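/- Let $n\ge 1$ and let $\mathbb H^n=\mathbb R^{2n+1}$ be the Heisenberg group, with points $x=(x_1,\dots,x_{2n},t)$, horizontal vector fields $X_i=\partial_{x_i}-\frac{x_{n+i}}2\partial_t$, $X_{n+i}=\partial_{x_{n+i}}+\frac{x_i}2\partial_t$ $(1\le i\le n)$, horizontal gradient $\mathfrak X u=(X_1u,\dots,X_{2n}u)$, horizontal divergence $\operatorname{div}_H F=\sum_{i=1}^{2n}X_iF_i$, homogeneous dimension $Q=2n+2$, Lebesgue measure, Carnot–Carathéodory distance $d$ (the infimum of the lengths of horizontal curves joining two points, where $X_1,\dots,X_{2n}$ are orthonormal) and its open balls $B_r(x)$. For open $U$ and $1\le p<\infty$, $HW^{1,p}(U)$ is the space of $u\in L^p(U)$ whose distributional horizontal gradient is in $L^p(U,\mathbb R^{2n})$, with norm $\|u\|_{L^p(U)}+\|\mathfrak X u\|_{L^p(U)}$, and $HW^{1,p}_0(U)$ is the closure of $C_0^\infty(U)$ in it. A weak solution in $U$ of $-\operatorname{div}_H A(x,\mathfrak X u)=\mu$ is a $u\in HW^{1,p}(U)$ with $\int_U\langle A(x,\mathfrak X u),\mathfrak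 X\varphi\rangle\,dx=\int\varphi\,d\mu$ for all $\varphi\in C_0^\infty(U)$. Let $p\ge 2$ and $L\ge 1$. There is a constant $c=c(n,p,L)>0$ such that the following holds. Let $L'\ge 1$, $s\ge 0$, $\alpha\in(0,1]$, let $\Omega\subseteq\mathbb H^n$ be a domain, and let $\mu$ be a signed Radon measure on $\mathbb H^n$ with $|\mu|(\Omega)<\infty$ and $|\mu|(\mathbb H^n\setminus\Omega)=0$. Let $a:\Omega\times\mathbb R^{2n}\to\mathbb R^{2n}$ be continuous, $C^1$ in its second variable $z$, with $D_za(x,z)$ symmetric, and such that for all $x,y\in\Omega$ and $z,\xi\in\mathbb R^{2n}$ $$(|z|^2+s^2)^{\frac{p-2}2}|\xi|^2\le\langle D_za(x,z)\xi,\xi\rangle\le L(|z|^2+s^2)^{\frac{p-2}2}|\xi|^2,$$ $$|a(x,z)-a(y,z)|\le L'|z|(|z|^2+s^2)^{\frac{p-2}2}d(x,y)^\alpha.$$ Let $u\in HW^{1,p}(\Omega)$ be a weak solution of $-\operatorname{div}_H a(x,\mathfrak X u)=\mu$ in $\Omega$. Let $x_0\in\Omega$ and $R>0$ with $B_{2R}\subseteq\Omega$,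 where $B_r=B_r(x_0)$. Let $w\in HW^{1,p}(B_{2R})$ be a weak solution of $\operatorname{div}_H a(x,\mathfrak X w)=0$ in $B_{2R}$ with $w-u\in HW^{1,p}_0(B_{2R})$, and let $v\in HW^{1,p}(B_R)$ be a weak solution of $\operatorname{div}_H a(x_0,\mathfrak X v)=0$ in $B_R$ with $v-w\in HW^{1,p}_0(B_R)$. Then $$\frac1{|B_R|}\int_{B_R}|\mathfrak X v-\mathfrak X u|\,dx\le c\bigl(1+(L'R^\alpha)^{\frac2p}\bigr)\Bigl(\frac{|\mu|(B_{2R})}{R^{Q-1}}\Bigr)^{\frac1{p-1}}+c\,(L'R^\alpha)^{\frac2p}\frac1{|B_{2R}|}\int_{B_{2R}}(|\mathfrak X u|+s)\,dx,$$ where $|E|$ denotes the Lebesgue measure of $E$. -/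

import Mathlib

open MeasureTheory Set
open scoped ENNReal

namespace Heis

noncomputable section

/-- The horizontal layer `ℝ^{2n}` with its Euclidean norm. The index `inl i` is the coordinate
number `i` and the index `inr i` is the coordinate number `n + i`, for `1 ≤ i ≤ n`. -/
abbrev Hor (n : ℕ) : Type := EuclideanSpace ℝ (Fin n ⊕ Fin n)

/-- The underlying space `ℝ^{2n+1}` of the Heisenberg group: points `(x₁, …, x_{2n}, t)`. Its
topology, differentiable structure and measure `volume` are those of `ℝ^{2n+1}`. The (product)
norm on this type plays no role. -/
abbrev Pt (n : ℕ) : Type := Hor n × ℝ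

/-- The homogeneous dimension `Q = 2n + 2`. -/
def homDim (n : ℕ) : ℕ := 2 * n + 2

/-- The left invariant horizontal vector fields
`X_i = ∂_{x_i} - (x_{n+i} / 2) ∂_t` and `X_{n+i} = ∂_{x_{n+i}} + (x_i / 2) ∂_t`. -/
def hfield {n : ℕ} (i : Fin n ⊕ Fin n) (x : Pt n) : Pt n :=
  (EuclideanSpace.single i (1 : ℝ),
    match i with
    | Sum.inl j => -(x.1 (Sum.inr j)) / 2
    | Sum.inr j => x.1 (Sum.inl j) / 2)

/-- The horizontal gradient `(X₁ φ, …, X_{2n} φ)` of a smooth function. -/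
def hgrad {n : ℕ} (φ : Pt n → ℝ) (x : Pt n) : Hor n :=
  WithLp.toLp 2 fun i => fderiv ℝ φ x (hfield i x)

/-- `γ`, restricted to `[0, 1]`, is an absolutely continuous horizontal curve from `x` to `y`,
with integrable horizontal velocity `h`: it is the integral of its derivative
`γ' = ∑ i, h i • X_i (γ)`. -/
def IsHorizontalCurve {n : ℕ} (γ : ℝ → Pt n) (h : ℝ → Hor n) (x y : Pt n) : Prop :=
  ContinuousOn γ (Icc 0 1) ∧ IntervalIntegrable h volume 0 1 ∧ γ 0 = x ∧ γ 1 = y ∧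
    ∀ t ∈ Icc (0 : ℝ) 1, γ t = γ 0 + ∫ τ in (0 : ℝ)..t, ∑ i, h τ i • hfield i (γ τ)

/-- The Carnot-Carathéodory distance: the infimum of the lengths `∫ |h|` of the horizontal
curves from `x` to `y`, the fields `X₁, …, X_{2n}` being orthonormal. -/
def ccDist {n : ℕ} (x y : Pt n) : ℝ :=
  sInf {l : ℝ | ∃ (γ : ℝ → Pt n) (h : ℝ → Hor n),
    IsHorizontalCurve γ h x y ∧ l = ∫ τ in (0 : ℝ)..1, ‖h τ‖}

/-- The open ball `B_r(x)` of the Carnot-Carathéodory distance. -/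
def ccBall {n : ℕ} (x : Pt n) (r : ℝ) : Set (Pt n) := {y | ccDist x y < r}

/-- `φ ∈ C_0^∞(U)`: smooth, with compact support contained in `U`. -/
def IsTest {n : ℕ} (U : Set (Pt n)) (φ : Pt n → ℝ) : Prop :=
  ContDiff ℝ (⊤ : ℕ∞) φ ∧ HasCompactSupport φ ∧ tsupport φ ⊆ U

/-- `u ∈ HW^{1,p}(U)` with distributional horizontal gradient `Du`. (The fields `X_i` are
divergence free, so that the formal adjoint of `X_i` is `-X_i`.) -/
def MemHW {n : ℕ} (p : ℝ) (U : Set (Pt n)) (u : Pt n → ℝ) (Du : Pt n → Hor n) : Prop :=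
  MemLp u (ENNReal.ofReal p) (volume.restrict U) ∧
  MemLp Du (ENNReal.ofReal p) (volume.restrict U) ∧
  ∀ φ : Pt n → ℝ, IsTest U φ → ∀ i,
    ∫ x in U, u x * hgrad φ x i = -∫ x in U, Du x i * φ x

/-- `u ∈ HW_0^{1,p}(U)`, with horizontal gradient `Du`: `u` belongs to the closure of
`C_0^∞(U)` in `HW^{1,p}(U)`. -/
def MemHWZero {n : ℕ} (p : ℝ) (U : Set (Pt n)) (u : Pt n → ℝ) (Du : Pt n → Hor n) : Prop :=
  MemHW p U u Du ∧
  ∀ ε : ℝ≥0∞, 0 < ε → ∃ φ : Pt n → ℝ, IsTest U φ ∧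
    eLpNorm (fun x => u x - φ x) (ENNReal.ofReal p) (volume.restrict U) +
      eLpNorm (fun x => Du x - hgrad φ x) (ENNReal.ofReal p) (volume.restrict U) < ε

/-- The integral `∫ φ dμ` against a signed measure, through its Jordan decomposition. -/
def signedIntegral {n : ℕ} (μ : SignedMeasure (Pt n)) (φ : Pt n → ℝ) : ℝ :=
  ∫ x, φ x ∂μ.toJordanDecomposition.posPart - ∫ x, φ x ∂μ.toJordanDecomposition.negPart

/-- `u ∈ HW^{1,p}(U)`, with horizontal gradient `Du`, is a weak solution of
`-div_H A(x, 𝔛u) = μ` in `U`. -/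
def IsWeakSolution {n : ℕ} (p : ℝ) (U : Set (Pt n)) (A : Pt n → Hor n → Hor n)
    (μ : SignedMeasure (Pt n)) (u : Pt n → ℝ) (Du : Pt n → Hor n) : Prop :=
  MemHW p U u Du ∧
  ∀ φ : Pt n → ℝ, IsTest U φ →
    ∫ x in U, inner ℝ (A x (Du x)) (hgrad φ x) = signedIntegral μ φ

/-- The structural assumptions on `a : Ω × ℝ^{2n} → ℝ^{2n}`: it is continuous, `C¹` in the
gradient variable with symmetric derivative `D_z a`, elliptic with growth exponent `p - 1`, and
Hölder continuous in `x` with respect to the Carnot-Carathéodory distance. -/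
structure StructureCondition {n : ℕ} (Ω : Set (Pt n)) (a : Pt n → Hor n → Hor n)
    (p L L' s α : ℝ) : Prop where
  continuousOn : ContinuousOn (fun q : Pt n × Hor n => a q.1 q.2) (Ω ×ˢ univ)
  contDiff : ∀ x ∈ Ω, ContDiff ℝ 1 (a x)
  symmetric : ∀ x ∈ Ω, ∀ z ξ η : Hor n,
    inner ℝ (fderiv ℝ (a x) z ξ) η = inner ℝ ξ (fderiv ℝ (a x) z η)
  lower : ∀ x ∈ Ω, ∀ z ξ : Hor n,
    (‖z‖ ^ 2 + s ^ 2) ^ ((p - 2) / 2) * ‖ξ‖ ^ 2 ≤ inner ℝ (fderiv ℝ (a x) z ξ) ξ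
  upper : ∀ x ∈ Ω, ∀ z ξ : Hor n,
    inner ℝ (fderiv ℝ (a x) z ξ) ξ ≤ L * (‖z‖ ^ 2 + s ^ 2) ^ ((p - 2) / 2) * ‖ξ‖ ^ 2
  holder : ∀ x ∈ Ω, ∀ y ∈ Ω, ∀ z : Hor n,
    ‖a x z - a y z‖ ≤ L' * ‖z‖ * (‖z‖ ^ 2 + s ^ 2) ^ ((p - 2) / 2) * ccDist x y ^ α

end

end Heis

/-!
The function `v - u` is split at `w`, and each difference is estimated in `L^1` by testing the
difference of two equations.

*The difference `w - u`* (`exists_comparison_measure`). Testing with a truncation of `w - u` at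
height `k` and using the strict monotonicity of `a(x, ·)` bounds the energy of the truncation by a
multiple of `k |μ|(B_{2R})` (`lintegral_trunc_energy_le`). This linear growth in `k` yields the
decay of the level sets of `w - u` (`exists_volume_level_le`). Hölder's inequality on the dyadic
shells `2^j k₀ < |w - u| ≤ 2^(j+1) k₀` then gives a geometric series for the `L^1` norm of the
gradient, which converges because `p ≥ 2` (`exists_lintegral_grad_le`).

*The difference `v - w`* (`exists_comparison_frozen`). Testing both homogeneous equations with
`v - w` bounds `‖𝔛 v - 𝔛 w‖_p^p` by the square of the oscillation `L' R^α` of the coefficients times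
the integral of `(|𝔛 w| + s)^p` over `B_R` (`StructureCondition.frozen_comparison`,
`lintegral_frozen_energy_le`). This integral is controlled by the `L^1` norm on `B_{2R}` through a
reverse Hölder inequality down to the exponent one (`exists_reverse_holder`): the Caccioppoli estimate combined with the
interpolation of `L^p` between `L^1` and the gradient, with absorption, and then the Poincaré
inequality. Finally `𝔛 w` is replaced by `𝔛 u` at the cost of the first estimate.

*Analysis on the group.* No Sobolev embedding is used. Carnot-Carathéodory balls are comparable with
left translates of homogeneous boxes: the identity is joined to each point of a box by an explicit
polynomial horizontal curve whose speed is of the order of the radius (`link`). Integrating along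
these curves shows that a function differs from its right translates by elements of a box of radius
`r` by at most a multiple of `r ‖𝔛 f‖_p` in `L^p` (`lintegral_translate_sub_le`). From this single
inequality follow a Nash type inequality (`nash_of_translate`), the weak type estimate behind the
decay of level sets (`weak_type_of_translate`), and the Poincaré inequalities with and without
boundary values (`TestLimit.lintegral_rpow_le`, `MemHW.exists_poincare`). It passes from smooth to
Sobolev functions by convolution on the left, which commutes with the left invariant horizontal
fields (`MemHW.exists_smooth_approx`).
-/

namespace Heis

noncomputable section

/-! ### The group law and homogeneous boxes -/

section

/-- The complex structure `J` of the horizontal layer, `J (x, y) = (-y, x)`. -/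
def rot {n : ℕ} : Hor n →L[ℝ] Hor n :=
  LinearMap.toContinuousLinearMap
    { toFun := fun x =>
        WithLp.toLp 2 (Sum.elim (fun i => -x (Sum.inr i)) (fun i => x (Sum.inl i)))
      map_add' := by
        intro x y; ext i; rcases i with i | i <;> simp; ring
      map_smul' := by
        intro c x; ext i; rcases i with i | i <;> simp }

/-- The symplectic form `ω(x, z) = ⟨J x, z⟩` of the horizontal layer. -/
def symp {n : ℕ} (x z : Hor n) : ℝ := inner ℝ (rot x) z

variable {n : ℕ}

@[simp] lemma rot_inl (x : Hor n) (i : Fin n) : rot x (Sum.inl i) = -x (Sum.inr i) := rfl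
@[simp] lemma rot_inr (x : Hor n) (i : Fin n) : rot x (Sum.inr i) = x (Sum.inl i) := rfl

lemma norm_rot (x : Hor n) : ‖rot x‖ = ‖x‖ := by
  rw [EuclideanSpace.norm_eq, EuclideanSpace.norm_eq, Fintype.sum_sum_type, Fintype.sum_sum_type]
  simp [add_comm]

@[simp] lemma symp_self (x : Hor n) : symp x x = 0 := by
  simp [symp, PiLp.inner_apply, Fintype.sum_sum_type, mul_comm]

lemma symp_add_left (x y z : Hor n) : symp (x + y) z = symp x z + symp y z := by
  simp [symp, inner_add_left]
lemma symp_add_right (x y z : Hor n) : symp x (y + z) = symp x y + symp x z := by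
  simp [symp, inner_add_right]
lemma symp_smul_left (c : ℝ) (x z : Hor n) : symp (c • x) z = c * symp x z := by
  simp [symp, inner_smul_left]
lemma symp_smul_right (c : ℝ) (x z : Hor n) : symp x (c • z) = c * symp x z := by
  simp [symp, inner_smul_right]
lemma symp_neg_left (x z : Hor n) : symp (-x) z = -symp x z := by
  simp [symp]
lemma symp_neg_right (x z : Hor n) : symp x (-z) = -symp x z := by
  simp [symp]
lemma symp_sub_left (x y z : Hor n) : symp (x - y) z = symp x z - symp y z := by
  simp [symp, inner_sub_left]
@[simp] lemma symp_zero_left (z : Hor n) : symp 0 z = 0 := by simp [symp]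
@[simp] lemma symp_zero_right (z : Hor n) : symp z 0 = 0 := by simp [symp]

lemma symp_swap (x z : Hor n) : symp x z = -symp z x := by
  have h := symp_self (x + z)
  rw [symp_add_left, symp_add_right, symp_add_right, symp_self, symp_self] at h
  linarith

lemma abs_symp_le (x z : Hor n) : |symp x z| ≤ ‖x‖ * ‖z‖ := by
  have := abs_real_inner_le_norm (rot x) z
  rwa [norm_rot] at this

@[fun_prop] lemma ContDiff.symp {E : Type*} [NormedAddCommGroup E] [NormedSpace ℝ E]
    {k : WithTop ℕ∞} {f g : E → Hor n} (hf : ContDiff ℝ k f) (hg : ContDiff ℝ k g) :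
    ContDiff ℝ k (fun x => Heis.symp (f x) (g x)) := by
  unfold Heis.symp
  exact ((rot (n := n)).contDiff.comp hf).inner ℝ hg

@[fun_prop] lemma Continuous.symp {E : Type*} [TopologicalSpace E]
    {f g : E → Hor n} (hf : Continuous f) (hg : Continuous g) :
    Continuous (fun x => Heis.symp (f x) (g x)) := by
  unfold Heis.symp; fun_prop

lemma HasDerivAt.symp {f g : ℝ → Hor n} {f' g' : Hor n} {s : ℝ}
    (hf : HasDerivAt f f' s) (hg : HasDerivAt g g' s) :
    HasDerivAt (fun x => Heis.symp (f x) (g x)) (Heis.symp (f s) g' + Heis.symp f' (g s)) s := by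
  unfold Heis.symp
  exact HasDerivAt.inner ℝ ((rot (n := n)).hasFDerivAt.comp_hasDerivAt s hf) hg

/-- The horizontal tangent vector at `x` with horizontal coordinates `z`. -/
def hlift (x : Pt n) (z : Hor n) : Pt n := (z, symp x.1 z / 2)

lemma hfield_eq (i : Fin n ⊕ Fin n) (x : Pt n) :
    hfield i x = hlift x (EuclideanSpace.single i 1) := by
  unfold hfield hlift
  congr 1
  simp only [symp, EuclideanSpace.inner_single_right]
  rcases i with i | i <;> simp

lemma hlift_add (x : Pt n) (z z' : Hor n) : hlift x (z + z') = hlift x z + hlift x z' := by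
  ext1 <;> simp [hlift, symp_add_right, add_div]

lemma hlift_smul (x : Pt n) (c : ℝ) (z : Hor n) : hlift x (c • z) = c • hlift x z := by
  ext1 <;> simp [hlift, symp_smul_right, mul_div_assoc]

lemma sum_smul_single (z : Hor n) :
    ∑ i, z i • (EuclideanSpace.single i (1 : ℝ) : Hor n) = z := by
  ext j
  rcases j with j | j <;> simp [Pi.single_apply]

lemma sum_hfield (x : Pt n) (z : Hor n) : ∑ i, z i • hfield i x = hlift x z := by
  let T : Hor n →ₗ[ℝ] Pt n :=
    { toFun := hlift x, map_add' := hlift_add x, map_smul' := hlift_smul x }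
  have : T (∑ i, z i • (EuclideanSpace.single i (1 : ℝ) : Hor n)) = T z := by
    rw [sum_smul_single]
  rw [map_sum] at this
  simpa [T, hfield_eq, hlift_smul] using this

/-- The horizontal gradient represents the differential on horizontal vectors. -/
lemma inner_hgrad (φ : Pt n → ℝ) (x : Pt n) (z : Hor n) :
    inner ℝ (hgrad φ x) z = fderiv ℝ φ x (hlift x z) := by
  rw [← sum_hfield, map_sum]
  simp [hgrad, PiLp.inner_apply]

@[simp] lemma hgrad_apply (φ : Pt n → ℝ) (x : Pt n) (i : Fin n ⊕ Fin n) :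
    hgrad φ x i = fderiv ℝ φ x (hfield i x) := rfl

/-- The group law of the Heisenberg group. The inverse of `x` is `-x`. -/
def mul (x h : Pt n) : Pt n := (x.1 + h.1, x.2 + h.2 + symp x.1 h.1 / 2)

@[simp] lemma mul_fst (x h : Pt n) : (mul x h).1 = x.1 + h.1 := rfl
@[simp] lemma mul_snd (x h : Pt n) : (mul x h).2 = x.2 + h.2 + symp x.1 h.1 / 2 := rfl

lemma mul_assoc' (x y z : Pt n) : mul (mul x y) z = mul x (mul y z) := by
  ext1
  · simp [add_assoc]
  · simp [symp_add_left, symp_add_right]; ring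

@[simp] lemma mul_zero' (x : Pt n) : mul x 0 = x := by ext1 <;> simp
@[simp] lemma zero_mul' (x : Pt n) : mul 0 x = x := by ext1 <;> simp
@[simp] lemma mul_neg_self (x : Pt n) : mul x (-x) = 0 := by ext1 <;> simp [symp_neg_right]
@[simp] lemma neg_mul_self (x : Pt n) : mul (-x) x = 0 := by ext1 <;> simp [symp_neg_left]
@[simp] lemma neg_mul_cancel (x y : Pt n) : mul (-x) (mul x y) = y := by simp [← mul_assoc']
@[simp] lemma mul_neg_cancel (x y : Pt n) : mul x (mul (-x) y) = y := by simp [← mul_assoc']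
lemma neg_mul' (x y : Pt n) : -(mul x y) = mul (-y) (-x) := by
  ext1
  · simp [add_comm]
  · simp [symp_neg_left, symp_neg_right, symp_swap y.1 x.1]; ring

@[fun_prop] lemma ContDiff.hmul {E : Type*} [NormedAddCommGroup E] [NormedSpace ℝ E]
    {k : WithTop ℕ∞} {f g : E → Pt n} (hf : ContDiff ℝ k f) (hg : ContDiff ℝ k g) :
    ContDiff ℝ k (fun x => mul (f x) (g x)) := by
  unfold mul; fun_prop

@[fun_prop] lemma Continuous.hmul {E : Type*} [TopologicalSpace E]
    {f g : E → Pt n} (hf : Continuous f) (hg : Continuous g) :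
    Continuous (fun x => mul (f x) (g x)) := by
  unfold mul; fun_prop

@[fun_prop] lemma Measurable.hmul {E : Type*} [MeasurableSpace E]
    {f g : E → Pt n} (hf : Measurable f) (hg : Measurable g) :
    Measurable (fun x => mul (f x) (g x)) := by
  have : Continuous (fun q : Pt n × Pt n => mul q.1 q.2) := by fun_prop
  exact this.measurable.comp (hf.prodMk hg)

/-- Translations of the group are translations of the horizontal variables combined with a shear
of the central one; hence Lebesgue measure is left and right invariant. -/
lemma measurePreserving_shear (c : Hor n) {g : Hor n → ℝ} (hg : Continuous g) :
    MeasurePreserving (fun x : Pt n => ((x.1 + c, x.2 + g x.1) : Pt n)) volume volume := by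
  refine MeasurePreserving.skew_product (g := fun a t => t + g a)
    (measurePreserving_add_right volume c) ?_ ?_
  · exact (continuous_snd.add (hg.comp continuous_fst)).measurable
  · exact Filter.Eventually.of_forall fun a => map_add_right_eq_self volume (g a)

lemma measurePreserving_mul_right (h : Pt n) :
    MeasurePreserving (fun x => mul x h) volume volume := by
  have := measurePreserving_shear h.1 (g := fun a => h.2 + symp a h.1 / 2) (by fun_prop)
  convert this using 2 with x
  ext1 <;> simp; ring

lemma measurePreserving_mul_left (y : Pt n) :
    MeasurePreserving (mul y) volume volume := by
  have := measurePreserving_shear y.1 (g := fun a => y.2 + symp y.1 a / 2) (by fun_prop)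
  convert this using 2 with x
  ext1 <;> simp [add_comm]; ring

/-- The homogeneous box of radius `r` centred at the identity. The height `r ^ 2` reflects that
the central variable has weight two, so that boxes are adapted to the dilations of the group. -/
def box (n : ℕ) (r : ℝ) : Set (Pt n) := Metric.ball 0 r ×ˢ Metric.ball 0 (r ^ 2)

/-- The left translate by `x` of the homogeneous box of radius `r`. -/
def cbox (x : Pt n) (r : ℝ) : Set (Pt n) := {y | mul (-x) y ∈ box n r}

lemma mem_box {r : ℝ} {h : Pt n} : h ∈ box n r ↔ ‖h.1‖ < r ∧ |h.2| < r ^ 2 := by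
  simp [box]

lemma isOpen_box (r : ℝ) : IsOpen (box n r) := Metric.isOpen_ball.prod Metric.isOpen_ball

lemma isOpen_cbox (x : Pt n) (r : ℝ) : IsOpen (cbox x r) :=
  (isOpen_box r).preimage (by fun_prop : Continuous fun y => mul (-x) y)

lemma box_mono {r s : ℝ} (hrs : r ≤ s) : box n r ⊆ box n s := by
  intro h hh
  rw [mem_box] at hh ⊢
  have h0 : 0 ≤ r := (norm_nonneg _).trans hh.1.le
  exact ⟨hh.1.trans_le hrs, hh.2.trans_le (by gcongr)⟩

lemma cbox_mono (x : Pt n) {r s : ℝ} (hrs : r ≤ s) : cbox x r ⊆ cbox x s :=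
  fun _ hy => box_mono hrs hy

lemma neg_mem_box {r : ℝ} {h : Pt n} (hh : h ∈ box n r) : -h ∈ box n r := by
  simpa [mem_box] using hh

/-- Boxes satisfy the triangle inequality: the cross term `ω / 2` of the group law is absorbed by
`(r + s) ^ 2 - r ^ 2 - s ^ 2`. -/
lemma mul_mem_box {r s : ℝ} {g h : Pt n} (hg : g ∈ box n r) (hh : h ∈ box n s) :
    mul g h ∈ box n (r + s) := by
  rw [mem_box] at *
  have h0 : 0 ≤ r := (norm_nonneg _).trans hg.1.le
  have h1 : 0 ≤ s := (norm_nonneg _).trans hh.1.le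
  refine ⟨(norm_add_le _ _).trans_lt (add_lt_add hg.1 hh.1), ?_⟩
  have h2 := abs_symp_le g.1 h.1
  have h3 : ‖g.1‖ * ‖h.1‖ ≤ r * s := mul_le_mul hg.1.le hh.1.le (norm_nonneg _) h0
  have h4 := abs_add_three g.2 h.2 (symp g.1 h.1 / 2)
  rw [abs_div, abs_two] at h4
  simp only [mul_snd]
  nlinarith [mul_nonneg h0 h1, hg.2, hh.2]

lemma mem_cbox_comm {x y : Pt n} {r : ℝ} : x ∈ cbox y r ↔ y ∈ cbox x r := by
  have key : ∀ a b : Pt n, a ∈ cbox b r → b ∈ cbox a r := by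
    intro a b h
    have := neg_mem_box h
    rwa [neg_mul', neg_neg] at this
  exact ⟨key _ _, key _ _⟩

lemma mul_mem_cbox {x y h : Pt n} {r s : ℝ} (hy : y ∈ cbox x r) (hh : h ∈ box n s) :
    mul y h ∈ cbox x (r + s) := by
  have := mul_mem_box hy hh
  rwa [mul_assoc'] at this

lemma self_mem_cbox (x : Pt n) {r : ℝ} (hr : 0 < r) : x ∈ cbox x r := by
  have : mul (-x) x ∈ box n r := by rw [neg_mul_self]; simp [mem_box, hr]
  exact this

/-- The Lebesgue measure of the homogeneous box of radius one. -/
def boxVol (n : ℕ) : ℝ := 2 * (volume (Metric.ball (0 : Hor n) 1)).toReal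

lemma boxVol_pos (n : ℕ) : 0 < boxVol n := by
  have : 0 < (volume (Metric.ball (0 : Hor n) 1)).toReal :=
    ENNReal.toReal_pos (Metric.measure_ball_pos _ _ one_pos).ne' measure_ball_lt_top.ne
  unfold boxVol; positivity

lemma volume_box {r : ℝ} (hr : 0 < r) :
    volume (box n r) = ENNReal.ofReal (boxVol n * r ^ homDim n) := by
  rw [box, Measure.volume_eq_prod, Measure.prod_prod, Measure.addHaar_ball_of_pos _ _ hr,
    Real.volume_ball]
  have h1 : Module.finrank ℝ (Hor n) = 2 * n := by simp; ring
  rw [h1, ← ENNReal.ofReal_toReal (measure_ball_lt_top (μ := volume) (x := (0 : Hor n)) (r := 1)).ne,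
    ← ENNReal.ofReal_mul (by positivity), ← ENNReal.ofReal_mul (by positivity)]
  congr 1
  unfold boxVol homDim
  ring

lemma volume_cbox (x : Pt n) {r : ℝ} (hr : 0 < r) :
    volume (cbox x r) = ENNReal.ofReal (boxVol n * r ^ homDim n) := by
  rw [← volume_box hr]
  exact (measurePreserving_mul_left (-x)).measure_preimage (isOpen_box r).measurableSet.nullMeasurableSet

end

/-! ### Horizontal curves and the Carnot-Carathéodory distance -/

section

variable {n : ℕ}

/-- The amplitude of the closed loop that is added to a segment in `link`. The lifted curve ends at
height `A r / 30 - r ω(h.1, e) / 6` when the amplitude is `A` and `e` spans the second direction of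
the loop; the value below makes this equal to `h.2`. -/
def linkAmp (i₀ : Fin n) (r : ℝ) (h : Pt n) : ℝ :=
  30 * h.2 / r + 5 * symp h.1 (EuclideanSpace.single (Sum.inr i₀) 1)

/-- A polynomial horizontal curve from the identity to `h`. Its horizontal part `c` is the segment
`s • h.1` plus a closed loop in a symplectic plane, and its vertical part is the primitive of
`ω(c, c') / 2`. The area enclosed by the loop produces the height `h.2`. An explicit formula is used
because differences of functions are later integrated along these curves with `h` fixed, which
calls for continuity in the parameter and a uniform bound of the speed. -/
def link (i₀ : Fin n) (r : ℝ) (h : Pt n) (s : ℝ) : Pt n :=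
  (s • h.1 + (linkAmp i₀ r h * (s - 3 * s ^ 2 + 2 * s ^ 3)) •
      (EuclideanSpace.single (Sum.inl i₀) 1 : Hor n) +
    (r * (s - s ^ 2)) • (EuclideanSpace.single (Sum.inr i₀) 1 : Hor n),
   (linkAmp i₀ r h * symp h.1 (EuclideanSpace.single (Sum.inl i₀) 1) * (s ^ 4 - s ^ 3) -
      r * symp h.1 (EuclideanSpace.single (Sum.inr i₀) 1) * s ^ 3 / 3 +
      2 * linkAmp i₀ r h * r * (s ^ 3 / 3 - s ^ 4 / 2 + s ^ 5 / 5)) / 2)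

/-- The horizontal velocity of `link`. -/
def linkVel (i₀ : Fin n) (r : ℝ) (h : Pt n) (s : ℝ) : Hor n :=
  h.1 + (linkAmp i₀ r h * (1 - 6 * s + 6 * s ^ 2)) •
      (EuclideanSpace.single (Sum.inl i₀) 1 : Hor n) +
    (r * (1 - 2 * s)) • (EuclideanSpace.single (Sum.inr i₀) 1 : Hor n)

variable (i₀ : Fin n)

lemma symp_single : symp (EuclideanSpace.single (Sum.inl i₀) 1 : Hor n)
    (EuclideanSpace.single (Sum.inr i₀) 1) = 1 := by
  simp [symp, EuclideanSpace.inner_single_right]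

@[simp] lemma link_zero (r : ℝ) (h : Pt n) : link i₀ r h 0 = 0 := by
  ext1 <;> simp [link]

lemma link_one {r : ℝ} (hr : r ≠ 0) (h : Pt n) : link i₀ r h 1 = h := by
  ext1
  · simp [link]; norm_num
  · simp only [link, linkAmp]; field_simp; ring

@[fun_prop] lemma continuous_link (r : ℝ) (h : Pt n) : Continuous (link i₀ r h) := by
  unfold link; fun_prop

@[fun_prop] lemma continuous_linkVel (r : ℝ) (h : Pt n) : Continuous (linkVel i₀ r h) := by
  unfold linkVel; fun_prop

lemma hasDerivAt_link (r : ℝ) (h : Pt n) (s : ℝ) :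
    HasDerivAt (link i₀ r h) (hlift (link i₀ r h s) (linkVel i₀ r h s)) s := by
  have h1 : HasDerivAt (fun s => (link i₀ r h s).1) (linkVel i₀ r h s) s := by
    have e1 : HasDerivAt (fun s : ℝ => s • h.1) ((1 : ℝ) • h.1) s :=
      (hasDerivAt_id s).smul_const h.1
    have e2 : HasDerivAt (fun s : ℝ => linkAmp i₀ r h * (s - 3 * s ^ 2 + 2 * s ^ 3))
        (linkAmp i₀ r h * (1 - 6 * s + 6 * s ^ 2)) s := by
      have := ((((hasDerivAt_id s).sub ((hasDerivAt_pow 2 s).const_mul 3)).add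
        ((hasDerivAt_pow 3 s).const_mul 2)).const_mul (linkAmp i₀ r h))
      refine this.congr_deriv ?_
      push_cast; ring
    have e3 : HasDerivAt (fun s : ℝ => r * (s - s ^ 2)) (r * (1 - 2 * s)) s := by
      have := ((hasDerivAt_id s).sub (hasDerivAt_pow 2 s)).const_mul r
      refine this.congr_deriv ?_
      push_cast; ring
    have := (e1.add (e2.smul_const (EuclideanSpace.single (Sum.inl i₀) 1 : Hor n))).add
      (e3.smul_const (EuclideanSpace.single (Sum.inr i₀) 1 : Hor n))
    rw [one_smul] at this
    exact this
  have h2 : HasDerivAt (fun s => (link i₀ r h s).2)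
      (symp (link i₀ r h s).1 (linkVel i₀ r h s) / 2) s := by
    have := (((((hasDerivAt_pow 4 s).sub (hasDerivAt_pow 3 s)).const_mul
        (linkAmp i₀ r h * symp h.1 (EuclideanSpace.single (Sum.inl i₀) 1))).sub
      (((hasDerivAt_pow 3 s).const_mul
        (r * symp h.1 (EuclideanSpace.single (Sum.inr i₀) 1))).div_const 3)).add
      (((((hasDerivAt_pow 3 s).div_const 3).sub ((hasDerivAt_pow 4 s).div_const 2)).add
        ((hasDerivAt_pow 5 s).div_const 5)).const_mul (2 * linkAmp i₀ r h * r))).div_const 2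
    refine this.congr_deriv ?_
    simp only [link, linkVel, symp_add_left, symp_add_right, symp_smul_left, symp_smul_right,
      symp_self, symp_single, symp_swap (EuclideanSpace.single (Sum.inr i₀) 1 : Hor n)
        (EuclideanSpace.single (Sum.inl i₀) 1),
      symp_swap (EuclideanSpace.single (Sum.inl i₀) 1 : Hor n) h.1,
      symp_swap (EuclideanSpace.single (Sum.inr i₀) 1 : Hor n) h.1]
    push_cast; ring
  exact h1.prodMk h2

lemma hasDerivAt_mul_link (x : Pt n) (r : ℝ) (h : Pt n) (s : ℝ) :
    HasDerivAt (fun s => mul x (link i₀ r h s))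
      (hlift (mul x (link i₀ r h s)) (linkVel i₀ r h s)) s := by
  have h0 := hasDerivAt_link i₀ r h s
  have h1 : HasDerivAt (fun s => (link i₀ r h s).1) (linkVel i₀ r h s) s := h0.fst
  have h2 : HasDerivAt (fun s => (link i₀ r h s).2) _ s := h0.snd
  have h3 := HasDerivAt.symp (hasDerivAt_const s x.1) h1
  have := (h1.const_add x.1).prodMk ((h2.const_add x.2).add (h3.div_const 2))
  refine this.congr_deriv ?_
  ext1
  · simp [hlift]
  · simp [hlift, symp_add_left]; ring

/-- On a box of radius `r` the speed of the link is comparable with `r`: the amplitude is at most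
`35 r` because `|h.2| < r ^ 2`. -/
lemma norm_linkVel_le {r : ℝ} {h : Pt n} (hh : h ∈ box n r) {s : ℝ} (hs : s ∈ Icc (0 : ℝ) 1) :
    ‖linkVel i₀ r h s‖ ≤ 37 * r := by
  obtain ⟨h1, h2⟩ := mem_box.1 hh
  have hr : 0 < r := (norm_nonneg _).trans_lt h1
  have h3 := abs_symp_le h.1 (EuclideanSpace.single (Sum.inr i₀) 1)
  simp only [PiLp.norm_single, norm_one, mul_one] at h3
  have hA : |linkAmp i₀ r h| ≤ 35 * r := by
    unfold linkAmp
    refine (abs_add_le _ _).trans ?_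
    have : |30 * h.2 / r| ≤ 30 * r := by
      rw [abs_div, abs_mul, abs_of_pos hr, div_le_iff₀ hr]
      norm_num; nlinarith
    rw [abs_mul]
    norm_num at *
    linarith
  have hP : |1 - 6 * s + 6 * s ^ 2| ≤ 1 := by
    rw [abs_le]; constructor <;> nlinarith [hs.1, hs.2, sq_nonneg (2 * s - 1)]
  have hQ : |1 - 2 * s| ≤ 1 := by
    rw [abs_le]; constructor <;> linarith [hs.1, hs.2]
  have e1 : |linkAmp i₀ r h * (1 - 6 * s + 6 * s ^ 2)| ≤ 35 * r := by
    rw [abs_mul]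
    calc _ ≤ 35 * r * 1 := mul_le_mul hA hP (abs_nonneg _) (by positivity)
      _ = _ := mul_one _
  have e2 : |r * (1 - 2 * s)| ≤ r := by
    rw [abs_mul, abs_of_pos hr]
    calc _ ≤ r * 1 := by gcongr
      _ = _ := mul_one _
  unfold linkVel
  refine (norm_add₃_le).trans ?_
  rw [norm_smul, norm_smul, PiLp.norm_single, PiLp.norm_single]
  simp only [Real.norm_eq_abs, norm_one, mul_one]
  linarith

/-- The link from `x` to `mul x h` is a horizontal curve. -/
lemma isHorizontalCurve_link (x : Pt n) {r : ℝ} (hr : r ≠ 0) (h : Pt n) :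
    IsHorizontalCurve (fun s => mul x (link i₀ r h s)) (linkVel i₀ r h) x (mul x h) := by
  refine ⟨by fun_prop, (continuous_linkVel i₀ r h).intervalIntegrable _ _, by simp,
    by simp [link_one i₀ hr], fun t _ => ?_⟩
  simp only [sum_hfield]
  rw [intervalIntegral.integral_eq_sub_of_hasDerivAt
    (fun s _ => hasDerivAt_mul_link i₀ x r h s)]
  · simp
  · refine Continuous.intervalIntegrable ?_ _ _
    unfold hlift; fun_prop

lemma intervalIntegrable_symp {h c : ℝ → Hor n} {t : ℝ} (ht : 0 ≤ t)
    (hi : IntervalIntegrable h volume 0 t) (hc : ContinuousOn c (Icc 0 t)) :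
    IntervalIntegrable (fun τ => symp (c τ) (h τ)) volume 0 t := by
  rw [intervalIntegrable_iff, uIoc_of_le ht] at hi ⊢
  have a1 : AEStronglyMeasurable c (volume.restrict (Ioc 0 t)) :=
    (hc.aestronglyMeasurable measurableSet_Icc).mono_measure
      (Measure.restrict_mono Ioc_subset_Icc_self le_rfl)
  have a2 : AEStronglyMeasurable h (volume.restrict (Ioc 0 t)) := hi.aestronglyMeasurable
  have hm : AEStronglyMeasurable (fun τ => symp (c τ) (h τ)) (volume.restrict (Ioc 0 t)) :=
    (rot.continuous.comp_aestronglyMeasurable a1).inner a2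
  obtain ⟨C, hC⟩ := isCompact_Icc.exists_bound_of_continuousOn hc
  refine (hi.norm.const_mul C).mono' hm ?_
  refine (ae_restrict_mem measurableSet_Ioc).mono fun τ hτ => ?_
  refine (abs_symp_le _ _).trans ?_
  gcongr
  exact hC τ (Ioc_subset_Icc_self hτ)

lemma IsHorizontalCurve.intervalIntegrable_hlift {γ : ℝ → Pt n} {h : ℝ → Hor n} {x y : Pt n}
    (H : IsHorizontalCurve γ h x y) {t : ℝ} (ht : t ∈ Icc (0 : ℝ) 1) :
    IntervalIntegrable (fun τ => hlift (γ τ) (h τ)) volume 0 t := by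
  obtain ⟨hc, hi, -, -, -⟩ := H
  have hit : IntervalIntegrable h volume 0 t := by
    refine hi.mono_set ?_
    rw [uIcc_of_le ht.1, uIcc_of_le zero_le_one]
    exact Icc_subset_Icc_right ht.2
  have b2 := (intervalIntegrable_symp ht.1 hit
    ((continuous_fst.comp_continuousOn hc).mono (Icc_subset_Icc_right ht.2))).div_const 2
  rw [intervalIntegrable_iff] at hit b2 ⊢
  exact hit.prodMk b2

/-- A horizontal curve of length `l` stays in the boxes of radius larger than `l`. After a left
translation to the identity, the height of the curve is `∫ ω(c, c') / 2`, hence at most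
`l ^ 2 / 2`. -/
lemma IsHorizontalCurve.mem_cbox {γ : ℝ → Pt n} {h : ℝ → Hor n} {x y : Pt n}
    (H : IsHorizontalCurve γ h x y) {r : ℝ} (hr : ∫ τ in (0 : ℝ)..1, ‖h τ‖ < r)
    {t : ℝ} (ht : t ∈ Icc (0 : ℝ) 1) : γ t ∈ cbox x r := by
  obtain ⟨hc, hi, h0, h1, hγ⟩ := id H
  simp only [sum_hfield, h0] at hγ
  set l := ∫ τ in (0 : ℝ)..1, ‖h τ‖ with hl
  have hl0 : 0 ≤ l := intervalIntegral.integral_nonneg zero_le_one fun _ _ => norm_nonneg _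
  have hsub : ∀ t ∈ Icc (0 : ℝ) 1, uIcc 0 t ⊆ uIcc (0 : ℝ) 1 := fun t ht => by
    rw [uIcc_of_le ht.1, uIcc_of_le zero_le_one]; exact Icc_subset_Icc_right ht.2
  have hc1 : ContinuousOn (fun s => (γ s).1) (Icc 0 1) := continuous_fst.comp_continuousOn hc
  have hii : ∀ t ∈ Icc (0 : ℝ) 1, IntervalIntegrable h volume 0 t := fun t ht =>
    hi.mono_set (hsub t ht)
  have hnn : ∀ t ∈ Icc (0 : ℝ) 1, ∫ τ in (0 : ℝ)..t, ‖h τ‖ ≤ l := fun t ht => by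
    refine intervalIntegral.integral_mono_interval le_rfl ht.1 ht.2
      (Filter.Eventually.of_forall fun _ => norm_nonneg _) hi.norm
  have hsi : ∀ c : ℝ → Hor n, ContinuousOn c (Icc 0 1) → ∀ t ∈ Icc (0 : ℝ) 1,
      IntervalIntegrable (fun τ => symp (c τ) (h τ)) volume 0 t := fun c hcc t ht =>
    intervalIntegrable_symp ht.1 (hii t ht) (hcc.mono (Icc_subset_Icc_right ht.2))
  have hli : ∀ t ∈ Icc (0 : ℝ) 1,
      IntervalIntegrable (fun τ => hlift (γ τ) (h τ)) volume 0 t := fun t ht =>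
    H.intervalIntegrable_hlift ht
  have hfst : ∀ t ∈ Icc (0 : ℝ) 1, (γ t).1 = x.1 + ∫ τ in (0 : ℝ)..t, h τ := by
    intro t ht
    conv_lhs => rw [hγ t ht]
    have := (ContinuousLinearMap.fst ℝ (Hor n) ℝ).intervalIntegral_comp_comm (hli t ht)
    simp only [ContinuousLinearMap.coe_fst', hlift] at this
    simp [hlift, this]
  have hsnd : (γ t).2 = x.2 + ∫ τ in (0 : ℝ)..t, symp (γ τ).1 (h τ) / 2 := by
    conv_lhs => rw [hγ t ht]
    have := (ContinuousLinearMap.snd ℝ (Hor n) ℝ).intervalIntegral_comp_comm (hli t ht)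
    simp only [ContinuousLinearMap.coe_snd', hlift] at this
    simp [hlift, this]
  have hdist : ∀ t ∈ Icc (0 : ℝ) 1, ‖(γ t).1 - x.1‖ ≤ l := by
    intro t ht
    rw [hfst t ht, add_sub_cancel_left]
    exact (intervalIntegral.norm_integral_le_integral_norm ht.1).trans (hnn t ht)
  have hx : symp x.1 ((γ t).1 - x.1) = ∫ τ in (0 : ℝ)..t, symp x.1 (h τ) := by
    rw [hfst t ht, add_sub_cancel_left]
    exact (((innerSL ℝ (rot x.1)).intervalIntegral_comp_comm (hii t ht))).symm
  have hkey : (γ t).2 - x.2 - symp x.1 (γ t).1 / 2 =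
      (∫ τ in (0 : ℝ)..t, symp ((γ τ).1 - x.1) (h τ)) / 2 := by
    have e1 : symp x.1 (γ t).1 = symp x.1 ((γ t).1 - x.1) := by
      simp [symp, inner_sub_right]
      have := symp_self x.1
      rw [symp] at this
      rw [this, sub_zero]
    simp only [symp_sub_left]
    rw [intervalIntegral.integral_sub (hsi _ hc1 t ht) (hsi _ continuousOn_const t ht), hsnd,
      intervalIntegral.integral_div, e1, hx]
    ring
  have hb : |∫ τ in (0 : ℝ)..t, symp ((γ τ).1 - x.1) (h τ)| ≤ l * l := by
    have : |∫ τ in (0 : ℝ)..t, symp ((γ τ).1 - x.1) (h τ)| ≤ ∫ τ in (0 : ℝ)..t, l * ‖h τ‖ := by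
      rw [← Real.norm_eq_abs]
      refine intervalIntegral.norm_integral_le_of_norm_le ht.1 ?_ ((hii t ht).norm.const_mul l)
      refine Filter.Eventually.of_forall fun τ hτ => (abs_symp_le _ _).trans ?_
      gcongr
      exact hdist τ ⟨hτ.1.le, hτ.2.trans ht.2⟩
    rw [intervalIntegral.integral_const_mul] at this
    exact this.trans (by gcongr; exact hnn t ht)
  refine mem_box.2 ⟨?_, ?_⟩
  · simp only [mul_fst, Prod.fst_neg, neg_add_eq_sub]
    exact (hdist t ht).trans_lt hr
  · have : (mul (-x) (γ t)).2 = (γ t).2 - x.2 - symp x.1 (γ t).1 / 2 := by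
      simp [symp_neg_left]; ring
    rw [this, hkey, abs_div, abs_two]
    nlinarith

/-- There is a horizontal curve of length `l` from `x` to `y`. -/
def Joined (x y : Pt n) (l : ℝ) : Prop :=
  ∃ (γ : ℝ → Pt n) (h : ℝ → Hor n),
    IsHorizontalCurve γ h x y ∧ l = ∫ τ in (0 : ℝ)..1, ‖h τ‖

lemma Joined.nonneg {x y : Pt n} {l : ℝ} (h : Joined x y l) : 0 ≤ l := by
  obtain ⟨γ, h, -, rfl⟩ := h
  exact intervalIntegral.integral_nonneg zero_le_one fun _ _ => norm_nonneg _

lemma exists_joined_of_mem_cbox [NeZero n] {x y : Pt n} {r : ℝ} (hy : y ∈ cbox x r) :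
    ∃ l ≤ 37 * r, Joined x y l := by
  have hh : mul (-x) y ∈ box n r := hy
  have hr : 0 < r := (norm_nonneg _).trans_lt (mem_box.1 hh).1
  have H := isHorizontalCurve_link 0 x hr.ne' (mul (-x) y)
  rw [mul_neg_cancel] at H
  refine ⟨_, ?_, _, _, H, rfl⟩
  have := intervalIntegral.norm_integral_le_of_norm_le_const (a := (0 : ℝ)) (b := 1)
    (f := fun s => ‖linkVel 0 r (mul (-x) y) s‖) (C := 37 * r) (fun s hs => by
      rw [uIoc_of_le zero_le_one] at hs
      rw [norm_norm]
      exact norm_linkVel_le 0 hh ⟨hs.1.le, hs.2⟩)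
  have h2 := (le_abs_self _).trans this
  simpa using h2

lemma exists_mem_cbox (x y : Pt n) : ∃ r, y ∈ cbox x r := by
  refine ⟨1 + ‖(mul (-x) y).1‖ + |(mul (-x) y).2|, mem_box.2 ⟨?_, ?_⟩⟩
  · linarith [abs_nonneg (mul (-x) y).2]
  · nlinarith [abs_nonneg (mul (-x) y).2, norm_nonneg (mul (-x) y).1,
      mul_nonneg (abs_nonneg (mul (-x) y).2) (norm_nonneg (mul (-x) y).1)]

lemma ccDist_le {x y : Pt n} {l : ℝ} (h : Joined x y l) : ccDist x y ≤ l :=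
  csInf_le ⟨0, fun _ hl => Joined.nonneg hl⟩ h

/-- Any two points are joined by a horizontal curve, so that the infimum defining `ccDist` is not
that of the empty set. -/
lemma exists_joined_lt [NeZero n] {x y : Pt n} {r : ℝ} (h : ccDist x y < r) :
    ∃ l < r, Joined x y l := by
  obtain ⟨ρ, hρ⟩ := exists_mem_cbox x y
  obtain ⟨l, -, hl⟩ := exists_joined_of_mem_cbox hρ
  obtain ⟨l', hl', hlr⟩ := exists_lt_of_csInf_lt (⟨l, hl⟩ : Set.Nonempty {l | Joined x y l}) h
  exact ⟨l', hlr, hl'⟩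

lemma ccDist_nonneg (x y : Pt n) : 0 ≤ ccDist x y :=
  Real.sInf_nonneg fun _ hl => Joined.nonneg hl

lemma ccBall_subset_cbox [NeZero n] (x : Pt n) (r : ℝ) : ccBall x r ⊆ cbox x r := by
  intro y hy
  obtain ⟨l, hl, γ, h, H, rfl⟩ := exists_joined_lt hy
  have := H.mem_cbox hl (right_mem_Icc.2 zero_le_one)
  rwa [H.2.2.2.1] at this

lemma cbox_subset_ccBall [NeZero n] (x : Pt n) (r : ℝ) : cbox x r ⊆ ccBall x (38 * r) := by
  intro y hy
  obtain ⟨l, hl, H⟩ := exists_joined_of_mem_cbox hy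
  have hr : 0 < r := (norm_nonneg _).trans_lt (mem_box.1 (show mul (-x) y ∈ box n r from hy)).1
  exact (ccDist_le H).trans_lt (by linarith)

end

/-! ### Concatenation of curves and Carnot-Carathéodory balls -/

section

variable {n : ℕ}

/-- The velocity of a concatenated curve, each half being run through at double speed. -/
def concatVel {E : Type*} [NormedAddCommGroup E] [NormedSpace ℝ E] (f g : ℝ → E) (τ : ℝ) : E :=
  if τ ≤ 1 / 2 then (2 : ℝ) • f (2 * τ) else (2 : ℝ) • g (2 * τ - 1)

section concat
variable {E : Type*} [NormedAddCommGroup E] [NormedSpace ℝ E] {f g : ℝ → E}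

lemma concatVel_eqOn_left {t : ℝ} (ht : t ≤ 1 / 2) :
    EqOn (fun τ => (2 : ℝ) • f (2 * τ)) (concatVel f g) (uIoc 0 t) := by
  intro τ hτ
  have : τ ≤ 1 / 2 := hτ.2.trans (max_le (by norm_num) ht)
  rw [concatVel, if_pos this]

lemma concatVel_eqOn_right {t : ℝ} (ht : 1 / 2 ≤ t) :
    EqOn (fun τ => (2 : ℝ) • g (2 * τ - 1)) (concatVel f g) (uIoc (1 / 2) t) := by
  intro τ hτ
  rw [uIoc_of_le ht] at hτ
  rw [concatVel, if_neg (not_le.2 hτ.1)]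

lemma intervalIntegrable_concatVel_left (hf : IntervalIntegrable f volume 0 1) :
    IntervalIntegrable (concatVel f g) volume 0 (1 / 2) := by
  have := (hf.comp_mul_left (c := 2)).smul (2 : ℝ)
  simp only [zero_div] at this
  exact this.congr (concatVel_eqOn_left le_rfl)

lemma intervalIntegrable_concatVel_right (hg : IntervalIntegrable g volume 0 1) :
    IntervalIntegrable (concatVel f g) volume (1 / 2) 1 := by
  have := ((hg.comp_sub_right 1).comp_mul_left (c := 2)).smul (2 : ℝ)
  norm_num at this
  exact this.congr (concatVel_eqOn_right (by norm_num))

lemma integral_concatVel_left {t : ℝ} (ht : t ≤ 1 / 2) :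
    ∫ τ in (0 : ℝ)..t, concatVel f g τ = ∫ τ in (0 : ℝ)..(2 * t), f τ := by
  rw [← intervalIntegral.integral_congr_ae (.of_forall (concatVel_eqOn_left ht)),
    intervalIntegral.integral_smul, intervalIntegral.smul_integral_comp_mul_left, mul_zero]

lemma integral_concatVel_right (hf : IntervalIntegrable f volume 0 1)
    (hg : IntervalIntegrable g volume 0 1) {t : ℝ} (ht : 1 / 2 ≤ t) (ht1 : t ≤ 1) :
    ∫ τ in (0 : ℝ)..t, concatVel f g τ =
      (∫ τ in (0 : ℝ)..1, f τ) + ∫ τ in (0 : ℝ)..(2 * t - 1), g τ := by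
  have h2 : IntervalIntegrable (concatVel f g) volume (1 / 2) t := by
    refine (intervalIntegrable_concatVel_right (f := f) hg).mono_set ?_
    rw [uIcc_of_le ht, uIcc_of_le (by norm_num)]
    exact Icc_subset_Icc_right ht1
  rw [← intervalIntegral.integral_add_adjacent_intervals
    (intervalIntegrable_concatVel_left (g := g) hf) h2, integral_concatVel_left le_rfl,
    ← intervalIntegral.integral_congr_ae (.of_forall (concatVel_eqOn_right ht)),
    intervalIntegral.integral_smul, intervalIntegral.smul_integral_comp_mul_sub]
  norm_num

end concat

/-- Horizontal curves can be concatenated. -/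
lemma Joined.trans {x y z : Pt n} {l l' : ℝ} (h : Joined x y l) (h' : Joined y z l') :
    Joined x z (l + l') := by
  obtain ⟨γ, u, H, rfl⟩ := h
  obtain ⟨δ, v, H', rfl⟩ := h'
  have iV := H.intervalIntegrable_hlift (right_mem_Icc.2 zero_le_one)
  have iV' := H'.intervalIntegrable_hlift (right_mem_Icc.2 zero_le_one)
  obtain ⟨hc, hi, h0, h1, hγ⟩ := H
  obtain ⟨hc', hi', h0', h1', hδ⟩ := H'
  simp only [sum_hfield] at hγ hδ
  set c : ℝ → Pt n := fun t => if t ≤ 1 / 2 then γ (2 * t) else δ (2 * t - 1) with hcdef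
  have hvel : ∀ τ, hlift (c τ) (concatVel u v τ) =
      concatVel (fun τ => hlift (γ τ) (u τ)) (fun τ => hlift (δ τ) (v τ)) τ := by
    intro τ
    simp only [hcdef, concatVel]
    split_ifs <;> rw [hlift_smul]
  have hc0 : c 0 = x := by simp [hcdef, h0]
  have hc1 : c 1 = z := by
    have : ¬ ((1 : ℝ) ≤ 1 / 2) := by norm_num
    simp only [hcdef, if_neg this]; norm_num; exact h1'
  refine ⟨c, concatVel u v, ⟨?_, ?_, hc0, hc1, ?_⟩, ?_⟩
  · have : ContinuousOn c (Icc 0 (1 / 2) ∪ Icc (1 / 2) 1) := by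
      refine ContinuousOn.union_of_isClosed ?_ ?_ isClosed_Icc isClosed_Icc
      · refine (hc.comp (by fun_prop : ContinuousOn (fun t : ℝ => 2 * t) (Icc 0 (1 / 2)))
          ?_).congr ?_
        · intro t ht; constructor <;> linarith [ht.1, ht.2]
        · intro t ht; simp only [hcdef, if_pos ht.2, Function.comp]
      · refine (hc'.comp (by fun_prop : ContinuousOn (fun t : ℝ => 2 * t - 1) (Icc (1 / 2) 1))
          ?_).congr ?_
        · intro t ht; constructor <;> linarith [ht.1, ht.2]
        · intro t ht
          rcases ht.1.eq_or_lt with rfl | h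
          · simp [hcdef, h1, h0']
          · simp only [hcdef, if_neg (not_le.2 h), Function.comp]
    rwa [Icc_union_Icc_eq_Icc (by norm_num) (by norm_num)] at this
  · exact (intervalIntegrable_concatVel_left hi).trans (intervalIntegrable_concatVel_right hi')
  · intro t ht
    simp only [sum_hfield, hvel, hc0]
    rcases le_or_gt t (1 / 2) with h | h
    · rw [integral_concatVel_left h]
      have : c t = γ (2 * t) := by simp only [hcdef, if_pos h]
      rw [this, hγ (2 * t) ⟨by linarith [ht.1], by linarith⟩, h0]
    · rw [integral_concatVel_right iV iV' h.le ht.2]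
      have : c t = δ (2 * t - 1) := by simp only [hcdef, if_neg (not_le.2 h)]
      have e1 := hγ 1 (right_mem_Icc.2 zero_le_one)
      rw [h0, h1] at e1
      rw [this, hδ (2 * t - 1) ⟨by linarith, by linarith [ht.2]⟩, h0', ← add_assoc, ← e1]
  · have hn : ∀ τ, ‖concatVel u v τ‖ = concatVel (fun τ => ‖u τ‖) (fun τ => ‖v τ‖) τ := by
      intro τ
      simp only [concatVel]
      split_ifs <;> simp [norm_smul]
    simp only [hn]
    rw [integral_concatVel_right hi.norm hi'.norm (by norm_num) le_rfl]
    norm_num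

/-- The derivative of a smooth function along the link from `x` to `mul x h`. -/
lemma hasDerivAt_comp_link (i₀ : Fin n) {ψ : Pt n → ℝ} (hψ : Differentiable ℝ ψ) (x : Pt n)
    (r : ℝ) (h : Pt n) (s : ℝ) :
    HasDerivAt (fun s => ψ (mul x (link i₀ r h s)))
      (inner ℝ (hgrad ψ (mul x (link i₀ r h s))) (linkVel i₀ r h s)) s := by
  rw [inner_hgrad]
  exact (hψ _).hasFDerivAt.comp_hasDerivAt s (hasDerivAt_mul_link i₀ x r h s)

lemma continuous_hgrad {ψ : Pt n → ℝ} (hψ : ContDiff ℝ 1 ψ) : Continuous (hgrad ψ) := by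
  have h1 := hψ.continuous_fderiv one_ne_zero
  have : Continuous fun x : Pt n => fun i => fderiv ℝ ψ x (hfield i x) := by
    refine continuous_pi fun i => h1.clm_apply ?_
    rw [show hfield i = fun x : Pt n => hlift x _ from funext (hfield_eq i)]
    unfold hlift
    fun_prop
  exact (PiLp.continuous_toLp 2 _).comp this

variable [NeZero n]

lemma ccDist_triangle_lt {x y z : Pt n} {r s : ℝ} (h : ccDist x y < r) (h' : ccDist y z < s) :
    ccDist x z < r + s := by
  obtain ⟨l, hl, H⟩ := exists_joined_lt h
  obtain ⟨l', hl', H'⟩ := exists_joined_lt h'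
  exact (ccDist_le (H.trans H')).trans_lt (add_lt_add hl hl')

lemma isOpen_ccBall (x : Pt n) (r : ℝ) : IsOpen (ccBall x r) := by
  rw [isOpen_iff_mem_nhds]
  intro y hy
  have hy' : ccDist x y < r := hy
  set ρ := (r - ccDist x y) / 2 with hρ
  have hρ0 : 0 < ρ := by rw [hρ]; linarith
  refine Filter.mem_of_superset ((isOpen_cbox y (ρ / 38)).mem_nhds
    (self_mem_cbox y (by positivity))) ?_
  intro z hz
  have h1 : ccDist y z < 38 * (ρ / 38) := cbox_subset_ccBall y _ hz
  have := ccDist_triangle_lt (show ccDist x y < r - ρ by rw [hρ]; linarith) h1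
  show ccDist x z < r
  linarith

lemma measurableSet_ccBall (x : Pt n) (r : ℝ) : MeasurableSet (ccBall x r) :=
  (isOpen_ccBall x r).measurableSet

lemma volume_ccBall_le (x : Pt n) {r : ℝ} (hr : 0 < r) :
    volume (ccBall x r) ≤ ENNReal.ofReal (boxVol n * r ^ homDim n) :=
  (measure_mono (ccBall_subset_cbox x r)).trans (volume_cbox x hr).le

lemma le_volume_ccBall (x : Pt n) {r : ℝ} (hr : 0 < r) :
    ENNReal.ofReal (boxVol n * (r / 38) ^ homDim n) ≤ volume (ccBall x r) := by
  rw [← volume_cbox x (by positivity)]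
  refine measure_mono ((cbox_subset_ccBall x (r / 38)).trans ?_)
  rw [mul_div_cancel₀ _ (by norm_num)]

end

/-! ### Right translations and means over boxes -/

section

/-- Jensen's inequality for the power `t ↦ t ^ q` and a probability measure. -/
lemma lintegral_rpow_le_of_prob {Y : Type*} [MeasurableSpace Y] (ν : Measure Y)
    [IsProbabilityMeasure ν] {q : ℝ} (hq : 1 ≤ q) {f : Y → ℝ≥0∞} (hf : AEMeasurable f ν) :
    (∫⁻ y, f y ∂ν) ^ q ≤ ∫⁻ y, f y ^ q ∂ν := by
  rcases hq.eq_or_lt with rfl | hq1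
  · simp
  have h := ENNReal.lintegral_mul_le_Lp_mul_Lq ν (Real.HolderConjugate.conjExponent hq1) hf
    (aemeasurable_const (b := (1 : ℝ≥0∞)))
  simp only [Pi.mul_apply, mul_one, ENNReal.one_rpow, lintegral_const, measure_univ] at h
  calc _ ≤ ((∫⁻ y, f y ^ q ∂ν) ^ (1 / q)) ^ q := by gcongr
    _ = _ := by rw [← ENNReal.rpow_mul, one_div_mul_cancel (by linarith), ENNReal.rpow_one]

/-- Averaging over a probability measure does not increase integrals of `q`-th powers. -/
lemma lintegral_lintegral_rpow_le {X Y : Type*} [MeasurableSpace X] [MeasurableSpace Y]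
    (μ : Measure X) [SFinite μ] (ν : Measure Y) [IsProbabilityMeasure ν] {q : ℝ} (hq : 1 ≤ q)
    {F : X → Y → ℝ≥0∞} (hF : AEMeasurable (Function.uncurry F) (μ.prod ν)) :
    ∫⁻ x, (∫⁻ y, F x y ∂ν) ^ q ∂μ ≤ ∫⁻ y, ∫⁻ x, F x y ^ q ∂μ ∂ν := by
  rw [← lintegral_lintegral_swap (hF.pow_const q)]
  refine lintegral_mono_ae ?_
  filter_upwards [hF.aestronglyMeasurable.prodMk_left] with x hx
  exact lintegral_rpow_le_of_prob ν hq hx.aemeasurable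

variable {n : ℕ}

/-- The fundamental theorem of calculus along the link from `x` to `mul x h`. -/
lemma enorm_translate_sub_le (i₀ : Fin n) {ψ : Pt n → ℝ} (hψ : ContDiff ℝ 1 ψ) {r : ℝ} {h : Pt n}
    (hh : h ∈ box n r) (x : Pt n) :
    ‖ψ (mul x h) - ψ x‖ₑ ≤
      ∫⁻ s in Ioc (0 : ℝ) 1, ENNReal.ofReal (37 * r) * ‖hgrad ψ (mul x (link i₀ r h s))‖ₑ := by
  have hr : 0 < r := (norm_nonneg _).trans_lt (mem_box.1 hh).1
  have hcg := continuous_hgrad hψ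
  have h1 := intervalIntegral.integral_eq_sub_of_hasDerivAt (a := 0) (b := 1)
    (fun s _ => hasDerivAt_comp_link i₀ (hψ.differentiable one_ne_zero) x r h s)
    (Continuous.intervalIntegrable (by fun_prop) _ _)
  simp only [link_one i₀ hr.ne', link_zero, mul_zero'] at h1
  rw [← h1, intervalIntegral.integral_of_le zero_le_one]
  refine (enorm_integral_le_lintegral_enorm _).trans ?_
  refine lintegral_mono_ae ((ae_restrict_mem measurableSet_Ioc).mono fun s hs => ?_)
  rw [← ofReal_norm, ← ofReal_norm (hgrad _ _), ← ENNReal.ofReal_mul (by positivity), mul_comm]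
  refine ENNReal.ofReal_le_ofReal ((norm_inner_le_norm _ _).trans ?_)
  gcongr
  exact norm_linkVel_le i₀ hh ⟨hs.1.le, hs.2⟩

/-- Differences under right translations are controlled by the horizontal gradient. Since the link
from `x` to `mul x h` is the left translate by `x` of a fixed curve, the integral in `x` of the
gradient at a fixed time is unchanged by the right translation, which preserves the measure. -/
lemma lintegral_translate_sub_le (i₀ : Fin n) {ψ : Pt n → ℝ} (hψ : ContDiff ℝ 1 ψ) {q : ℝ}
    (hq : 1 ≤ q) {r : ℝ} {h : Pt n} (hh : h ∈ box n r) {A A' : Set (Pt n)}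
    (hA : MeasurableSet A) (hA' : MeasurableSet A')
    (hAA' : ∀ x ∈ A, ∀ s ∈ Icc (0 : ℝ) 1, mul x (link i₀ r h s) ∈ A') :
    ∫⁻ x in A, ‖ψ (mul x h) - ψ x‖ₑ ^ q ≤
      ENNReal.ofReal (37 * r) ^ q * ∫⁻ x in A', ‖hgrad ψ x‖ₑ ^ q := by
  have hcg := continuous_hgrad hψ
  have hq0 : 0 ≤ q := by linarith
  have : IsProbabilityMeasure (volume.restrict (Ioc (0 : ℝ) 1)) := ⟨by simp⟩
  calc ∫⁻ x in A, ‖ψ (mul x h) - ψ x‖ₑ ^ q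
      ≤ ∫⁻ x in A, (∫⁻ s in Ioc (0 : ℝ) 1,
          ENNReal.ofReal (37 * r) * ‖hgrad ψ (mul x (link i₀ r h s))‖ₑ) ^ q := by
        gcongr with x; exact enorm_translate_sub_le i₀ hψ hh x
    _ ≤ ∫⁻ s in Ioc (0 : ℝ) 1, ∫⁻ x in A,
          (ENNReal.ofReal (37 * r) * ‖hgrad ψ (mul x (link i₀ r h s))‖ₑ) ^ q := by
        refine lintegral_lintegral_rpow_le _ _ hq (Measurable.aemeasurable ?_)
        refine Measurable.const_mul ?_ _
        refine Measurable.enorm (Continuous.measurable ?_)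
        have : Continuous fun z : Pt n × ℝ => link i₀ r h z.2 :=
          (continuous_link i₀ r h).comp continuous_snd
        fun_prop
    _ ≤ ∫⁻ s in Ioc (0 : ℝ) 1,
          ENNReal.ofReal (37 * r) ^ q * ∫⁻ x in A', ‖hgrad ψ x‖ₑ ^ q := by
        refine lintegral_mono_ae ((ae_restrict_mem measurableSet_Ioc).mono fun s hs => ?_)
        simp only [ENNReal.mul_rpow_of_nonneg _ _ hq0]
        have hm : Measurable fun x => ‖hgrad ψ x‖ₑ ^ q := hcg.measurable.enorm.pow_const q
        have hm' : Measurable fun x => ‖hgrad ψ (mul x (link i₀ r h s))‖ₑ ^ q :=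
          hm.comp (measurePreserving_mul_right _).measurable
        rw [lintegral_const_mul _ hm']
        gcongr _ * ?_
        rw [← lintegral_indicator hA', ← lintegral_indicator hA,
          ← (measurePreserving_mul_right (link i₀ r h s)).lintegral_comp
            (hm.indicator hA')]
        refine lintegral_mono fun x => ?_
        by_cases hx : x ∈ A
        · rw [indicator_of_mem hx, indicator_of_mem (hAA' x hx s ⟨hs.1.le, hs.2⟩)]
        · rw [indicator_of_notMem hx]; exact zero_le
    _ = _ := by simp

/-- The uniform probability measure on the box of radius `ε`. -/
def boxProb (n : ℕ) (ε : ℝ) : Measure (Pt n) :=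
  (volume (box n ε))⁻¹ • volume.restrict (box n ε)

lemma volume_box_ne_zero {ε : ℝ} (hε : 0 < ε) : volume (box n ε) ≠ 0 := by
  rw [volume_box hε]
  have := boxVol_pos n
  simp; positivity

lemma volume_box_ne_top {ε : ℝ} (hε : 0 < ε) : volume (box n ε) ≠ ∞ := by
  rw [volume_box hε]; exact ENNReal.ofReal_ne_top

lemma isProbabilityMeasure_boxProb {ε : ℝ} (hε : 0 < ε) :
    IsProbabilityMeasure (boxProb n ε) := by
  constructor
  simp [boxProb, ENNReal.inv_mul_cancel (volume_box_ne_zero hε) (volume_box_ne_top hε)]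

lemma lintegral_boxProb {ε : ℝ} (f : Pt n → ℝ≥0∞) :
    ∫⁻ h, f h ∂(boxProb n ε) = (volume (box n ε))⁻¹ * ∫⁻ h in box n ε, f h := by
  rw [boxProb, lintegral_smul_measure, smul_eq_mul]

lemma ae_boxProb {ε : ℝ} : ∀ᵐ h ∂(boxProb n ε), h ∈ box n ε :=
  Measure.ae_smul_measure (ae_restrict_mem (isOpen_box ε).measurableSet) _

lemma boxProb_absolutelyContinuous (ε : ℝ) : boxProb n ε ≪ volume :=
  Measure.AbsolutelyContinuous.smul_left Measure.restrict_le_self.absolutelyContinuous _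

/-- Invariance of the integral under a measure preserving map that need not be an embedding, for
an almost everywhere measurable integrand. -/
lemma lintegral_comp_of_mp {X : Type*} [MeasurableSpace X] {μ : Measure X} {g : X → X}
    (hg : MeasurePreserving g μ μ) {f : X → ℝ≥0∞} (hf : AEMeasurable f μ) :
    ∫⁻ x, f (g x) ∂μ = ∫⁻ x, f x ∂μ := by
  conv_rhs => rw [← hg.map_eq]
  rw [lintegral_map' (by rwa [hg.map_eq]) hg.aemeasurable]

/-- This makes `f (mul x h)` jointly measurable for `f` measurable almost everywhere. -/
lemma quasiMeasurePreserving_mul {ε : ℝ} (hε : 0 < ε) :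
    Measure.QuasiMeasurePreserving (fun z : Pt n × Pt n => mul z.1 z.2)
      (volume.prod (boxProb n ε)) volume := by
  have h1 : MeasurePreserving (fun z : Pt n × Pt n => (z.1, mul z.1 z.2))
      (volume.prod volume) (volume.prod volume) := by
    refine (MeasurePreserving.id volume).skew_product (g := fun x h => mul x h) ?_ ?_
    · exact Measurable.hmul measurable_fst measurable_snd
    · exact Filter.Eventually.of_forall fun x => (measurePreserving_mul_left x).map_eq
  have h2 := Measure.quasiMeasurePreserving_snd.comp h1.quasiMeasurePreserving
  have := isProbabilityMeasure_boxProb (n := n) hε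
  exact h2.mono_left (Measure.AbsolutelyContinuous.rfl.prod (boxProb_absolutelyContinuous ε))

section averages
variable {f : Pt n → ℝ} {ε : ℝ}

lemma aemeasurable_translate (hf : AEStronglyMeasurable f volume) (hε : 0 < ε) :
    AEStronglyMeasurable (fun z : Pt n × Pt n => f (mul z.1 z.2))
      (volume.prod (boxProb n ε)) :=
  hf.comp_quasiMeasurePreserving (quasiMeasurePreserving_mul hε)

/-- The mean of `|f|` over the translated box `x · box ε`. -/
def boxMean (ε : ℝ) (f : Pt n → ℝ) (x : Pt n) : ℝ≥0∞ :=
  ∫⁻ h, ‖f (mul x h)‖ₑ ∂(boxProb n ε)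

/-- The mean of `|f - f(x)|` over the translated box `x · box ε`. -/
def boxOsc (ε : ℝ) (f : Pt n → ℝ) (x : Pt n) : ℝ≥0∞ :=
  ∫⁻ h, ‖f (mul x h) - f x‖ₑ ∂(boxProb n ε)

lemma aemeasurable_uncurry_osc (hf : AEStronglyMeasurable f volume) (hε : 0 < ε) :
    AEMeasurable (Function.uncurry fun x h => ‖f (mul x h) - f x‖ₑ)
      (volume.prod (boxProb n ε)) := by
  have := isProbabilityMeasure_boxProb (n := n) hε
  exact ((aemeasurable_translate hf hε).sub hf.comp_fst).enorm

lemma aemeasurable_uncurry_mean (hf : AEStronglyMeasurable f volume) (hε : 0 < ε) :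
    AEMeasurable (Function.uncurry fun x h => ‖f (mul x h)‖ₑ)
      (volume.prod (boxProb n ε)) :=
  (aemeasurable_translate hf hε).enorm

lemma aemeasurable_boxOsc (hf : AEStronglyMeasurable f volume) (hε : 0 < ε) :
    AEMeasurable (boxOsc ε f) volume := by
  have := isProbabilityMeasure_boxProb (n := n) hε
  exact (aemeasurable_uncurry_osc hf hε).lintegral_prod_right'

lemma aemeasurable_boxMean (hf : AEStronglyMeasurable f volume) (hε : 0 < ε) :
    AEMeasurable (boxMean ε f) volume := by
  have := isProbabilityMeasure_boxProb (n := n) hε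
  exact (aemeasurable_uncurry_mean hf hε).lintegral_prod_right'

lemma enorm_le_boxOsc_add_boxMean (hf : AEStronglyMeasurable f volume) (hε : 0 < ε) :
    ∀ᵐ x, ‖f x‖ₑ ≤ boxOsc ε f x + boxMean ε f x := by
  have := isProbabilityMeasure_boxProb (n := n) hε
  filter_upwards [(aemeasurable_uncurry_mean hf hε).aestronglyMeasurable.prodMk_left] with x hx
  calc ‖f x‖ₑ = ∫⁻ _, ‖f x‖ₑ ∂(boxProb n ε) := by simp
    _ ≤ ∫⁻ h, (‖f (mul x h) - f x‖ₑ + ‖f (mul x h)‖ₑ) ∂(boxProb n ε) := by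
        gcongr with h
        rw [← enorm_neg (f (mul x h) - f x)]
        refine le_trans (le_of_eq ?_) (enorm_add_le _ _)
        congr 1; ring
    _ = _ := lintegral_add_right' _ hx.aemeasurable

lemma lintegral_boxOsc_rpow_le (hf : AEStronglyMeasurable f volume) (hε : 0 < ε) {q : ℝ}
    (hq : 1 ≤ q) {N : ℝ≥0∞}
    (hN : ∀ h ∈ box n ε, ∫⁻ x, ‖f (mul x h) - f x‖ₑ ^ q ≤ N) :
    ∫⁻ x, boxOsc ε f x ^ q ≤ N := by
  have := isProbabilityMeasure_boxProb (n := n) hε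
  refine (lintegral_lintegral_rpow_le volume (boxProb n ε) hq
    (aemeasurable_uncurry_osc hf hε)).trans ?_
  calc _ ≤ ∫⁻ _, N ∂(boxProb n ε) := lintegral_mono_ae (ae_boxProb.mono hN)
    _ = N := by simp

lemma boxMean_rpow_le (hf : AEStronglyMeasurable f volume) (hε : 0 < ε) {q : ℝ}
    (hq : 1 ≤ q) :
    ∀ᵐ x, boxMean ε f x ^ q ≤ (volume (box n ε))⁻¹ * ∫⁻ x, ‖f x‖ₑ ^ q := by
  have := isProbabilityMeasure_boxProb (n := n) hε
  filter_upwards [(aemeasurable_uncurry_mean hf hε).aestronglyMeasurable.prodMk_left] with x hx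
  refine (lintegral_rpow_le_of_prob _ hq hx.aemeasurable).trans ?_
  rw [lintegral_boxProb]
  gcongr _ * ?_
  refine (setLIntegral_le_lintegral _ _).trans (le_of_eq ?_)
  exact lintegral_comp_of_mp (measurePreserving_mul_left x) (f := fun y => ‖f y‖ₑ ^ q)
    (hf.enorm.pow_const q)

lemma lintegral_boxMean_le (hf : AEStronglyMeasurable f volume) (hε : 0 < ε) :
    ∫⁻ x, boxMean ε f x ≤ ∫⁻ x, ‖f x‖ₑ := by
  have := isProbabilityMeasure_boxProb (n := n) hε
  unfold boxMean
  rw [lintegral_lintegral_swap (aemeasurable_uncurry_mean hf hε)]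
  calc _ = ∫⁻ _, (∫⁻ x, ‖f x‖ₑ) ∂(boxProb n ε) := by
        congr 1; ext h
        exact lintegral_comp_of_mp (measurePreserving_mul_right h)
          (f := fun y => ‖f y‖ₑ) hf.enorm
    _ ≤ _ := by simp

/-- A Nash type inequality: if the right translates of `f` by the box of radius `ε` are
`N`-close to `f` in `L^q`, then `‖f‖_q` is controlled by `N` and `‖f‖_1`. Indeed `f` differs
little from its means over boxes, and these are bounded in terms of `‖f‖_1`. -/
lemma nash_of_translate (hf : AEStronglyMeasurable f volume) (hε : 0 < ε) {q : ℝ}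
    (hq : 1 ≤ q) {N : ℝ≥0∞}
    (hN : ∀ h ∈ box n ε, ∫⁻ x, ‖f (mul x h) - f x‖ₑ ^ q ≤ N) :
    (∫⁻ x, ‖f x‖ₑ ^ q) ^ (1 / q) ≤ N ^ (1 / q) +
      (((volume (box n ε))⁻¹ * ∫⁻ x, ‖f x‖ₑ) ^ (q - 1) * ∫⁻ x, ‖f x‖ₑ) ^ (1 / q) := by
  have hq0 : 0 < q := by linarith
  calc (∫⁻ x, ‖f x‖ₑ ^ q) ^ (1 / q)
      ≤ (∫⁻ x, (boxOsc ε f + boxMean ε f) x ^ q) ^ (1 / q) := by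
        gcongr ?_ ^ (1 / q)
        refine lintegral_mono_ae ((enorm_le_boxOsc_add_boxMean hf hε).mono fun x hx => ?_)
        simp only [Pi.add_apply]; gcongr
    _ ≤ (∫⁻ x, boxOsc ε f x ^ q) ^ (1 / q) + (∫⁻ x, boxMean ε f x ^ q) ^ (1 / q) :=
        ENNReal.lintegral_Lp_add_le (aemeasurable_boxOsc hf hε) (aemeasurable_boxMean hf hε) hq
    _ ≤ _ := by
        gcongr ?_ ^ (1 / q) + ?_ ^ (1 / q)
        · exact lintegral_boxOsc_rpow_le hf hε hq hN
        · have h1 := boxMean_rpow_le hf hε le_rfl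
          simp only [ENNReal.rpow_one] at h1
          calc ∫⁻ x, boxMean ε f x ^ q
              ≤ ∫⁻ x, ((volume (box n ε))⁻¹ * ∫⁻ x, ‖f x‖ₑ) ^ (q - 1) * boxMean ε f x := by
                refine lintegral_mono_ae (h1.mono fun x hx => ?_)
                calc boxMean ε f x ^ q = boxMean ε f x ^ (q - 1) * boxMean ε f x ^ (1 : ℝ) := by
                      rw [← ENNReal.rpow_add_of_nonneg _ _ (by linarith) zero_le_one]
                      congr 1; ring
                  _ ≤ _ := by rw [ENNReal.rpow_one]; gcongr
            _ = _ * ∫⁻ x, boxMean ε f x := lintegral_const_mul'' _ (aemeasurable_boxMean hf hε)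
            _ ≤ _ := by gcongr _ * ?_; exact lintegral_boxMean_le hf hε

/-- If the right translates of `f` by the box of radius `ε` are close to `f` in `L^q`, and the
`L^q` norm of `f` makes the means over such boxes at most `t`, then the superlevel set
`{|f| > 2 t}` is small. -/
lemma weak_type_of_translate (hf : AEStronglyMeasurable f volume) (hε : 0 < ε) {q : ℝ}
    (hq : 1 ≤ q) {N : ℝ≥0∞}
    (hN : ∀ h ∈ box n ε, ∫⁻ x, ‖f (mul x h) - f x‖ₑ ^ q ≤ N) {t : ℝ≥0∞} (ht : t ≠ ∞)
    (htf : (volume (box n ε))⁻¹ * ∫⁻ x, ‖f x‖ₑ ^ q ≤ t ^ q) :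
    t ^ q * volume {x | 2 * t < ‖f x‖ₑ} ≤ N := by
  have hq0 : 0 < q := by linarith
  refine le_trans ?_ (lintegral_boxOsc_rpow_le hf hε hq hN)
  refine le_trans ?_ (mul_meas_ge_le_lintegral₀ ((aemeasurable_boxOsc hf hε).pow_const q) (t ^ q))
  gcongr _ * ?_
  refine measure_mono_ae (μ := volume) ?_
  filter_upwards [enorm_le_boxOsc_add_boxMean hf hε, boxMean_rpow_le hf hε hq] with x h1 h2 h3
  have h4 : boxMean ε f x ≤ t := (ENNReal.rpow_le_rpow_iff hq0).1 (h2.trans htf)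
  have h5 : t ≤ boxOsc ε f x := by
    by_contra! hlt
    have h3' : 2 * t < ‖f x‖ₑ := h3
    have : ‖f x‖ₑ < t + t := h1.trans_lt (ENNReal.add_lt_add_of_lt_of_le
      (ne_top_of_le_ne_top ht h4) hlt h4)
    rw [two_mul] at h3'
    exact absurd (h3'.trans this) (lt_irrefl _)
  exact ENNReal.rpow_le_rpow h5 hq0.le

end averages

end

/-! ### Smooth approximation by convolution on the group -/

section

open Filter Topology Convolution

section translations
variable {n : ℕ} {E : Type*} [NormedAddCommGroup E]

/-- Left translations act continuously on `L^p`. -/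
lemma tendsto_eLpNorm_translate {p : ℝ≥0∞} (hp1 : 1 ≤ p) (hp : p ≠ ∞) {f : Pt n → E}
    (hf : MemLp f p volume) :
    Tendsto (fun y : Pt n => eLpNorm (fun x => f (mul (-y) x) - f x) p volume) (𝓝 0) (𝓝 0) := by
  have : Fact (1 ≤ p) := ⟨hp1⟩
  let g : C(Pt n, C(Pt n, Pt n)) :=
    ContinuousMap.curry ⟨fun z : Pt n × Pt n => mul (-z.1) z.2, by fun_prop⟩
  have hg : ∀ y, MeasurePreserving (g y) volume volume := fun y =>
    measurePreserving_mul_left (-y)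
  have h1 : Tendsto (fun y => Lp.compMeasurePreserving (g y) (hg y) (hf.toLp f)) (𝓝 0)
      (𝓝 (Lp.compMeasurePreserving (g 0) (hg 0) (hf.toLp f))) :=
    (tendsto_const_nhds (x := hf.toLp f)).compMeasurePreservingLp (g.continuous.tendsto 0) hg
      (hg 0) hp
  rw [tendsto_iff_edist_tendsto_0] at h1
  refine h1.congr fun y => ?_
  rw [Lp.toLp_compMeasurePreserving, Lp.toLp_compMeasurePreserving, Lp.edist_toLp_toLp]
  refine congrArg (fun u => eLpNorm u p volume) ?_
  ext x
  simp [g]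

end translations

variable {n : ℕ}

/-- The left group convolution `ρ * f (x) = ∫ ρ (x t⁻¹) f (t) dt`. It is an average of left
translates of `f`, and therefore commutes with the left invariant fields. -/
def moll {E : Type*} [NormedAddCommGroup E] [NormedSpace ℝ E] (ρ : Pt n → ℝ) (f : Pt n → E)
    (x : Pt n) : E := ∫ t, ρ (mul x (-t)) • f t

lemma measurePreserving_mul_neg (x : Pt n) :
    MeasurePreserving (fun t => mul x (-t)) volume volume := by
  have := (Measure.measurePreserving_sub_left volume x.1).skew_product
    (g := fun a t => x.2 - symp x.1 a / 2 - t) (μc := (volume : Measure ℝ)) (μd := volume)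
    (Continuous.measurable (by unfold Function.uncurry; fun_prop))
    (Filter.Eventually.of_forall fun a => (Measure.measurePreserving_sub_left volume _).map_eq)
  have e : (fun t => mul x (-t)) = fun t => (x.1 - t.1, x.2 - symp x.1 t.1 / 2 - t.2) := by
    ext1 t
    refine Prod.ext ?_ ?_
    · simp [sub_eq_add_neg]
    · simp only [mul_snd, Prod.snd_neg, Prod.fst_neg, symp_neg_right]; ring
  rw [e]
  exact this

lemma mul_neg_mul_neg (x t : Pt n) : mul (-(mul x (-t))) x = t := by
  rw [neg_mul', neg_neg, mul_assoc', neg_mul_self, mul_zero']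

lemma measurableEmbedding_mul_neg (x : Pt n) : MeasurableEmbedding (fun t => mul x (-t)) := by
  refine Continuous.measurableEmbedding (by fun_prop) ?_
  intro t t' h
  have := congrArg (fun z => mul (-z) x) h
  simpa only [mul_neg_mul_neg] using this

/-- The convolution as an average of left translates. -/
lemma moll_eq {E : Type*} [NormedAddCommGroup E] [NormedSpace ℝ E] (ρ : Pt n → ℝ)
    (f : Pt n → E) (x : Pt n) : moll ρ f x = ∫ y, ρ y • f (mul (-y) x) := by
  rw [← (measurePreserving_mul_neg x).integral_comp (measurableEmbedding_mul_neg x)]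
  simp only [mul_neg_mul_neg]
  rfl

/-- A nonnegative smooth compactly supported kernel of mass one. -/
structure IsKernel (ρ : Pt n → ℝ) : Prop where
  smooth : ContDiff ℝ (⊤ : ℕ∞) ρ
  compact : HasCompactSupport ρ
  nonneg : ∀ x, 0 ≤ ρ x
  mass : ∫ x, ρ x = 1

lemma exists_isKernel {δ : ℝ} (hδ : 0 < δ) :
    ∃ ρ : Pt n → ℝ, IsKernel ρ ∧ tsupport ρ ⊆ Metric.closedBall 0 δ := by
  let b : ContDiffBump (0 : Pt n) := ⟨δ / 2, δ, by positivity, by linarith⟩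
  exact ⟨b.normed volume, ⟨b.contDiff_normed, b.hasCompactSupport_normed,
    fun x => b.nonneg_normed x, b.integral_normed⟩, by rw [b.tsupport_normed_eq]⟩

section approx
variable {E : Type*} [NormedAddCommGroup E] [NormedSpace ℝ E]

lemma IsKernel.integrable_smul {ρ : Pt n → ℝ} (hρ : IsKernel ρ) {f : Pt n → E}
    (hf : LocallyIntegrable f volume) (x : Pt n) :
    Integrable (fun y => ρ y • f (mul (-y) x)) := by
  have h1 : Integrable (fun t => ρ (mul x (-t)) • f t) := by
    refine hf.integrable_smul_left_of_hasCompactSupport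
      (hρ.smooth.continuous.comp (by fun_prop)) ?_
    refine HasCompactSupport.intro (K := (fun y => mul (-y) x) '' tsupport ρ)
      (hρ.compact.isCompact.image (by fun_prop)) ?_
    intro t ht
    by_contra h
    exact ht ⟨mul x (-t), subset_tsupport _ h, mul_neg_mul_neg x t⟩
  have h2 := (measurePreserving_mul_neg x).integrable_comp_emb (measurableEmbedding_mul_neg x)
    (g := fun y => ρ y • f (mul (-y) x))
  refine h2.1 (h1.congr (ae_of_all _ fun t => ?_))
  simp only [Function.comp, mul_neg_mul_neg]

lemma IsKernel.isProbabilityMeasure {ρ : Pt n → ℝ} (hρ : IsKernel ρ) :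
    IsProbabilityMeasure (volume.withDensity fun y => ENNReal.ofReal (ρ y)) := by
  constructor
  rw [withDensity_apply _ MeasurableSet.univ, Measure.restrict_univ,
    ← ofReal_integral_eq_lintegral_ofReal
      (hρ.smooth.continuous.integrable_of_hasCompactSupport hρ.compact)
      (ae_of_all _ hρ.nonneg), hρ.mass, ENNReal.ofReal_one]

variable [CompleteSpace E]

lemma IsKernel.enorm_moll_sub_le {ρ : Pt n → ℝ} (hρ : IsKernel ρ) {f : Pt n → E}
    (hf : LocallyIntegrable f volume) (x : Pt n) :
    ‖moll ρ f x - f x‖ₑ ≤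
      ∫⁻ y, ‖f (mul (-y) x) - f x‖ₑ ∂(volume.withDensity fun y => ENNReal.ofReal (ρ y)) := by
  have hi : Integrable ρ := hρ.smooth.continuous.integrable_of_hasCompactSupport hρ.compact
  have h1 : moll ρ f x - f x = ∫ y, ρ y • (f (mul (-y) x) - f x) := by
    simp only [smul_sub]
    rw [integral_sub (hρ.integrable_smul hf x) (hi.smul_const _), integral_smul_const, hρ.mass,
      one_smul, moll_eq]
  rw [h1, lintegral_withDensity_eq_lintegral_mul_non_measurable _
    (hρ.smooth.continuous.measurable.ennreal_ofReal) (ae_of_all _ fun _ => ENNReal.ofReal_lt_top)]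
  refine (enorm_integral_le_lintegral_enorm _).trans (lintegral_mono fun y => ?_)
  rw [enorm_smul, Real.enorm_eq_ofReal (hρ.nonneg y)]
  rfl

/-- The mollification is as close to `f` as the left translates of `f` by elements of the support
of the kernel. -/
lemma IsKernel.eLpNorm_moll_sub_le {ρ : Pt n → ℝ} (hρ : IsKernel ρ) {p : ℝ} (hp : 1 ≤ p)
    {f : Pt n → E} (hf : MemLp f (ENNReal.ofReal p) volume) {η : ℝ≥0∞}
    (hη : ∀ y ∈ tsupport ρ,
      eLpNorm (fun x => f (mul (-y) x) - f x) (ENNReal.ofReal p) volume ≤ η) :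
    eLpNorm (fun x => moll ρ f x - f x) (ENNReal.ofReal p) volume ≤ η := by
  have hp0 : 0 < p := by linarith
  have hpe : ENNReal.ofReal p ≠ 0 := by simpa using hp0
  have hpr : (ENNReal.ofReal p).toReal = p := ENNReal.toReal_ofReal hp0.le
  have hfl : LocallyIntegrable f volume := hf.locallyIntegrable (by simpa using hp)
  set ν := volume.withDensity fun y => ENNReal.ofReal (ρ y) with hν
  have := hρ.isProbabilityMeasure
  have hν1 : ν ≪ volume := withDensity_absolutelyContinuous _ _
  have hm : AEMeasurable (Function.uncurry fun x y => ‖f (mul (-y) x) - f x‖ₑ)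
      (volume.prod ν) := by
    have h1 : Measure.QuasiMeasurePreserving (fun z : Pt n × Pt n => mul (-z.2) z.1)
        (volume.prod volume) volume := by
      have h1 : MeasurePreserving (fun z : Pt n × Pt n => (z.1, mul (-z.1) z.2))
          (volume.prod volume) (volume.prod volume) := by
        refine (MeasurePreserving.id volume).skew_product (g := fun x h => mul (-x) h) ?_ ?_
        · exact Measurable.hmul measurable_fst.neg measurable_snd
        · exact Filter.Eventually.of_forall fun x => (measurePreserving_mul_left (-x)).map_eq
      exact (Measure.quasiMeasurePreserving_snd.comp h1.quasiMeasurePreserving).comp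
        Measure.measurePreserving_swap.quasiMeasurePreserving
    have h2 := hf.1.comp_quasiMeasurePreserving
      (h1.mono_left (Measure.AbsolutelyContinuous.rfl.prod hν1))
    exact (h2.sub hf.1.comp_fst).enorm
  rw [eLpNorm_eq_lintegral_rpow_enorm_toReal hpe ENNReal.ofReal_ne_top, hpr]
  have hηp : ∀ y ∈ tsupport ρ, ∫⁻ x, ‖f (mul (-y) x) - f x‖ₑ ^ p ≤ η ^ p := by
    intro y hy
    have := hη y hy
    rw [eLpNorm_eq_lintegral_rpow_enorm_toReal hpe ENNReal.ofReal_ne_top, hpr] at this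
    rwa [one_div, ENNReal.rpow_inv_le_iff hp0] at this
  rw [one_div, ENNReal.rpow_inv_le_iff hp0]
  calc _ ≤ ∫⁻ x, (∫⁻ y, ‖f (mul (-y) x) - f x‖ₑ ∂ν) ^ p := by
        gcongr with x; exact hρ.enorm_moll_sub_le hfl x
    _ ≤ ∫⁻ y, ∫⁻ x, ‖f (mul (-y) x) - f x‖ₑ ^ p ∂volume ∂ν :=
        lintegral_lintegral_rpow_le volume ν hp hm
    _ ≤ ∫⁻ _, η ^ p ∂ν := by
        refine lintegral_mono_ae ?_
        rw [hν, ae_withDensity_iff hρ.smooth.continuous.measurable.ennreal_ofReal]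
        refine ae_of_all _ fun y hy => hηp y (subset_tsupport _ ?_)
        intro h0; simp [h0] at hy
    _ = η ^ p := by simp [hν]

end approx

lemma hasDerivAt_mul_smul (t : Pt n) (z : Hor n) (s : ℝ) :
    HasDerivAt (fun s : ℝ => mul t (s • ((z, 0) : Pt n))) (hlift (mul t (s • ((z, 0) : Pt n))) z) s := by
  have h1 : HasDerivAt (fun s : ℝ => t.1 + s • z) z s := by
    simpa using ((hasDerivAt_id s).smul_const z).const_add t.1
  have h2 : HasDerivAt (fun s : ℝ => t.2 + s * (symp t.1 z / 2)) (symp t.1 z / 2) s := by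
    simpa using ((hasDerivAt_id s).mul_const (symp t.1 z / 2)).const_add t.2
  have h3 := h1.prodMk h2
  have e : (fun s : ℝ => mul t (s • ((z, 0) : Pt n))) =
      fun s => (t.1 + s • z, t.2 + s * (symp t.1 z / 2)) := by
    ext1 u
    ext1
    · simp
    · simp [symp_smul_right]; ring
  rw [e]
  refine h3.congr_deriv ?_
  simp [hlift, symp_add_left, symp_smul_left]

/-- Smoothness is local, so that the first argument of the kernel may be confined to a ball; then
the smoothness theorem for convolutions with parameters applies to `(q, z) ↦ ρ (mul q z)`. -/
lemma IsKernel.contDiff_moll {ρ : Pt n → ℝ} (hρ : IsKernel ρ) {f : Pt n → ℝ}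
    (hf : LocallyIntegrable f volume) : ContDiff ℝ (⊤ : ℕ∞) (moll ρ f) := by
  rw [contDiff_iff_contDiffAt]
  intro x
  set M := ‖x‖ + 1
  have h := contDiffOn_convolution_right_with_param_comp (μ := (volume : Measure (Pt n)))
    (n := (⊤ : ℕ∞)) (ContinuousLinearMap.mul ℝ ℝ)
    (s := Metric.ball (0 : Pt n) M) (v := fun _ => (0 : Pt n)) (f := f)
    (g := fun q z => ρ (mul q z))
    (k := (fun z : Pt n × Pt n => mul (-z.1) z.2) '' (Metric.closedBall (0 : Pt n) M ×ˢ tsupport ρ))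
    contDiffOn_const Metric.isOpen_ball
    (((isCompact_closedBall _ _).prod hρ.compact.isCompact).image (by fun_prop)) ?_ hf ?_
  · have h2 := h.contDiffAt (Metric.isOpen_ball.mem_nhds (by simp [M] : x ∈ Metric.ball (0 : Pt n) M))
    refine h2.congr_of_eventuallyEq (Eventually.of_forall fun y => ?_)
    simp only [moll, convolution, ContinuousLinearMap.mul_apply', zero_sub, smul_eq_mul]
    congr 1; ext t; ring
  · intro q z hq hz
    by_contra hne
    exact hz ⟨(q, mul q z), ⟨Metric.ball_subset_closedBall hq, subset_tsupport _ hne⟩, by simp⟩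
  · refine ContDiff.contDiffOn ?_
    exact hρ.smooth.comp (by fun_prop : ContDiff ℝ (⊤ : ℕ∞) fun z : Pt n × Pt n => mul z.1 z.2)

/-- The horizontal derivative of a left convolution falls on the kernel: moving `x` in the direction
`X_i` has the effect on `ρ (x t⁻¹)` of moving `t` in the direction `-X_i`. -/
lemma IsKernel.hgrad_moll {ρ : Pt n → ℝ} (hρ : IsKernel ρ) {f : Pt n → ℝ}
    (hf : LocallyIntegrable f volume) (x : Pt n) (i : Fin n ⊕ Fin n) :
    hgrad (moll ρ f) x i = -∫ t, f t * hgrad (fun t => ρ (mul x (-t))) t i := by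
  set e : Pt n := (EuclideanSpace.single i 1, 0) with he
  set G : ℝ × Pt n → ℝ := fun z => ρ (mul (mul x (z.1 • e)) (-z.2)) with hG
  have hGs : ContDiff ℝ (⊤ : ℕ∞) G := hρ.smooth.comp (by fun_prop)
  have hGd : Differentiable ℝ G := hGs.differentiable (by simp)
  set D : ℝ × Pt n → ℝ := fun z => fderiv ℝ G z (1, 0) with hD
  have hDc : Continuous D := (hGs.continuous_fderiv (by simp)).clm_apply continuous_const
  have hder : ∀ s t, HasDerivAt (fun s => G (s, t)) (D (s, t)) s := fun s t =>
    HasFDerivAt.comp_hasDerivAt (f := fun s => (s, t)) s (hGd (s, t)).hasFDerivAt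
      ((hasDerivAt_id' s).prodMk (hasDerivAt_const s t))
  set k : Set (Pt n) := (fun z : ℝ × Pt n => mul (-z.2) (mul x (z.1 • e))) ''
    (Metric.closedBall (0 : ℝ) 1 ×ˢ tsupport ρ) with hk
  have hkc : IsCompact k := ((isCompact_closedBall _ _).prod hρ.compact.isCompact).image (by fun_prop)
  have hGk : ∀ s ∈ Metric.ball (0 : ℝ) 1, ∀ t ∉ k, G (s, t) = 0 := by
    intro s hs t ht
    by_contra hne
    exact ht ⟨(s, mul (mul x (s • e)) (-t)),
      ⟨Metric.ball_subset_closedBall hs, subset_tsupport _ hne⟩, mul_neg_mul_neg _ t⟩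
  have hDk : ∀ s ∈ Metric.ball (0 : ℝ) 1, ∀ t ∉ k, D (s, t) = 0 := by
    intro s hs t ht
    have h0 : HasDerivAt (fun s => G (s, t)) 0 s := by
      refine (hasDerivAt_const s (0 : ℝ)).congr_of_eventuallyEq ?_
      filter_upwards [Metric.isOpen_ball.mem_nhds hs] with s' hs'
      exact hGk s' hs' t ht
    exact (hder s t).unique h0
  obtain ⟨C, hC⟩ := ((isCompact_closedBall (0 : ℝ) 1).prod hkc).exists_bound_of_continuousOn
    hDc.continuousOn
  have hfk : IntegrableOn f k volume := hf.integrableOn_isCompact hkc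
  have hm : ∀ g : Pt n → ℝ, Continuous g → AEStronglyMeasurable (fun t => g t * f t) volume :=
    fun g hg => hg.aestronglyMeasurable.mul hf.aestronglyMeasurable
  have key := hasDerivAt_integral_of_dominated_loc_of_deriv_le (μ := (volume : Measure (Pt n)))
    (F := fun s t => G (s, t) * f t) (F' := fun s t => D (s, t) * f t) (x₀ := (0 : ℝ))
    (bound := k.indicator fun t => C * ‖f t‖) (Metric.ball_mem_nhds 0 one_pos)
    (Eventually.of_forall fun s => hm _ (hGs.continuous.comp (by fun_prop)))
    (by
      have := hρ.integrable_smul hf (mul x ((0 : ℝ) • e))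
      have h2 := ((measurePreserving_mul_neg (mul x ((0 : ℝ) • e))).integrable_comp_emb
        (measurableEmbedding_mul_neg _)).2 this
      refine h2.congr (ae_of_all _ fun t => ?_)
      simp only [Function.comp, mul_neg_mul_neg, hG, smul_eq_mul])
    (hm _ (hDc.comp (by fun_prop)))
    (ae_of_all _ fun t s hs => by
      by_cases ht : t ∈ k
      · rw [indicator_of_mem ht, norm_mul]
        gcongr
        exact hC (s, t) ⟨Metric.ball_subset_closedBall hs, ht⟩
      · rw [indicator_of_notMem ht, hDk s hs t ht, zero_mul, norm_zero])
    ((integrable_indicator_iff hkc.measurableSet).2 (hfk.norm.const_mul C))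
    (ae_of_all _ fun t s _ => (hder s t).mul_const (f t))
  have h1 : HasDerivAt (fun s : ℝ => moll ρ f (mul x (s • e)))
      (fderiv ℝ (moll ρ f) x (hfield i x)) 0 := by
    have h2 := hasDerivAt_mul_smul x (EuclideanSpace.single i 1) 0
    have h3 := ((hρ.contDiff_moll hf).differentiable (by simp)
      (mul x ((0 : ℝ) • e))).hasFDerivAt.comp_hasDerivAt (0 : ℝ) h2
    simp only [zero_smul, mul_zero'] at h3
    rw [hfield_eq]
    exact h3
  have h4 := h1.unique key.2
  rw [hgrad_apply, h4, ← integral_neg]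
  refine integral_congr_ae (ae_of_all _ fun t => ?_)
  have h5 : D (0, t) = -hgrad (fun t => ρ (mul x (-t))) t i := by
    have h6 : HasDerivAt (fun s => G (s, t))
        (fderiv ℝ (fun t => ρ (mul x (-t))) t (hlift t (-EuclideanSpace.single i 1))) 0 := by
      have h7 := hasDerivAt_mul_smul t (-EuclideanSpace.single i 1) 0
      have hθ : ContDiff ℝ (⊤ : ℕ∞) fun t => ρ (mul x (-t)) := hρ.smooth.comp (by fun_prop)
      have h8 := (hθ.differentiable (by simp)
        (mul t ((0 : ℝ) • ((-EuclideanSpace.single i 1, 0) : Pt n)))).hasFDerivAt.comp_hasDerivAt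
          (0 : ℝ) h7
      simp only [zero_smul, mul_zero'] at h8
      refine h8.congr_of_eventuallyEq (Eventually.of_forall fun s => ?_)
      simp only [hG, Function.comp, neg_mul', mul_assoc']
      congr 3
      ext1 <;> simp [he]
    rw [(hder 0 t).unique h6, hgrad_apply, hfield_eq, ← map_neg]
    congr 1
    ext1 <;> simp [hlift, symp_neg_right]
    ring
  simp only [h5]
  ring

/-- Smooth functions are dense in the horizontal Sobolev space, locally. As the kernel
`t ↦ ρ (x t⁻¹)` is an admissible test function for `x` near the compact set, the horizontal
gradient of the mollification is the mollification of the weak horizontal gradient there. -/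
lemma MemHW.exists_smooth_approx {p : ℝ} (hp : 1 ≤ p) {U : Set (Pt n)} (hU : IsOpen U)
    {w : Pt n → ℝ} {Dw : Pt n → Hor n} (hw : MemHW p U w Dw) {K : Set (Pt n)} (hK : IsCompact K)
    (hKU : K ⊆ U) {ε : ℝ≥0∞} (hε : 0 < ε) :
    ∃ ψ : Pt n → ℝ, ContDiff ℝ (⊤ : ℕ∞) ψ ∧
      eLpNorm (fun x => w x - ψ x) (ENNReal.ofReal p) (volume.restrict K) ≤ ε ∧
      eLpNorm (fun x => Dw x - hgrad ψ x) (ENNReal.ofReal p) (volume.restrict K) ≤ ε := by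
  obtain ⟨hw1, hw2, hw3⟩ := hw
  have hUm := hU.measurableSet
  have hp1 : (1 : ℝ≥0∞) ≤ ENNReal.ofReal p := by simpa using hp
  set f := U.indicator w with hfdef
  set F := U.indicator Dw with hFdef
  have hf : MemLp f (ENNReal.ofReal p) volume := (memLp_indicator_iff_restrict hUm).2 hw1
  have hF : MemLp F (ENNReal.ofReal p) volume := (memLp_indicator_iff_restrict hUm).2 hw2
  have hfl := hf.locallyIntegrable hp1
  have hFl := hF.locallyIntegrable hp1
  have t1 := (tendsto_eLpNorm_translate hp1 ENNReal.ofReal_ne_top hf).eventually_le_const hε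
  have t2 := (tendsto_eLpNorm_translate hp1 ENNReal.ofReal_ne_top hF).eventually_le_const hε
  have t3 : ∀ᶠ y : Pt n in 𝓝 0, ∀ x ∈ K, mul (-y) x ∈ U := by
    obtain ⟨u, v, hu, -, h0u, hKv, huv⟩ := generalized_tube_lemma
      (s := {(0 : Pt n)}) isCompact_singleton hK
      (hU.preimage (by fun_prop : Continuous fun z : Pt n × Pt n => mul (-z.1) z.2)) (by
        rintro ⟨y, x⟩ ⟨hy, hx⟩
        simp only [mem_singleton_iff] at hy
        simpa [hy] using hKU hx)
    filter_upwards [hu.mem_nhds (h0u rfl)] with y hy x hx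
    exact huv (⟨hy, hKv hx⟩ : (y, x) ∈ u ×ˢ v)
  obtain ⟨δ, hδ, hball⟩ := Metric.nhds_basis_closedBall.eventually_iff.1 (t1.and (t2.and t3))
  obtain ⟨ρ, hρ, hρδ⟩ := exists_isKernel (n := n) hδ
  have hψ := hρ.contDiff_moll hfl
  have hgr : ∀ x ∈ K, hgrad (moll ρ f) x = moll ρ F x := by
    intro x hx
    ext i
    set θ : Pt n → ℝ := fun t => ρ (mul x (-t)) with hθ
    have hθt : tsupport θ ⊆ (fun y => mul (-y) x) '' tsupport ρ := by
      refine closure_minimal ?_ (hρ.compact.isCompact.image (by fun_prop)).isClosed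
      intro t ht
      exact ⟨mul x (-t), subset_tsupport _ ht, mul_neg_mul_neg x t⟩
    have hθT : IsTest U θ := by
      refine ⟨hρ.smooth.comp (by fun_prop), ?_, hθt.trans ?_⟩
      · exact (hρ.compact.isCompact.image (by fun_prop)).of_isClosed_subset
          (isClosed_tsupport _) hθt
      · rintro _ ⟨y, hy, rfl⟩
        exact (hball (hρδ hy)).2.2 x hx
    have e1 : ∫ t, f t * hgrad θ t i = ∫ t in U, w t * hgrad θ t i := by
      rw [← integral_indicator hUm]
      congr 1; ext t
      by_cases h : t ∈ U <;> simp [hfdef, h]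
    have e2 : ∫ t in U, Dw t i * θ t = moll ρ F x i := by
      have hint : Integrable (fun t => θ t • F t) := by
        have h2 := ((measurePreserving_mul_neg x).integrable_comp_emb
          (measurableEmbedding_mul_neg x)).2 (hρ.integrable_smul hFl x)
        refine h2.congr (ae_of_all _ fun t => ?_)
        simp only [Function.comp, mul_neg_mul_neg, hθ]
      have : ∫ t, (θ t • F t) i = (∫ t, θ t • F t) i :=
        (EuclideanSpace.proj (𝕜 := ℝ) i).integral_comp_comm hint
      rw [moll, ← this, ← integral_indicator hUm]
      congr 1; ext t
      by_cases h : t ∈ U <;> simp [hFdef, h, mul_comm]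
    rw [hρ.hgrad_moll hfl, e1, hw3 θ hθT i, neg_neg, e2]
  refine ⟨moll ρ f, hψ, ?_, ?_⟩
  · have h1 := hρ.eLpNorm_moll_sub_le hp hf (η := ε) fun y hy => (hball (hρδ hy)).1
    have h2 : eLpNorm (fun x => w x - moll ρ f x) (ENNReal.ofReal p) (volume.restrict K) =
        eLpNorm (fun x => moll ρ f x - f x) (ENNReal.ofReal p) (volume.restrict K) := by
      rw [← eLpNorm_neg]
      exact eLpNorm_congr_ae ((ae_restrict_mem hK.measurableSet).mono fun x hx => by
        simp [hfdef, hKU hx])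
    rw [h2]
    exact (eLpNorm_mono_measure _ Measure.restrict_le_self).trans h1
  · have h1 := hρ.eLpNorm_moll_sub_le hp hF (η := ε) fun y hy => (hball (hρδ hy)).2.1
    have h2 : eLpNorm (fun x => Dw x - hgrad (moll ρ f) x) (ENNReal.ofReal p) (volume.restrict K) =
        eLpNorm (fun x => moll ρ F x - F x) (ENNReal.ofReal p) (volume.restrict K) := by
      rw [← eLpNorm_neg]
      exact eLpNorm_congr_ae ((ae_restrict_mem hK.measurableSet).mono fun x hx => by
        simp [hFdef, hKU hx, hgr x hx])
    rw [h2]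
    exact (eLpNorm_mono_measure _ Measure.restrict_le_self).trans h1

end

/-! ### Test functions and the Poincaré inequality -/

section

open Filter Topology
variable {n : ℕ}

lemma link_mem_box (i₀ : Fin n) {r : ℝ} {h : Pt n} (hh : h ∈ box n r) {s : ℝ}
    (hs : s ∈ Icc (0 : ℝ) 1) : link i₀ r h s ∈ box n (38 * r) := by
  have hr : 0 < r := (norm_nonneg _).trans_lt (mem_box.1 hh).1
  have hl : ∫ τ in (0 : ℝ)..1, ‖linkVel i₀ r h τ‖ < 38 * r := by
    have := intervalIntegral.norm_integral_le_of_norm_le_const (a := (0 : ℝ)) (b := 1)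
      (f := fun s => ‖linkVel i₀ r h s‖) (C := 37 * r) (fun s hs => by
        rw [uIoc_of_le zero_le_one] at hs
        rw [norm_norm]
        exact norm_linkVel_le i₀ hh ⟨hs.1.le, hs.2⟩)
    have h2 := (le_abs_self _).trans this
    simp at h2
    linarith
  have := (isHorizontalCurve_link i₀ 0 hr.ne' h).mem_cbox hl hs
  simpa [cbox] using this

/-- Between two concentric boxes lies the closed box of the smaller radius, which is compact. -/
lemma exists_compact_between (y : Pt n) {r R : ℝ} (hr : 0 ≤ r) (hrR : r < R) :
    ∃ K, IsCompact K ∧ cbox y r ⊆ K ∧ K ⊆ cbox y R := by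
  refine ⟨mul y '' (Metric.closedBall 0 r ×ˢ Metric.closedBall 0 (r ^ 2)),
    ((isCompact_closedBall _ _).prod (isCompact_closedBall _ _)).image (by fun_prop), ?_, ?_⟩
  · intro x hx
    exact ⟨mul (-y) x, prod_mono Metric.ball_subset_closedBall Metric.ball_subset_closedBall hx,
      mul_neg_cancel y x⟩
  · rintro _ ⟨x, ⟨h1, h2⟩, rfl⟩
    show mul (-y) (mul y x) ∈ box n R
    rw [neg_mul_cancel, mem_box]
    simp only [Metric.mem_closedBall, dist_zero_right, Real.norm_eq_abs] at h1 h2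
    exact ⟨h1.trans_lt hrR, h2.trans_lt (by gcongr)⟩

lemma IsTest.mono {U V : Set (Pt n)} (hUV : U ⊆ V) {φ : Pt n → ℝ} (hφ : IsTest U φ) :
    IsTest V φ := ⟨hφ.1, hφ.2.1, hφ.2.2.trans hUV⟩

lemma IsTest.eq_zero {U : Set (Pt n)} {φ : Pt n → ℝ} (hφ : IsTest U φ) {x : Pt n} (hx : x ∉ U) :
    φ x = 0 := image_eq_zero_of_notMem_tsupport fun h => hx (hφ.2.2 h)

lemma hgrad_eq_zero_of_notMem_tsupport {φ : Pt n → ℝ} {x : Pt n} (hx : x ∉ tsupport φ) :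
    hgrad φ x = 0 := by
  ext i
  have : fderiv ℝ φ x = 0 := by
    by_contra h
    exact hx (support_fderiv_subset ℝ h)
  simp [this]

lemma IsTest.hgrad_eq_zero {U : Set (Pt n)} {φ : Pt n → ℝ} (hφ : IsTest U φ) {x : Pt n}
    (hx : x ∉ U) : hgrad φ x = 0 :=
  hgrad_eq_zero_of_notMem_tsupport fun h => hx (hφ.2.2 h)

lemma MemHW.mono {p : ℝ} {U V : Set (Pt n)} (hVU : V ⊆ U) {w : Pt n → ℝ} {Dw : Pt n → Hor n}
    (hw : MemHW p U w Dw) : MemHW p V w Dw := by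
  refine ⟨hw.1.mono_measure (Measure.restrict_mono hVU le_rfl),
    hw.2.1.mono_measure (Measure.restrict_mono hVU le_rfl), fun φ hφ i => ?_⟩
  have e1 : ∀ W, V ⊆ W → ∫ x in W, w x * hgrad φ x i = ∫ x, w x * hgrad φ x i := fun W hW =>
    setIntegral_eq_integral_of_forall_compl_eq_zero fun x hx => by
      simp only [hφ.hgrad_eq_zero (fun h => hx (hW h)), PiLp.zero_apply, mul_zero]
  have e2 : ∀ W, V ⊆ W → ∫ x in W, Dw x i * φ x = ∫ x, Dw x i * φ x := fun W hW =>
    setIntegral_eq_integral_of_forall_compl_eq_zero fun x hx => by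
      simp only [hφ.eq_zero (fun h => hx (hW h)), mul_zero]
  rw [e1 V le_rfl, e2 V le_rfl, ← e1 U hVU, ← e2 U hVU]
  exact hw.2.2 φ (hφ.mono hVU) i

lemma MemHW.one {p : ℝ} (hp : 1 ≤ p) {U : Set (Pt n)} (hU : volume U ≠ ∞) {w : Pt n → ℝ}
    {Dw : Pt n → Hor n} (hw : MemHW p U w Dw) : MemHW 1 U w Dw := by
  have : IsFiniteMeasure (volume.restrict U) := isFiniteMeasure_restrict.2 hU
  have h1 : ENNReal.ofReal 1 ≤ ENNReal.ofReal p := ENNReal.ofReal_le_ofReal hp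
  exact ⟨hw.1.mono_exponent h1, hw.2.1.mono_exponent h1, hw.2.2⟩

/-- Removes an approximation error `ε` that enters an estimate with finite factors. -/
lemma ENNReal.le_of_forall_pos_le_affine {a A B M : ℝ≥0∞} (hA : A ≠ ∞) (hM : M ≠ ∞)
    (h : ∀ ε : ℝ≥0∞, 0 < ε → a ≤ A * (B + ε) + M * ε) : a ≤ A * B := by
  have h0 := ENNReal.tendsto_inv_nat_nhds_zero
  have h1 : Tendsto (fun k : ℕ => A * (B + (k : ℝ≥0∞)⁻¹) + M * (k : ℝ≥0∞)⁻¹) atTop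
      (𝓝 (A * (B + 0) + M * 0)) :=
    (ENNReal.Tendsto.const_mul (tendsto_const_nhds.add h0) (Or.inr hA)).add
      (ENNReal.Tendsto.const_mul h0 (Or.inr hM))
  simp only [add_zero, mul_zero] at h1
  exact ge_of_tendsto' h1 fun k => h _ (by simp)

lemma setLIntegral_cbox_le {x y : Pt n} {r : ℝ} (hx : x ∈ cbox y r) {g : Pt n → ℝ≥0∞}
    (hg : Measurable g) :
    ∫⁻ x' in cbox y r, g x' ≤ ∫⁻ h in box n (2 * r), g (mul x h) := by
  have hm := (isOpen_cbox y r).measurableSet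
  have h0 := lintegral_comp_of_mp (measurePreserving_mul_left x)
    (f := (cbox y r).indicator g) (hg.indicator hm).aemeasurable
  rw [← lintegral_indicator hm, ← h0, ← lintegral_indicator (isOpen_box _).measurableSet]
  refine lintegral_mono fun h => ?_
  by_cases hh : mul x h ∈ cbox y r
  · have : h ∈ box n (2 * r) := by
      have h1 : y ∈ cbox x r := mem_cbox_comm.1 hx
      have h2 := mul_mem_box (show mul (-x) y ∈ box n r from h1) (show mul (-y) (mul x h) ∈ box n r from hh)
      rwa [mul_assoc', mul_neg_cancel, neg_mul_cancel, ← two_mul] at h2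
    rw [indicator_of_mem hh, indicator_of_mem this]
  · rw [indicator_of_notMem hh]; exact zero_le

/-- The mean oscillation of a smooth function over a box. Two points of the box differ by a right
translation in the box of radius `2 r`, and the links between them stay in the box of radius
`r + 38 * (2 r)`. -/
lemma lintegral_lintegral_sub_le [NeZero n] {ψ : Pt n → ℝ} (hψ : ContDiff ℝ 1 ψ) (y : Pt n)
    {r : ℝ} :
    ∫⁻ x in cbox y r, ∫⁻ x' in cbox y r, ‖ψ x' - ψ x‖ₑ ≤
      volume (box n (2 * r)) * ENNReal.ofReal (74 * r) *
        ∫⁻ x in cbox y (77 * r), ‖hgrad ψ x‖ₑ := by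
  have hc := hψ.continuous
  have hm : ∀ ρ, MeasurableSet (cbox y ρ) := fun ρ => (isOpen_cbox y ρ).measurableSet
  calc _ ≤ ∫⁻ x in cbox y r, ∫⁻ h in box n (2 * r), ‖ψ (mul x h) - ψ x‖ₑ := by
        refine lintegral_mono_ae ((ae_restrict_mem (hm r)).mono fun x hx => ?_)
        exact setLIntegral_cbox_le hx (by fun_prop)
    _ = ∫⁻ h in box n (2 * r), ∫⁻ x in cbox y r, ‖ψ (mul x h) - ψ x‖ₑ := by
        refine lintegral_lintegral_swap (Measurable.aemeasurable ?_)
        refine Measurable.enorm (Continuous.measurable ?_)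
        fun_prop
    _ ≤ ∫⁻ _ in box n (2 * r), ENNReal.ofReal (74 * r) *
          ∫⁻ x in cbox y (77 * r), ‖hgrad ψ x‖ₑ := by
        refine lintegral_mono_ae ((ae_restrict_mem (isOpen_box _).measurableSet).mono
          fun h hh => ?_)
        have := lintegral_translate_sub_le (0 : Fin n) hψ le_rfl hh (hm r) (hm (77 * r))
          (fun x hx s hs => by
            have := mul_mem_cbox hx (link_mem_box 0 hh hs)
            exact cbox_mono y (by linarith) this)
        simp only [ENNReal.rpow_one] at this
        rw [show 37 * (2 * r) = 74 * r by ring] at this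
        exact this
    _ = _ := by rw [lintegral_const, Measure.restrict_apply_univ]; ring

/-- The mean oscillation of a Sobolev function over a box, by approximation. -/
lemma MemHW.lintegral_lintegral_sub_le [NeZero n] {U : Set (Pt n)}
    {w : Pt n → ℝ} {Dw : Pt n → Hor n} (hw : MemHW 1 U w Dw) (hU : IsOpen U)
    (y : Pt n) {r : ℝ} (hr : 0 < r) (hrU : cbox y (78 * r) ⊆ U) :
    ∫⁻ x in cbox y r, ∫⁻ x' in cbox y r, ‖w x' - w x‖ₑ ≤
      volume (box n (2 * r)) * ENNReal.ofReal (74 * r) *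
        ∫⁻ x in cbox y (77 * r), ‖Dw x‖ₑ := by
  obtain ⟨K, hK, hrK, hKr⟩ := exists_compact_between y (show 0 ≤ 77 * r by positivity)
    (show 77 * r < 78 * r by linarith)
  set D := cbox y r
  have hDK : D ⊆ K := (cbox_mono y (by linarith)).trans hrK
  have hDU : D ⊆ U := hDK.trans (hKr.trans hrU)
  have hDv : volume D ≠ ∞ := by rw [volume_cbox y hr]; exact ENNReal.ofReal_ne_top
  have hwm : AEMeasurable w (volume.restrict D) :=
    (hw.1.1.mono_measure (Measure.restrict_mono hDU le_rfl)).aemeasurable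
  refine ENNReal.le_of_forall_pos_le_affine (M := 2 * volume D)
    (ENNReal.mul_ne_top (volume_box_ne_top (by linarith)) ENNReal.ofReal_ne_top)
    (ENNReal.mul_ne_top (by simp) hDv) fun ε hε => ?_
  obtain ⟨ψ, hψ, h1, h2⟩ := hw.exists_smooth_approx le_rfl hU hK (hKr.trans hrU) hε
  rw [ENNReal.ofReal_one, eLpNorm_one_eq_lintegral_enorm] at h1 h2
  have hψ1 : ContDiff ℝ 1 ψ := hψ.of_le (by simp)
  have hψc := hψ1.continuous
  have h1' : ∫⁻ x in D, ‖w x - ψ x‖ₑ ≤ ε := (lintegral_mono_set hDK).trans h1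
  have hsub : AEMeasurable (fun x => ‖w x - ψ x‖ₑ) (volume.restrict D) :=
    (hwm.sub hψc.aemeasurable).enorm
  have hgr : ∫⁻ x in cbox y (77 * r), ‖hgrad ψ x‖ₑ ≤
      (∫⁻ x in cbox y (77 * r), ‖Dw x‖ₑ) + ε := by
    calc _ ≤ ∫⁻ x in cbox y (77 * r), (‖hgrad ψ x - Dw x‖ₑ + ‖Dw x‖ₑ) := by
          gcongr with x
          refine le_trans (le_of_eq ?_) (enorm_add_le _ _)
          rw [sub_add_cancel]
      _ = (∫⁻ x in cbox y (77 * r), ‖hgrad ψ x - Dw x‖ₑ) +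
            ∫⁻ x in cbox y (77 * r), ‖Dw x‖ₑ :=
          lintegral_add_right' _ (hw.2.1.1.mono_measure
            (Measure.restrict_mono (hrK.trans (hKr.trans hrU)) le_rfl)).enorm
      _ ≤ ε + _ := by
          gcongr
          refine le_trans (le_of_eq ?_) ((lintegral_mono_set hrK).trans h2)
          simp only [← enorm_neg (hgrad ψ _ - _), neg_sub]
      _ = _ := add_comm _ _
  calc ∫⁻ x in D, ∫⁻ x' in D, ‖w x' - w x‖ₑ
      ≤ ∫⁻ x in D, ((∫⁻ x' in D, ‖ψ x' - ψ x‖ₑ) + (ε + volume D * ‖w x - ψ x‖ₑ)) := by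
        refine lintegral_mono fun x => ?_
        calc _ ≤ ∫⁻ x' in D, (‖ψ x' - ψ x‖ₑ + (‖w x' - ψ x'‖ₑ + ‖w x - ψ x‖ₑ)) := by
              refine lintegral_mono fun x' => ?_
              have e : w x' - w x = (ψ x' - ψ x) + ((w x' - ψ x') + -(w x - ψ x)) := by ring
              rw [e]
              refine (enorm_add_le _ _).trans ?_
              gcongr
              refine (enorm_add_le _ _).trans ?_
              rw [enorm_neg]
          _ = (∫⁻ x' in D, ‖ψ x' - ψ x‖ₑ) +
                ((∫⁻ x' in D, ‖w x' - ψ x'‖ₑ) + ∫⁻ _ in D, ‖w x - ψ x‖ₑ) := by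
              rw [lintegral_add_right' _ (hsub.add_const _), lintegral_add_right' _ aemeasurable_const]
          _ ≤ _ := by
              rw [lintegral_const, Measure.restrict_apply_univ, mul_comm (volume D)]
              gcongr
    _ = (∫⁻ x in D, ∫⁻ x' in D, ‖ψ x' - ψ x‖ₑ) +
          (∫⁻ _ in D, ε) + volume D * ∫⁻ x in D, ‖w x - ψ x‖ₑ := by
        rw [lintegral_add_right' _ ((hsub.const_mul _).const_add _),
          lintegral_add_right' _ (hsub.const_mul _), lintegral_const_mul'' _ hsub, add_assoc]
    _ ≤ volume (box n (2 * r)) * ENNReal.ofReal (74 * r) *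
          ((∫⁻ x in cbox y (77 * r), ‖Dw x‖ₑ) + ε) + ε * volume D + volume D * ε := by
        rw [lintegral_const, Measure.restrict_apply_univ]
        gcongr
        exact (Heis.lintegral_lintegral_sub_le hψ1 y).trans (by gcongr)
    _ = _ := by ring

/-- The Poincaré inequality on boxes, with exponent one and an enlarged box on the right. -/
lemma MemHW.exists_poincare [NeZero n] {U : Set (Pt n)}
    {w : Pt n → ℝ} {Dw : Pt n → Hor n} (hw : MemHW 1 U w Dw) (hU : IsOpen U)
    (y : Pt n) {r : ℝ} (hr : 0 < r) (hrU : cbox y (78 * r) ⊆ U) :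
    ∃ c : ℝ, ∫⁻ x in cbox y r, ‖w x - c‖ₑ ≤
      ENNReal.ofReal (74 * 2 ^ homDim n * r) * ∫⁻ x in cbox y (77 * r), ‖Dw x‖ₑ := by
  have hv := volume_cbox y hr
  have hb := boxVol_pos n
  have hv0 : volume (cbox y r) ≠ 0 := by
    rw [hv]; simp; positivity
  have hwm : AEStronglyMeasurable w (volume.restrict (cbox y r)) :=
    hw.1.1.mono_measure (Measure.restrict_mono ((cbox_mono y (by linarith)).trans hrU) le_rfl)
  have hm : AEMeasurable (Function.uncurry fun x x' => ‖w x' - w x‖ₑ)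
      ((volume.restrict (cbox y r)).prod (volume.restrict (cbox y r))) :=
    (hwm.comp_snd.sub hwm.comp_fst).enorm
  -- The constant is the value of `w` at a point where the oscillation is at most its average.
  obtain ⟨x, -, hx⟩ := exists_le_setLAverage hv0 (hv ▸ ENNReal.ofReal_ne_top)
    hm.lintegral_prod_right'
  refine ⟨w x, hx.trans ?_⟩
  rw [setLAverage_eq]
  refine (ENNReal.div_le_div_right (hw.lintegral_lintegral_sub_le hU y hr hrU) _).trans ?_
  rw [hv, volume_box (by linarith), ENNReal.div_eq_inv_mul, ← mul_assoc, ← mul_assoc,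
    ← ENNReal.ofReal_inv_of_pos (by positivity), ← ENNReal.ofReal_mul (by positivity),
    ← ENNReal.ofReal_mul (by positivity)]
  refine le_of_eq ?_
  congr 2
  rw [mul_pow]
  field_simp

end

/-! ### Monotonicity and growth of the vector field -/

section

open Filter Topology
variable {n : ℕ}

/-- The constant of the weighted monotonicity inequality for `a(x, ·)`. The factors come from
integrating the ellipticity over `[3 / 4, 1]`, where the squared norm of the argument is bounded
below by an eighth of the sum of the squared norms of the endpoints. -/
def monoConst (p : ℝ) : ℝ := 1 / 4 * (1 / 8) ^ ((p - 2) / 2)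

lemma monoConst_pos (p : ℝ) : 0 < monoConst p := by unfold monoConst; positivity

lemma rpow_mul_sq {t p : ℝ} (ht : 0 ≤ t) (hp : 2 ≤ p) : (t ^ 2) ^ ((p - 2) / 2) * t ^ 2 = t ^ p := by
  rw [← Real.rpow_natCast, ← Real.rpow_mul ht, ← Real.rpow_add_of_nonneg ht (by push_cast; linarith)
    (by norm_num)]
  congr 1; push_cast; ring

lemma weight_mul_sq_le {t s p : ℝ} (ht : 0 ≤ t) (hs : 0 ≤ s) (hp : 2 ≤ p) :
    (t ^ 2 + s ^ 2) ^ ((p - 2) / 2) * t ^ 2 ≤ (t + s) ^ p := by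
  rw [← rpow_mul_sq (add_nonneg ht hs) hp]
  have h : 0 ≤ (p - 2) / 2 := by linarith
  gcongr
  · nlinarith [mul_nonneg ht hs]
  · linarith

lemma weight_mul_le {t s p : ℝ} (ht : 0 ≤ t) (hs : 0 ≤ s) (hp : 2 ≤ p) :
    (t ^ 2 + s ^ 2) ^ ((p - 2) / 2) * t ≤ (t + s) ^ (p - 1) := by
  have hts := add_nonneg ht hs
  have h : 0 ≤ (p - 2) / 2 := by linarith
  have h1 : (t + s) ^ (p - 1) = ((t + s) ^ 2) ^ ((p - 2) / 2) * (t + s) := by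
    nth_rewrite 3 [← Real.rpow_one (t + s)]
    rw [← Real.rpow_natCast, ← Real.rpow_mul hts,
      ← Real.rpow_add_of_nonneg hts (by push_cast; linarith) zero_le_one]
    congr 1; push_cast; ring
  rw [h1]
  gcongr
  · nlinarith [mul_nonneg ht hs]
  · linarith

namespace StructureCondition
variable {Ω : Set (Pt n)} {a : Pt n → Hor n → Hor n} {p L L' s α : ℝ}

/-- By symmetry the bound on the quadratic form bounds the operator norm. -/
lemma norm_fderiv_le (h : StructureCondition Ω a p L L' s α) (hL : 0 ≤ L) {x : Pt n}
    (hx : x ∈ Ω) (z : Hor n) :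
    ‖fderiv ℝ (a x) z‖ ≤ L * (‖z‖ ^ 2 + s ^ 2) ^ ((p - 2) / 2) := by
  set Λ := L * (‖z‖ ^ 2 + s ^ 2) ^ ((p - 2) / 2) with hΛ
  have hΛ0 : 0 ≤ Λ := by positivity
  set B := fderiv ℝ (a x) z with hB
  refine ContinuousLinearMap.opNorm_le_bound _ hΛ0 fun ξ => ?_
  -- polarization: `4 ⟨B ξ, η⟩ ≤ Λ |ξ + η|²`
  have hpol : ∀ η, 4 * inner ℝ (B ξ) η ≤ Λ * ‖ξ + η‖ ^ 2 := by
    intro η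
    have h1 := h.upper x hx z (ξ + η)
    have h2 := (by positivity : 0 ≤ (‖z‖ ^ 2 + s ^ 2) ^ ((p - 2) / 2) * ‖ξ - η‖ ^ 2).trans
      (h.lower x hx z (ξ - η))
    have h3 : inner ℝ (B η) ξ = inner ℝ (B ξ) η := by
      rw [h.symmetric x hx z η ξ, real_inner_comm]
    rw [← hΛ, ← hB, map_add, inner_add_left, inner_add_right, inner_add_right, h3] at h1
    rw [← hB, map_sub, inner_sub_left, inner_sub_right, inner_sub_right, h3] at h2
    linarith
  rcases eq_or_ne (B ξ) 0 with h0 | h0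
  · rw [h0, norm_zero]; positivity
  have hn : 0 < ‖B ξ‖ := norm_pos_iff.2 h0
  have h4 := hpol ((‖ξ‖ / ‖B ξ‖) • B ξ)
  have h5 : ‖(‖ξ‖ / ‖B ξ‖) • B ξ‖ = ‖ξ‖ := by
    rw [norm_smul, norm_div, norm_norm, norm_norm, div_mul_cancel₀ _ hn.ne']
  rw [inner_smul_right, real_inner_self_eq_norm_sq] at h4
  have h6 : ‖ξ + (‖ξ‖ / ‖B ξ‖) • B ξ‖ ≤ 2 * ‖ξ‖ := by
    refine (norm_add_le _ _).trans ?_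
    rw [h5]; linarith
  have h7 : ‖ξ + (‖ξ‖ / ‖B ξ‖) • B ξ‖ ^ 2 ≤ (2 * ‖ξ‖) ^ 2 := by gcongr
  have h8 : ‖ξ‖ / ‖B ξ‖ * ‖B ξ‖ ^ 2 = ‖ξ‖ * ‖B ξ‖ := by field_simp
  rw [h8] at h4
  have h9 : 4 * (‖ξ‖ * ‖B ξ‖) ≤ Λ * (2 * ‖ξ‖) ^ 2 := h4.trans (by gcongr)
  have hξ : 0 < ‖ξ‖ := norm_pos_iff.2 fun h => h0 (by rw [h, map_zero])
  nlinarith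

lemma norm_sub_zero_le (h : StructureCondition Ω a p L L' s α) (hL : 0 ≤ L) (hp : 2 ≤ p)
    {x : Pt n} (hx : x ∈ Ω) (z : Hor n) :
    ‖a x z - a x 0‖ ≤ L * ((‖z‖ ^ 2 + s ^ 2) ^ ((p - 2) / 2) * ‖z‖) := by
  have hd := (h.contDiff x hx).differentiable one_ne_zero
  have he : 0 ≤ (p - 2) / 2 := by linarith
  have := (convex_closedBall (0 : Hor n) ‖z‖).norm_image_sub_le_of_norm_fderiv_le (𝕜 := ℝ)
    (f := a x) (C := L * (‖z‖ ^ 2 + s ^ 2) ^ ((p - 2) / 2)) (fun y _ => hd y)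
    (fun y hy => (h.norm_fderiv_le hL hx y).trans (by
      have : ‖y‖ ≤ ‖z‖ := by simpa using hy
      gcongr)) (Metric.mem_closedBall_self (norm_nonneg _)) (by simp : z ∈ _)
  rw [sub_zero] at this
  linarith

/-- The Hölder condition carries the factor `|z|`, which forces `a(x, 0)` not to depend on `x`. -/
lemma apply_zero_eq (h : StructureCondition Ω a p L L' s α) {x y : Pt n} (hx : x ∈ Ω)
    (hy : y ∈ Ω) : a x 0 = a y 0 := by
  have := h.holder x hx y hy 0
  simp only [norm_zero, mul_zero, zero_mul] at this
  exact sub_eq_zero.1 (norm_le_zero_iff.1 this)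

/-- Weighted monotonicity when the first argument has the larger norm. The derivative of
`t ↦ ⟨a(x, z₂ + t (z₁ - z₂)), z₁ - z₂⟩` is nonnegative, and on `[3 / 4, 1]` the segment stays away
from the origin, where the ellipticity may degenerate. -/
lemma monotone_weight_of_norm_le (h : StructureCondition Ω a p L L' s α) (hp : 2 ≤ p)
    {x : Pt n} (hx : x ∈ Ω)
    {z₁ z₂ : Hor n} (hz : ‖z₂‖ ≤ ‖z₁‖) :
    monoConst p * ((‖z₁‖ ^ 2 + ‖z₂‖ ^ 2 + s ^ 2) ^ ((p - 2) / 2) * ‖z₁ - z₂‖ ^ 2) ≤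
      inner ℝ (a x z₁ - a x z₂) (z₁ - z₂) := by
  have he : 0 ≤ (p - 2) / 2 := by linarith
  have hd := (h.contDiff x hx).differentiable one_ne_zero
  set ζ := z₁ - z₂ with hζ
  set f : ℝ → ℝ := fun t => inner ℝ (a x (z₂ + t • ζ)) ζ with hf
  have hder : ∀ t, HasDerivAt f (inner ℝ (fderiv ℝ (a x) (z₂ + t • ζ) ζ) ζ) t := by
    intro t
    have h1 : HasDerivAt (fun t : ℝ => z₂ + t • ζ) ζ t := by
      simpa using ((hasDerivAt_id t).smul_const ζ).const_add z₂
    have h2 := (hd (z₂ + t • ζ)).hasFDerivAt.comp_hasDerivAt t h1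
    have := HasDerivAt.inner ℝ h2 (hasDerivAt_const t ζ)
    simpa using this
  have hmono : Monotone f := by
    refine monotone_of_deriv_nonneg (fun t => (hder t).differentiableAt) fun t => ?_
    rw [(hder t).deriv]
    exact (by positivity : 0 ≤ (‖z₂ + t • ζ‖ ^ 2 + s ^ 2) ^ ((p - 2) / 2) * ‖ζ‖ ^ 2).trans
      (h.lower x hx _ ζ)
  obtain ⟨t, ht, hslope⟩ := exists_hasDerivAt_eq_slope f _ (show (3 / 4 : ℝ) < 1 by norm_num)
    (fun t _ => (hder t).continuousAt.continuousWithinAt) (fun t _ => hder t)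
  have h0 : f 0 ≤ f (3 / 4) := hmono (by norm_num)
  have hf0 : f 0 = inner ℝ (a x z₂) ζ := by simp [hf]
  have hf1 : f 1 = inner ℝ (a x z₁) ζ := by simp [hf, hζ]
  have hlow := h.lower x hx (z₂ + t • ζ) ζ
  rw [hslope] at hlow
  have hzt : ‖z₁‖ / 2 ≤ ‖z₂ + t • ζ‖ := by
    have e : t • z₁ = (z₂ + t • ζ) - (1 - t) • z₂ := by rw [hζ]; module
    have h1 : t * ‖z₁‖ ≤ ‖z₂ + t • ζ‖ + (1 - t) * ‖z₂‖ := by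
      calc t * ‖z₁‖ = ‖t • z₁‖ := by
            rw [norm_smul, Real.norm_of_nonneg (by linarith [ht.1])]
        _ ≤ ‖z₂ + t • ζ‖ + ‖(1 - t) • z₂‖ := by rw [e]; exact norm_sub_le _ _
        _ = _ := by rw [norm_smul, Real.norm_of_nonneg (by linarith [ht.2])]
    nlinarith [ht.1, ht.2, norm_nonneg z₁, norm_nonneg z₂]
  have hW : 1 / 8 * (‖z₁‖ ^ 2 + ‖z₂‖ ^ 2 + s ^ 2) ≤ ‖z₂ + t • ζ‖ ^ 2 + s ^ 2 := by
    nlinarith [norm_nonneg z₁, norm_nonneg z₂, sq_nonneg s]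
  have hpow : (1 / 8 : ℝ) ^ ((p - 2) / 2) * (‖z₁‖ ^ 2 + ‖z₂‖ ^ 2 + s ^ 2) ^ ((p - 2) / 2) ≤
      (‖z₂ + t • ζ‖ ^ 2 + s ^ 2) ^ ((p - 2) / 2) := by
    rw [← Real.mul_rpow (by norm_num) (by positivity)]
    gcongr
  have hfin := mul_le_mul_of_nonneg_right hpow (sq_nonneg ‖ζ‖)
  rw [inner_sub_left, ← hf0, ← hf1]
  unfold monoConst
  norm_num at hlow hfin ⊢
  nlinarith

/-- Strict monotonicity of `a(x, ·)`, in weighted form. -/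
lemma monotone_weight (h : StructureCondition Ω a p L L' s α) (hp : 2 ≤ p) {x : Pt n}
    (hx : x ∈ Ω) (z₁ z₂ : Hor n) :
    monoConst p * ((‖z₁‖ ^ 2 + ‖z₂‖ ^ 2 + s ^ 2) ^ ((p - 2) / 2) * ‖z₁ - z₂‖ ^ 2) ≤
      inner ℝ (a x z₁ - a x z₂) (z₁ - z₂) := by
  rcases le_total ‖z₂‖ ‖z₁‖ with hz | hz
  · exact h.monotone_weight_of_norm_le hp hx hz
  · have := h.monotone_weight_of_norm_le hp hx hz
    rw [norm_sub_rev, add_comm (‖z₂‖ ^ 2)] at this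
    refine this.trans (le_of_eq ?_)
    rw [← neg_sub (a x z₁), ← neg_sub z₁, inner_neg_neg]

end StructureCondition

lemma rpow_le_weight {p : ℝ} (hp : 2 ≤ p) (s : ℝ) (z₁ z₂ : Hor n) :
    (1 / 2) ^ ((p - 2) / 2) * ‖z₁ - z₂‖ ^ p ≤
      (‖z₁‖ ^ 2 + ‖z₂‖ ^ 2 + s ^ 2) ^ ((p - 2) / 2) * ‖z₁ - z₂‖ ^ 2 := by
  have he : 0 ≤ (p - 2) / 2 := by linarith
  rw [← rpow_mul_sq (norm_nonneg _) hp, ← mul_assoc,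
    ← Real.mul_rpow (by norm_num) (by positivity)]
  gcongr
  have h1 := norm_sub_le z₁ z₂
  nlinarith [norm_nonneg z₁, norm_nonneg z₂, sq_nonneg s, sq_nonneg (‖z₁‖ - ‖z₂‖),
    norm_nonneg (z₁ - z₂)]

namespace StructureCondition
variable {Ω : Set (Pt n)} {a : Pt n → Hor n → Hor n} {p L L' s α : ℝ}

/-- Strict monotonicity of `a(x, ·)`. -/
lemma monotone_rpow (h : StructureCondition Ω a p L L' s α) (hp : 2 ≤ p) {x : Pt n}
    (hx : x ∈ Ω) (z₁ z₂ : Hor n) :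
    monoConst p * (1 / 2) ^ ((p - 2) / 2) * ‖z₁ - z₂‖ ^ p ≤
      inner ℝ (a x z₁ - a x z₂) (z₁ - z₂) := by
  refine le_trans ?_ (h.monotone_weight hp hx z₁ z₂)
  rw [mul_assoc]
  exact mul_le_mul_of_nonneg_left (rpow_le_weight hp s z₁ z₂) (monoConst_pos p).le

/-- The pointwise comparison of the frozen and the unfrozen vector field. The error of freezing is
paired with `z₁ - z₂` and split by Young's inequality with the weight kept, so that half of the
weighted monotonicity absorbs one part and the oscillation enters squared in the other. -/
lemma frozen_comparison (h : StructureCondition Ω a p L L' s α) (hp : 2 ≤ p) (hs : 0 ≤ s)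
    {x x₀ : Pt n} (hx : x ∈ Ω) (hx₀ : x₀ ∈ Ω) {κ : ℝ}
    (hκ : L' * ccDist x₀ x ^ α ≤ κ) (z₁ z₂ : Hor n) :
    monoConst p / 2 * (1 / 2) ^ ((p - 2) / 2) * ‖z₁ - z₂‖ ^ p ≤
      inner ℝ (a x₀ z₁ - a x z₂) (z₁ - z₂) + κ ^ 2 / (2 * monoConst p) * (‖z₂‖ + s) ^ p := by
  have he : 0 ≤ (p - 2) / 2 := by linarith
  have hc := monoConst_pos p
  set c := monoConst p
  have h1 := h.monotone_weight hp hx₀ z₁ z₂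
  have h2 := rpow_le_weight hp s z₁ z₂
  have h3 := weight_mul_sq_le (norm_nonneg z₂) hs hp
  set ζ := z₁ - z₂ with hζ
  set W := (‖z₁‖ ^ 2 + ‖z₂‖ ^ 2 + s ^ 2) ^ ((p - 2) / 2) with hW
  set V := (‖z₂‖ ^ 2 + s ^ 2) ^ ((p - 2) / 2) with hV
  have hV0 : 0 ≤ V := by positivity
  have hVW : V ≤ W := by rw [hV, hW]; gcongr; nlinarith [sq_nonneg ‖z₁‖]
  have h4 : ‖a x₀ z₂ - a x z₂‖ ≤ κ * ‖z₂‖ * V := by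
    refine (h.holder x₀ hx₀ x hx z₂).trans ?_
    calc _ = (L' * ccDist x₀ x ^ α) * (‖z₂‖ * V) := by ring
      _ ≤ κ * (‖z₂‖ * V) := by gcongr
      _ = _ := by ring
  have h5 : -(κ * ‖z₂‖ * V * ‖ζ‖) ≤ inner ℝ (a x₀ z₂ - a x z₂) ζ := by
    have := (abs_real_inner_le_norm (a x₀ z₂ - a x z₂) ζ).trans
      (mul_le_mul_of_nonneg_right h4 (norm_nonneg ζ))
    exact (abs_le.1 this).1
  have h6 : inner ℝ (a x₀ z₁ - a x z₂) ζ =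
      inner ℝ (a x₀ z₁ - a x₀ z₂) ζ + inner ℝ (a x₀ z₂ - a x z₂) ζ := by
    rw [← inner_add_left]; congr 1; abel
  have h7 : κ * ‖z₂‖ * ‖ζ‖ ≤ c / 2 * ‖ζ‖ ^ 2 + κ ^ 2 / (2 * c) * ‖z₂‖ ^ 2 := by
    have : c / 2 * ‖ζ‖ ^ 2 + κ ^ 2 / (2 * c) * ‖z₂‖ ^ 2 - κ * ‖z₂‖ * ‖ζ‖ =
        1 / (2 * c) * (c * ‖ζ‖ - κ * ‖z₂‖) ^ 2 := by field_simp; ring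
    have : 0 ≤ 1 / (2 * c) * (c * ‖ζ‖ - κ * ‖z₂‖) ^ 2 := by positivity
    linarith
  have h8 := mul_le_mul_of_nonneg_left h7 hV0
  have h9 : V * ‖ζ‖ ^ 2 ≤ W * ‖ζ‖ ^ 2 := by gcongr
  have h10 : κ ^ 2 / (2 * c) * (V * ‖z₂‖ ^ 2) ≤ κ ^ 2 / (2 * c) * (‖z₂‖ + s) ^ p := by gcongr
  rw [h6]
  have h11 : c / 2 * ((1 / 2) ^ ((p - 2) / 2) * ‖ζ‖ ^ p) ≤ c / 2 * (W * ‖ζ‖ ^ 2) := by gcongr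
  have h12 : c / 2 * (V * ‖ζ‖ ^ 2) ≤ c / 2 * (W * ‖ζ‖ ^ 2) := by gcongr
  nlinarith

end StructureCondition

end

/-! ### Limits of test functions and truncations -/

section

open Filter Topology
variable {n : ℕ}

/-- The sequence of test functions `φ k` converges in `HW^{1,p}(U)` to `f`, with horizontal
gradient `F`. -/
structure TestLimit (p : ℝ) (U : Set (Pt n)) (φ : ℕ → Pt n → ℝ) (f : Pt n → ℝ)
    (F : Pt n → Hor n) : Prop where
  isTest : ∀ k, IsTest U (φ k)
  memLp : MemLp f (ENNReal.ofReal p) (volume.restrict U)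
  memLp_grad : MemLp F (ENNReal.ofReal p) (volume.restrict U)
  tendsto : Tendsto (fun k => eLpNorm (fun x => f x - φ k x) (ENNReal.ofReal p)
    (volume.restrict U)) atTop (𝓝 0)
  tendsto_grad : Tendsto (fun k => eLpNorm (fun x => F x - hgrad (φ k) x) (ENNReal.ofReal p)
    (volume.restrict U)) atTop (𝓝 0)

lemma IsTest.contDiff_one {U : Set (Pt n)} {φ : Pt n → ℝ} (hφ : IsTest U φ) : ContDiff ℝ 1 φ :=
  hφ.1.of_le (by simp)

lemma IsTest.continuous_hgrad {U : Set (Pt n)} {φ : Pt n → ℝ} (hφ : IsTest U φ) :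
    Continuous (hgrad φ) := Heis.continuous_hgrad hφ.contDiff_one

/-- Hölder's inequality for the pairing of fields with conjugate exponents. -/
lemma eLpNorm_inner_le {p : ℝ} (hp : 1 < p) {ν : Measure (Pt n)} {A F : Pt n → Hor n}
    (hA : AEStronglyMeasurable A ν) (hF : AEStronglyMeasurable F ν) :
    eLpNorm (fun x => inner ℝ (A x) (F x)) 1 ν ≤
      eLpNorm A (ENNReal.ofReal (p / (p - 1))) ν * eLpNorm F (ENNReal.ofReal p) ν := by
  have hpq : ENNReal.HolderConjugate (ENNReal.ofReal (p / (p - 1))) (ENNReal.ofReal p) :=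
    (Real.HolderConjugate.conjExponent hp).symm.ennrealOfReal
  have := eLpNorm_le_eLpNorm_mul_eLpNorm'_of_norm (p := ENNReal.ofReal (p / (p - 1)))
    (q := ENNReal.ofReal p) (r := 1) hA hF (fun u v => inner ℝ u v) 1
    (ae_of_all _ fun x => by simpa using norm_inner_le_norm (𝕜 := ℝ) (A x) (F x))
  simpa using this

lemma integrable_inner_of_memLp {p : ℝ} (hp : 1 < p) {ν : Measure (Pt n)} {A F : Pt n → Hor n}
    (hA : MemLp A (ENNReal.ofReal (p / (p - 1))) ν) (hF : MemLp F (ENNReal.ofReal p) ν) :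
    Integrable (fun x => inner ℝ (A x) (F x)) ν :=
  memLp_one_iff_integrable.1 ⟨hA.1.inner hF.1, (eLpNorm_inner_le hp hA.1 hF.1).trans_lt
    (ENNReal.mul_lt_top hA.2 hF.2)⟩

lemma IsTest.memLp_hgrad {U : Set (Pt n)} {φ : Pt n → ℝ} (hφ : IsTest U φ) (q : ℝ≥0∞)
    (V : Set (Pt n)) : MemLp (hgrad φ) q (volume.restrict V) :=
  (hφ.continuous_hgrad.memLp_of_hasCompactSupport (HasCompactSupport.intro hφ.2.1 fun _ hx =>
    hgrad_eq_zero_of_notMem_tsupport hx)).restrict _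

lemma MemHWZero.exists_testLimit {p : ℝ} {U : Set (Pt n)} {f : Pt n → ℝ} {F : Pt n → Hor n}
    (h : MemHWZero p U f F) : ∃ φ, TestLimit p U φ f F := by
  have h0 := ENNReal.tendsto_inv_nat_nhds_zero
  choose φ hφ hφ_lt using fun k : ℕ => h.2 (k : ℝ≥0∞)⁻¹ (by simp)
  refine ⟨φ, hφ, h.1.1, h.1.2.1, ?_, ?_⟩
  · exact tendsto_of_tendsto_of_tendsto_of_le_of_le tendsto_const_nhds h0 (fun _ => zero_le)
      fun k => le_self_add.trans (hφ_lt k).le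
  · exact tendsto_of_tendsto_of_tendsto_of_le_of_le tendsto_const_nhds h0 (fun _ => zero_le)
      fun k => le_add_self.trans (hφ_lt k).le

namespace TestLimit
variable {p : ℝ} {U : Set (Pt n)} {φ : ℕ → Pt n → ℝ} {f : Pt n → ℝ} {F : Pt n → Hor n}

lemma comp_subseq (h : TestLimit p U φ f F) {ns : ℕ → ℕ} (hns : StrictMono ns) :
    TestLimit p U (fun k => φ (ns k)) f F :=
  ⟨fun _ => h.isTest _, h.memLp, h.memLp_grad, h.tendsto.comp hns.tendsto_atTop,
    h.tendsto_grad.comp hns.tendsto_atTop⟩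

lemma exists_ae_tendsto (h : TestLimit p U φ f F) (hp : 0 < p) :
    ∃ ns : ℕ → ℕ, StrictMono ns ∧
      ∀ᵐ x ∂(volume.restrict U), Tendsto (fun k => φ (ns k) x) atTop (𝓝 (f x)) := by
  have h1 : TendstoInMeasure (volume.restrict U) φ atTop f := by
    refine tendstoInMeasure_of_tendsto_eLpNorm (p := ENNReal.ofReal p) (by simpa using hp)
      (fun k => (h.isTest k).1.continuous.aestronglyMeasurable) h.memLp.1 ?_
    refine h.tendsto.congr fun k => ?_
    rw [← eLpNorm_neg]
    congr 1; ext x; simp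
  exact h1.exists_seq_tendsto_ae

/-- The pairing with a field of conjugate integrability passes to the limit. -/
lemma tendsto_integral_inner (h : TestLimit p U φ f F) (hp : 1 < p) {A : Pt n → Hor n}
    (hA : MemLp A (ENNReal.ofReal (p / (p - 1))) (volume.restrict U)) :
    Tendsto (fun k => ∫ x in U, inner ℝ (A x) (hgrad (φ k) x)) atTop
      (𝓝 (∫ x in U, inner ℝ (A x) (F x))) := by
  rw [tendsto_iff_edist_tendsto_0]
  have h2 : Tendsto (fun k => eLpNorm A (ENNReal.ofReal (p / (p - 1))) (volume.restrict U) *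
      eLpNorm (fun x => F x - hgrad (φ k) x) (ENNReal.ofReal p) (volume.restrict U)) atTop
      (𝓝 (eLpNorm A (ENNReal.ofReal (p / (p - 1))) (volume.restrict U) * 0)) :=
    ENNReal.Tendsto.const_mul h.tendsto_grad (Or.inr hA.2.ne)
  rw [mul_zero] at h2
  refine tendsto_of_tendsto_of_tendsto_of_le_of_le tendsto_const_nhds h2 (fun _ => zero_le)
    fun k => ?_
  rw [edist_comm, edist_eq_enorm_sub, ← integral_sub (integrable_inner_of_memLp hp hA h.memLp_grad)
      (integrable_inner_of_memLp hp hA ((h.isTest k).memLp_hgrad _ U))]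
  refine (enorm_integral_le_lintegral_enorm _).trans ?_
  rw [← eLpNorm_one_eq_lintegral_enorm]
  refine le_trans (le_of_eq ?_) (eLpNorm_inner_le hp hA.1
    (h.memLp_grad.1.sub ((h.isTest k).memLp_hgrad (ENNReal.ofReal p) U).1))
  congr 1; ext x; rw [inner_sub_right]

end TestLimit

/-- A smooth truncation at height comparable to `k`. Being smooth and vanishing at the origin, it
maps test functions to test functions, which a piecewise linear truncation does not. -/
def trunc (k t : ℝ) : ℝ := k * Real.arctan (t / k)

/-- The derivative of `trunc k`. -/
def trunc' (k t : ℝ) : ℝ := 1 / (1 + (t / k) ^ 2)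

lemma hasDerivAt_trunc {k : ℝ} (hk : k ≠ 0) (t : ℝ) : HasDerivAt (trunc k) (trunc' k t) t := by
  have := ((hasDerivAt_id t).div_const k).arctan.const_mul k
  refine this.congr_deriv ?_
  simp only [trunc', id]
  field_simp

lemma trunc'_nonneg (k t : ℝ) : 0 ≤ trunc' k t := by unfold trunc'; positivity

lemma trunc'_le_one (k t : ℝ) : trunc' k t ≤ 1 := by
  unfold trunc'
  rw [div_le_one (by positivity)]
  nlinarith [sq_nonneg (t / k)]

lemma continuous_trunc' (k : ℝ) : Continuous (trunc' k) := by
  unfold trunc'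
  refine continuous_const.div (by fun_prop) fun t => ?_
  positivity

lemma abs_trunc_le {k : ℝ} (hk : 0 < k) (t : ℝ) : |trunc k t| ≤ 2 * k := by
  unfold trunc
  rw [abs_mul, abs_of_pos hk]
  have h1 : |Real.arctan (t / k)| ≤ 2 := by
    rw [abs_le]
    constructor <;> linarith [Real.arctan_lt_pi_div_two (t / k),
      Real.neg_pi_div_two_lt_arctan (t / k), Real.pi_le_four]
  nlinarith

lemma abs_trunc_sub_le {k : ℝ} (hk : k ≠ 0) (t t' : ℝ) : |trunc k t - trunc k t'| ≤ |t - t'| := by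
  have := convex_univ.norm_image_sub_le_of_norm_hasDerivWithin_le (f := trunc k)
    (f' := trunc' k) (C := 1) (fun x _ => (hasDerivAt_trunc hk x).hasDerivWithinAt)
    (fun x _ => by
      rw [Real.norm_of_nonneg (trunc'_nonneg k x)]; exact trunc'_le_one k x)
    (mem_univ t') (mem_univ t)
  simpa using this

lemma contDiff_trunc (k : ℝ) : ContDiff ℝ (⊤ : ℕ∞) (trunc k) := by
  unfold trunc
  exact contDiff_const.mul (Real.contDiff_arctan.comp (by fun_prop))

lemma IsTest.trunc {U : Set (Pt n)} {φ : Pt n → ℝ} (hφ : IsTest U φ) (k : ℝ) :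
    IsTest U (fun x => trunc k (φ x)) := by
  have h0 : Heis.trunc k 0 = 0 := by simp [Heis.trunc]
  exact ⟨(contDiff_trunc k).comp hφ.1, hφ.2.1.comp_left h0,
    (tsupport_comp_subset h0 φ).trans hφ.2.2⟩

lemma hgrad_trunc {k : ℝ} (hk : k ≠ 0) {φ : Pt n → ℝ} (hφ : Differentiable ℝ φ) (x : Pt n) :
    hgrad (fun x => trunc k (φ x)) x = trunc' k (φ x) • hgrad φ x := by
  have h := (hasDerivAt_trunc hk (φ x)).comp_hasFDerivAt x (hφ x).hasFDerivAt
  ext i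
  rw [PiLp.smul_apply, hgrad_apply, hgrad_apply]
  exact congrArg (fun T => T (hfield i x)) h.fderiv

/-- The chain rule for `trunc k` on limits of test functions. Convergence almost everywhere is used
to pass to the limit in the factor `trunc' k (φ j x)`, by dominated convergence. -/
lemma TestLimit.trunc {p : ℝ} (hp : 1 ≤ p) {U : Set (Pt n)} {φ : ℕ → Pt n → ℝ} {f : Pt n → ℝ}
    {F : Pt n → Hor n} (h : TestLimit p U φ f F)
    (hae : ∀ᵐ x ∂(volume.restrict U), Tendsto (fun j => φ j x) atTop (𝓝 (f x)))
    {k : ℝ} (hk : 0 < k) :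
    TestLimit p U (fun j x => trunc k (φ j x)) (fun x => trunc k (f x))
      (fun x => trunc' k (f x) • F x) := by
  have hp0 : 0 < p := by linarith
  have hP : (1 : ℝ≥0∞) ≤ ENNReal.ofReal p := by simpa using hp
  have hPr : (ENNReal.ofReal p).toReal = p := ENNReal.toReal_ofReal hp0.le
  have hP0 : ENNReal.ofReal p ≠ 0 := by simpa using hp0
  have hcm : ∀ {g : Pt n → ℝ}, AEStronglyMeasurable g (volume.restrict U) →
      AEStronglyMeasurable (fun x => trunc' k (g x)) (volume.restrict U) := fun hg =>
    (continuous_trunc' k).comp_aestronglyMeasurable hg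
  have hφm : ∀ j, AEStronglyMeasurable (φ j) (volume.restrict U) := fun j =>
    (h.isTest j).1.continuous.aestronglyMeasurable
  refine ⟨fun j => (h.isTest j).trunc k, ?_, ?_, ?_, ?_⟩
  · refine h.memLp.mono ((contDiff_trunc k).continuous.comp_aestronglyMeasurable h.memLp.1)
      (ae_of_all _ fun x => ?_)
    have := abs_trunc_sub_le hk.ne' (f x) 0
    simpa [Heis.trunc] using this
  · refine h.memLp_grad.mono ((hcm h.memLp.1).smul h.memLp_grad.1) (ae_of_all _ fun x => ?_)
    rw [norm_smul, Real.norm_of_nonneg (trunc'_nonneg k _)]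
    exact mul_le_of_le_one_left (norm_nonneg _) (trunc'_le_one k _)
  · refine tendsto_of_tendsto_of_tendsto_of_le_of_le tendsto_const_nhds h.tendsto
      (fun _ => zero_le) fun j => eLpNorm_mono fun x => ?_
    exact abs_trunc_sub_le hk.ne' _ _
  · have h1 : Tendsto (fun j => eLpNorm (fun x => (trunc' k (f x) - trunc' k (φ j x)) • F x)
        (ENNReal.ofReal p) (volume.restrict U)) atTop (𝓝 0) := by
      have h2 : Tendsto (fun j => ∫⁻ x in U,
          ‖(trunc' k (f x) - trunc' k (φ j x)) • F x‖ₑ ^ p) atTop (𝓝 (∫⁻ _ in U, 0)) := by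
        refine tendsto_lintegral_of_dominated_convergence' (fun x => ‖F x‖ₑ ^ p) ?_ ?_ ?_ ?_
        · exact fun j => ((((hcm h.memLp.1).sub (hcm (hφm j))).smul
            h.memLp_grad.1).enorm).pow_const p
        · refine fun j => ae_of_all _ fun x => ?_
          refine ENNReal.rpow_le_rpow ?_ hp0.le
          rw [enorm_smul]
          refine mul_le_of_le_one_left zero_le ?_
          rw [← ofReal_norm, Real.norm_eq_abs]
          refine ENNReal.ofReal_le_one.2 (abs_le.2 ⟨?_, ?_⟩) <;>
            linarith [trunc'_nonneg k (f x), trunc'_nonneg k (φ j x), trunc'_le_one k (f x),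
              trunc'_le_one k (φ j x)]
        · have := lintegral_rpow_enorm_lt_top_of_eLpNorm_lt_top hP0 ENNReal.ofReal_ne_top
            h.memLp_grad.2
          rw [hPr] at this
          exact this.ne
        · filter_upwards [hae] with x hx
          have h3 : Tendsto (fun j => (trunc' k (f x) - trunc' k (φ j x)) • F x) atTop
              (𝓝 ((trunc' k (f x) - trunc' k (f x)) • F x)) :=
            (tendsto_const_nhds.sub (((continuous_trunc' k).tendsto _).comp hx)).smul_const _
          rw [sub_self, zero_smul] at h3
          have h4 := (h3.enorm).ennrpow_const p
          simpa [hp0] using h4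
      rw [lintegral_zero] at h2
      have h3 := h2.ennrpow_const (1 / p)
      rw [ENNReal.zero_rpow_of_pos (by positivity)] at h3
      refine h3.congr fun j => ?_
      rw [eLpNorm_eq_lintegral_rpow_enorm_toReal hP0 ENNReal.ofReal_ne_top, hPr]
    have h5 := h1.add h.tendsto_grad
    rw [add_zero] at h5
    refine tendsto_of_tendsto_of_tendsto_of_le_of_le tendsto_const_nhds h5
      (fun _ => zero_le) fun j => ?_
    have e : (fun x => trunc' k (f x) • F x - hgrad (fun x => Heis.trunc k (φ j x)) x) =
        (fun x => (trunc' k (f x) - trunc' k (φ j x)) • F x) +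
          fun x => trunc' k (φ j x) • (F x - hgrad (φ j) x) := by
      ext1 x
      rw [hgrad_trunc hk.ne' ((h.isTest j).1.differentiable (by simp))]
      simp only [Pi.add_apply]
      module
    dsimp only
    rw [e]
    refine (eLpNorm_add_le (((hcm h.memLp.1).sub (hcm (hφm j))).smul h.memLp_grad.1)
      ((hcm (hφm j)).smul (h.memLp_grad.1.sub
        (h.isTest j).continuous_hgrad.aestronglyMeasurable)) hP).trans ?_
    refine add_le_add le_rfl (eLpNorm_mono fun x => ?_)
    simp only [Pi.smul_apply', Pi.sub_apply]
    rw [norm_smul, Real.norm_of_nonneg (trunc'_nonneg k _)]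
    exact mul_le_of_le_one_left (norm_nonneg _) (trunc'_le_one k _)

end

/-! ### Translates and cutoffs of Sobolev functions -/

section

open Filter Topology
variable {n : ℕ}

/-- The `L^p` distance of a test function from its right translate by an element of a box. -/
lemma IsTest.eLpNorm_translate_le [NeZero n] {p : ℝ} (hp : 1 ≤ p) {U : Set (Pt n)}
    (hU : MeasurableSet U) {φ : Pt n → ℝ} (hφ : IsTest U φ) {r : ℝ} {g : Pt n}
    (hg : g ∈ box n r) :
    eLpNorm (fun x => φ (mul x g) - φ x) (ENNReal.ofReal p) volume ≤
      ENNReal.ofReal (37 * r) * eLpNorm (hgrad φ) (ENNReal.ofReal p) (volume.restrict U) := by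
  have hp0 : 0 < p := by linarith
  have hPr : (ENNReal.ofReal p).toReal = p := ENNReal.toReal_ofReal hp0.le
  have hP0 : ENNReal.ofReal p ≠ 0 := by simpa using hp0
  have h1 := lintegral_translate_sub_le (0 : Fin n) hφ.contDiff_one hp hg MeasurableSet.univ
    MeasurableSet.univ (fun _ _ _ _ => mem_univ _)
  rw [Measure.restrict_univ] at h1
  have h2 : ∫⁻ x, ‖hgrad φ x‖ₑ ^ p = ∫⁻ x in U, ‖hgrad φ x‖ₑ ^ p := by
    rw [← lintegral_indicator hU]
    congr 1; ext x
    by_cases hx : x ∈ U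
    · simp [hx]
    · simp [hx, hφ.hgrad_eq_zero hx, hp0]
  rw [eLpNorm_eq_lintegral_rpow_enorm_toReal hP0 ENNReal.ofReal_ne_top,
    eLpNorm_eq_lintegral_rpow_enorm_toReal hP0 ENNReal.ofReal_ne_top, hPr, ← h2]
  have h3 := ENNReal.rpow_le_rpow h1 (show 0 ≤ 1 / p by positivity)
  rwa [ENNReal.mul_rpow_of_nonneg _ _ (by positivity), ← ENNReal.rpow_mul,
    mul_one_div_cancel hp0.ne', ENNReal.rpow_one] at h3

/-- Limits of test functions, extended by zero, are close to their right translates. -/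
lemma TestLimit.lintegral_translate_le [NeZero n] {p : ℝ} (hp : 1 ≤ p) {U : Set (Pt n)}
    (hU : MeasurableSet U) {φ : ℕ → Pt n → ℝ} {f : Pt n → ℝ} {F : Pt n → Hor n}
    (h : TestLimit p U φ f F) {r : ℝ} {g : Pt n} (hg : g ∈ box n r) :
    ∫⁻ x, ‖U.indicator f (mul x g) - U.indicator f x‖ₑ ^ p ≤
      ENNReal.ofReal (37 * r) ^ p * ∫⁻ x in U, ‖F x‖ₑ ^ p := by
  have hp0 : 0 < p := by linarith
  have hP : (1 : ℝ≥0∞) ≤ ENNReal.ofReal p := by simpa using hp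
  have hPr : (ENNReal.ofReal p).toReal = p := ENNReal.toReal_ofReal hp0.le
  have hP0 : ENNReal.ofReal p ≠ 0 := by simpa using hp0
  have hconv : ∀ {E : Type} [NormedAddCommGroup E] (G : Pt n → E) (ν : Measure (Pt n)),
      eLpNorm G (ENNReal.ofReal p) ν = (∫⁻ x, ‖G x‖ₑ ^ p ∂ν) ^ (1 / p) := by
    intro E _ G ν
    rw [eLpNorm_eq_lintegral_rpow_enorm_toReal hP0 ENNReal.ofReal_ne_top, hPr]
  set fb := U.indicator f with hfb
  have hfbm : AEStronglyMeasurable fb volume :=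
    ((memLp_indicator_iff_restrict hU).2 h.memLp).1
  have hmp := measurePreserving_mul_right g
  suffices hs : eLpNorm (fun x => fb (mul x g) - fb x) (ENNReal.ofReal p) volume ≤
      ENNReal.ofReal (37 * r) * eLpNorm F (ENNReal.ofReal p) (volume.restrict U) by
    rw [hconv, hconv] at hs
    have h2 := ENNReal.rpow_le_rpow hs hp0.le
    rwa [ENNReal.mul_rpow_of_nonneg _ _ hp0.le, ← ENNReal.rpow_mul, ← ENNReal.rpow_mul,
      one_div_mul_cancel hp0.ne', ENNReal.rpow_one, ENNReal.rpow_one] at h2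
  have hb : ∀ k, eLpNorm (fun x => fb (mul x g) - fb x) (ENNReal.ofReal p) volume ≤
      (eLpNorm (fun x => f x - φ k x) (ENNReal.ofReal p) (volume.restrict U) +
        ENNReal.ofReal (37 * r) * (eLpNorm F (ENNReal.ofReal p) (volume.restrict U) +
          eLpNorm (fun x => F x - hgrad (φ k) x) (ENNReal.ofReal p) (volume.restrict U))) +
        eLpNorm (fun x => f x - φ k x) (ENNReal.ofReal p) (volume.restrict U) := by
    intro k
    have hφ := h.isTest k
    have hφc : Continuous (φ k) := hφ.1.continuous
    have hd : AEStronglyMeasurable (fun x => fb x - φ k x) volume :=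
      hfbm.sub hφc.aestronglyMeasurable
    have ed : eLpNorm (fun x => fb x - φ k x) (ENNReal.ofReal p) volume =
        eLpNorm (fun x => f x - φ k x) (ENNReal.ofReal p) (volume.restrict U) := by
      rw [← eLpNorm_indicator_eq_eLpNorm_restrict hU]
      congr 1; ext x
      by_cases hx : x ∈ U
      · simp [hfb, hx]
      · simp [hfb, hx, hφ.eq_zero hx]
    have ed' : eLpNorm (fun x => fb (mul x g) - φ k (mul x g)) (ENNReal.ofReal p) volume =
        eLpNorm (fun x => f x - φ k x) (ENNReal.ofReal p) (volume.restrict U) := by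
      rw [← ed]
      have := eLpNorm_comp_measurePreserving (p := ENNReal.ofReal p) hd hmp
      simpa only [Function.comp_def] using this
    have et : eLpNorm (fun x => φ k (mul x g) - φ k x) (ENNReal.ofReal p) volume ≤
        ENNReal.ofReal (37 * r) * eLpNorm (hgrad (φ k)) (ENNReal.ofReal p) (volume.restrict U) :=
      hφ.eLpNorm_translate_le hp hU hg
    have eg : eLpNorm (hgrad (φ k)) (ENNReal.ofReal p) (volume.restrict U) ≤
        eLpNorm F (ENNReal.ofReal p) (volume.restrict U) +
          eLpNorm (fun x => F x - hgrad (φ k) x) (ENNReal.ofReal p) (volume.restrict U) := by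
      have e : hgrad (φ k) = F - fun x => F x - hgrad (φ k) x := by ext1 x; simp
      conv_lhs => rw [e]
      exact eLpNorm_sub_le h.memLp_grad.1
        (h.memLp_grad.1.sub hφ.continuous_hgrad.aestronglyMeasurable) hP
    have e : (fun x => fb (mul x g) - fb x) = ((fun x => fb (mul x g) - φ k (mul x g)) +
        fun x => φ k (mul x g) - φ k x) - fun x => fb x - φ k x := by
      ext1 x; simp
    have m1 : AEStronglyMeasurable (fun x => fb (mul x g) - φ k (mul x g)) volume :=
      hd.comp_measurePreserving hmp
    have m2 : AEStronglyMeasurable (fun x => φ k (mul x g) - φ k x) volume :=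
      Continuous.aestronglyMeasurable (by fun_prop)
    rw [e]
    refine (eLpNorm_sub_le (m1.add m2) hd hP).trans ?_
    refine (add_le_add (eLpNorm_add_le m1 m2 hP) le_rfl).trans ?_
    rw [ed, ed']
    gcongr
    exact et.trans (by gcongr)
  have hlim := (h.tendsto.add (ENNReal.Tendsto.const_mul (a := ENNReal.ofReal (37 * r))
    ((tendsto_const_nhds (x := eLpNorm F (ENNReal.ofReal p) (volume.restrict U))).add
      h.tendsto_grad) (Or.inr ENNReal.ofReal_ne_top))).add h.tendsto
  simp only [add_zero, zero_add] at hlim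
  exact ge_of_tendsto' hlim hb

lemma hgrad_mul {f g : Pt n → ℝ} (hf : Differentiable ℝ f) (hg : Differentiable ℝ g) (x : Pt n) :
    hgrad (fun x => f x * g x) x = f x • hgrad g x + g x • hgrad f x := by
  ext i
  simp only [hgrad_apply, PiLp.add_apply, PiLp.smul_apply]
  rw [fderiv_fun_mul (hf x) (hg x)]
  simp

/-- A Sobolev function times a cutoff function is a limit of test functions. -/
lemma MemHW.exists_testLimit_mul {p : ℝ} (hp : 1 ≤ p) {U : Set (Pt n)} (hU : IsOpen U)
    {w : Pt n → ℝ} {Dw : Pt n → Hor n} (hw : MemHW p U w Dw) {θ : Pt n → ℝ} (hθ : IsTest U θ)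
    (c : ℝ) :
    ∃ φ, TestLimit p U φ (fun x => θ x * (w x - c))
      (fun x => θ x • Dw x + (w x - c) • hgrad θ x) := by
  have hP : (1 : ℝ≥0∞) ≤ ENNReal.ofReal p := by simpa using hp
  set K := tsupport θ with hKdef
  have hK : IsCompact K := hθ.2.1.isCompact
  have hKm := hK.measurableSet
  choose ψ hψ h1 h2 using fun k : ℕ => hw.exists_smooth_approx hp hU hK hθ.2.2
    (ε := (k : ℝ≥0∞)⁻¹) (by simp)
  have hθc := hθ.1.continuous
  have hgc := hθ.continuous_hgrad
  obtain ⟨C₁, hC₁⟩ := hθ.2.1.exists_bound_of_continuous hθc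
  obtain ⟨C₂, hC₂⟩ := (HasCompactSupport.intro hθ.2.1
    (fun x hx => hgrad_eq_zero_of_notMem_tsupport hx)).exists_bound_of_continuous hgc
  have hθ0 : ∀ x ∉ K, θ x = 0 := fun x hx => image_eq_zero_of_notMem_tsupport hx
  have hg0 : ∀ x ∉ K, hgrad θ x = 0 := fun x hx => hgrad_eq_zero_of_notMem_tsupport hx
  have hres : ∀ {E : Type} [NormedAddCommGroup E] (G : Pt n → E), (∀ x ∉ K, G x = 0) →
      eLpNorm G (ENNReal.ofReal p) (volume.restrict U) =
        eLpNorm G (ENNReal.ofReal p) (volume.restrict K) := by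
    intro E _ G hG
    rw [← eLpNorm_indicator_eq_eLpNorm_restrict hU.measurableSet,
      ← eLpNorm_indicator_eq_eLpNorm_restrict hKm]
    congr 1; ext x
    by_cases hx : x ∈ K
    · simp [hx, hθ.2.2 hx]
    · by_cases hxU : x ∈ U <;> simp [hx, hG x hx, hxU]
  have hwK : MemLp w (ENNReal.ofReal p) (volume.restrict K) :=
    hw.1.mono_measure (Measure.restrict_mono hθ.2.2 le_rfl)
  have hDK : MemLp Dw (ENNReal.ofReal p) (volume.restrict K) :=
    hw.2.1.mono_measure (Measure.restrict_mono hθ.2.2 le_rfl)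
  have hfin : IsFiniteMeasure (volume.restrict K) :=
    isFiniteMeasure_restrict.2 hK.measure_lt_top.ne
  have hwc : MemLp (fun x => w x - c) (ENNReal.ofReal p) (volume.restrict K) :=
    hwK.sub (memLp_const c)
  have hsm : ∀ {G : Pt n → Hor n}, AEStronglyMeasurable G (volume.restrict K) →
      AEStronglyMeasurable (fun x => θ x • G x) (volume.restrict K) := fun hG =>
    hθc.aestronglyMeasurable.smul hG
  have hsm' : ∀ {g : Pt n → ℝ}, AEStronglyMeasurable g (volume.restrict K) →
      AEStronglyMeasurable (fun x => g x • hgrad θ x) (volume.restrict K) := fun hg =>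
    hg.smul hgc.aestronglyMeasurable
  have b1 : ∀ {g : Pt n → ℝ} x, ‖θ x * g x‖ ≤ C₁ * ‖g x‖ := fun {g} x => by
    rw [norm_mul]; gcongr; exact hC₁ x
  have b2 : ∀ {G : Pt n → Hor n} x, ‖θ x • G x‖ ≤ C₁ * ‖G x‖ := fun {g} x => by
    rw [norm_smul]; gcongr; exact hC₁ x
  have b3 : ∀ {g : Pt n → ℝ} x, ‖g x • hgrad θ x‖ ≤ C₂ * ‖g x‖ := fun {g} x => by
    rw [norm_smul, mul_comm]; gcongr; exact hC₂ x
  have h0 := ENNReal.tendsto_inv_nat_nhds_zero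
  refine ⟨fun k x => θ x * (ψ k x - c), ?_, ?_, ?_, ?_, ?_⟩
  · intro k
    have hs : tsupport (fun x => θ x * (ψ k x - c)) ⊆ K := by
      refine closure_mono fun x hx => ?_
      intro h; exact hx (by simp [h])
    exact ⟨hθ.1.mul ((hψ k).sub contDiff_const), hK.of_isClosed_subset (isClosed_tsupport _) hs,
      hs.trans hθ.2.2⟩
  · rw [← memLp_indicator_iff_restrict hU.measurableSet]
    have e : U.indicator (fun x => θ x * (w x - c)) = K.indicator (fun x => θ x * (w x - c)) := by
      ext x
      by_cases hx : x ∈ K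
      · simp [hx, hθ.2.2 hx]
      · by_cases hxU : x ∈ U <;> simp [hx, hθ0 x hx, hxU]
    rw [e, memLp_indicator_iff_restrict hKm]
    exact hwc.of_le_mul (hθc.aestronglyMeasurable.mul hwc.1) (ae_of_all _ fun x => b1 (g := fun x => w x - c) x)
  · rw [← memLp_indicator_iff_restrict hU.measurableSet]
    have e : U.indicator (fun x => θ x • Dw x + (w x - c) • hgrad θ x) =
        K.indicator (fun x => θ x • Dw x + (w x - c) • hgrad θ x) := by
      ext1 x
      by_cases hx : x ∈ K
      · simp [hx, hθ.2.2 hx]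
      · by_cases hxU : x ∈ U <;> simp [hx, hθ0 x hx, hg0 x hx, hxU]
    rw [e, memLp_indicator_iff_restrict hKm]
    exact (hDK.of_le_mul (hsm hDK.1) (ae_of_all _ fun x => b2 x)).add
      (hwc.of_le_mul (hsm' hwc.1) (ae_of_all _ fun x => b3 (g := fun x => w x - c) x))
  · have h3 := ENNReal.Tendsto.const_mul (a := ENNReal.ofReal C₁) h0 (Or.inr ENNReal.ofReal_ne_top)
    rw [mul_zero] at h3
    refine tendsto_of_tendsto_of_tendsto_of_le_of_le tendsto_const_nhds h3 (fun _ => zero_le)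
      fun k => ?_
    dsimp only
    rw [hres _ (fun x hx => by simp [hθ0 x hx])]
    refine (eLpNorm_le_mul_eLpNorm_of_ae_le_mul (g := fun x => w x - ψ k x)
      (ae_of_all _ fun x => ?_) _).trans (by gcongr; exact h1 k)
    refine le_trans (le_of_eq ?_) (b1 (g := fun x => w x - ψ k x) x)
    congr 1; ring
  · have h3 := (ENNReal.Tendsto.const_mul (a := ENNReal.ofReal C₁) h0
      (Or.inr ENNReal.ofReal_ne_top)).add (ENNReal.Tendsto.const_mul (a := ENNReal.ofReal C₂) h0
      (Or.inr ENNReal.ofReal_ne_top))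
    rw [mul_zero, mul_zero, add_zero] at h3
    refine tendsto_of_tendsto_of_tendsto_of_le_of_le tendsto_const_nhds h3 (fun _ => zero_le)
      fun k => ?_
    have hψd : Differentiable ℝ (ψ k) := (hψ k).differentiable (by simp)
    have hgr : ∀ x, hgrad (fun x => θ x * (ψ k x - c)) x =
        θ x • hgrad (ψ k) x + (ψ k x - c) • hgrad θ x := by
      intro x
      rw [hgrad_mul (hθ.1.differentiable (by simp)) (hψd.sub_const c)]
      congr 2
      ext i
      rw [hgrad_apply, hgrad_apply, fderiv_sub_const]
    dsimp only
    rw [hres _ (fun x hx => by rw [hgr]; simp [hθ0 x hx, hg0 x hx])]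
    have e : (fun x => θ x • Dw x + (w x - c) • hgrad θ x -
        hgrad (fun x => θ x * (ψ k x - c)) x) = (fun x => θ x • (Dw x - hgrad (ψ k) x)) +
          fun x => (w x - ψ k x) • hgrad θ x := by
      ext1 x
      rw [hgr]
      simp only [Pi.add_apply]
      module
    rw [e]
    refine (eLpNorm_add_le (hsm (hDK.1.sub (continuous_hgrad
      ((hψ k).of_le (by simp))).aestronglyMeasurable))
      (hsm' (hwK.1.sub (hψ k).continuous.aestronglyMeasurable)) hP).trans ?_
    refine add_le_add ?_ ?_
    · exact (eLpNorm_le_mul_eLpNorm_of_ae_le_mul (g := fun x => Dw x - hgrad (ψ k) x)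
        (ae_of_all _ fun x => b2 (G := fun x => Dw x - hgrad (ψ k) x) x) _).trans
        (by gcongr; exact h2 k)
    · exact (eLpNorm_le_mul_eLpNorm_of_ae_le_mul (g := fun x => w x - ψ k x)
        (ae_of_all _ fun x => b3 (g := fun x => w x - ψ k x) x) _).trans
        (by gcongr; exact h1 k)

/-- The horizontal gradient of a test function has mean zero, since the coefficient of the central
derivative in `X_i` does not depend on the central variable. -/
lemma IsTest.integral_inner_const {U : Set (Pt n)} {φ : Pt n → ℝ} (hφ : IsTest U φ) (z : Hor n) :
    ∫ x, inner ℝ z (hgrad φ x) = 0 := by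
  have key : ∀ {g : Pt n → ℝ}, ContDiff ℝ 1 g → HasCompactSupport g → ∀ v : Pt n,
      Integrable (fun x => fderiv ℝ g x v) ∧ ∫ x, fderiv ℝ g x v = 0 := by
    intro g hg hgc v
    have hi : Integrable (fun x => fderiv ℝ g x v) := by
      refine Continuous.integrable_of_hasCompactSupport
        ((hg.continuous_fderiv one_ne_zero).clm_apply continuous_const) ?_
      exact HasCompactSupport.fderiv_apply (𝕜 := ℝ) hgc v
    refine ⟨hi, ?_⟩
    have haar : (volume : Measure (Pt n)).IsAddHaarMeasure := by
      rw [Measure.volume_eq_prod]; infer_instance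
    have := integral_mul_fderiv_eq_neg_fderiv_mul_of_integrable (μ := (volume : Measure (Pt n)))
      (f := fun _ => (1 : ℝ)) (g := g) (v := v) (by simp) (by simpa using hi)
      (by simpa using hg.continuous.integrable_of_hasCompactSupport hgc)
      (fun x _ => differentiableAt_const _) (fun x _ => hg.differentiable one_ne_zero x)
    simpa using this
  have hφ1 := hφ.contDiff_one
  have hs : ContDiff ℝ 1 (fun x : Pt n => symp x.1 z / 2) := by fun_prop
  have h1 := key hφ1 hφ.2.1 (z, 0)
  have h2 := key (hs.mul hφ1) (hφ.2.1.mul_left) (0, 1)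
  have e : ∀ x, inner ℝ z (hgrad φ x) =
      fderiv ℝ φ x (z, 0) + fderiv ℝ (fun x : Pt n => symp x.1 z / 2 * φ x) x (0, 1) := by
    intro x
    have h3 : HasFDerivAt (fun x : Pt n => symp x.1 z / 2 * φ x)
        ((symp x.1 z / 2) • fderiv ℝ φ x + φ x • fderiv ℝ (fun x : Pt n => symp x.1 z / 2) x) x :=
      ((hs.differentiable one_ne_zero x).hasFDerivAt).mul
        (hφ1.differentiable one_ne_zero x).hasFDerivAt
    have h4 : fderiv ℝ (fun x : Pt n => symp x.1 z / 2) x (0, 1) = 0 := by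
      have h5 : HasDerivAt (fun t : ℝ => x + t • ((0, 1) : Pt n)) (0, 1) 0 := by
        simpa using ((hasDerivAt_id (0 : ℝ)).smul_const ((0, 1) : Pt n)).const_add x
      have h6 := (hs.differentiable one_ne_zero
        (x + (0 : ℝ) • ((0, 1) : Pt n))).hasFDerivAt.comp_hasDerivAt (0 : ℝ) h5
      have h7 : HasDerivAt ((fun x : Pt n => symp x.1 z / 2) ∘ fun t : ℝ => x + t • ((0, 1) : Pt n))
          0 0 := by
        have : ((fun x : Pt n => symp x.1 z / 2) ∘ fun t : ℝ => x + t • ((0, 1) : Pt n)) =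
            fun _ => symp x.1 z / 2 := by ext t; simp
        rw [this]; exact hasDerivAt_const _ _
      have := h6.unique h7
      simpa using this
    rw [h3.fderiv, real_inner_comm, inner_hgrad]
    have h8 : hlift x z = (z, 0) + (symp x.1 z / 2) • ((0, 1) : Pt n) := by
      ext1 <;> simp [hlift]
    rw [h8, map_add, map_smul]
    simp [h4]
  simp only [e]
  rw [integral_add h1.1 h2.1, h1.2]
  simpa using h2.2

end

/-! ### The weak formulation -/

section

open Filter Topology
variable {n : ℕ}

/-- Integration of a pointwise energy inequality `G ≤ I + H` in which the sign of `I` is not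
known. -/
lemma lintegral_le_of_le_add {X : Type*} [MeasurableSpace X] {ν : Measure X} {I G H : X → ℝ}
    {M : ℝ} (hI : Integrable I ν) (hIM : ∫ x, I x ∂ν ≤ M) (hG : AEStronglyMeasurable G ν)
    (hG0 : 0 ≤ᵐ[ν] G) (hH : AEStronglyMeasurable H ν) (hH0 : 0 ≤ᵐ[ν] H)
    (hGH : ∀ᵐ x ∂ν, G x ≤ I x + H x) :
    ∫⁻ x, ENNReal.ofReal (G x) ∂ν ≤ ENNReal.ofReal M + ∫⁻ x, ENNReal.ofReal (H x) ∂ν := by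
  by_cases htop : ∫⁻ x, ENNReal.ofReal (H x) ∂ν = ∞
  · simp [htop]
  have hHi : Integrable H ν := by
    refine ⟨hH, ?_⟩
    rw [hasFiniteIntegral_iff_ofReal hH0]
    exact lt_top_iff_ne_top.2 htop
  have hGi : Integrable G ν := by
    refine (hI.add hHi).mono' hG ?_
    filter_upwards [hGH, hG0] with x h1 h2
    rw [Real.norm_of_nonneg h2]; exact h1
  have h0 : 0 ≤ ∫ x, H x ∂ν := integral_nonneg_of_ae hH0
  have h1 : ∫ x, G x ∂ν ≤ M + ∫ x, H x ∂ν := by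
    refine (integral_mono_ae hGi (hI.add hHi) hGH).trans ?_
    simp only [Pi.add_apply]
    rw [integral_add hI hHi]
    linarith
  rw [← ofReal_integral_eq_lintegral_ofReal hGi hG0, ← ofReal_integral_eq_lintegral_ofReal hHi hH0]
  refine (ENNReal.ofReal_le_ofReal h1).trans ENNReal.ofReal_add_le

lemma signedIntegral_zero (φ : Pt n → ℝ) : signedIntegral 0 φ = 0 := by
  simp [signedIntegral, SignedMeasure.toJordanDecomposition_zero]

namespace StructureCondition
variable {Ω : Set (Pt n)} {a : Pt n → Hor n → Hor n} {p L L' s α : ℝ}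

lemma aestronglyMeasurable (h : StructureCondition Ω a p L L' s α) (hΩ : IsOpen Ω)
    {U : Set (Pt n)} (hU : MeasurableSet U) (hUΩ : U ⊆ Ω) {G : Pt n → Hor n}
    (hG : AEStronglyMeasurable G (volume.restrict U)) :
    AEStronglyMeasurable (fun x => a x (G x)) (volume.restrict U) := by
  classical
  have hm : Measurable ((Ω ×ˢ univ).piecewise (fun q : Pt n × Hor n => a q.1 q.2) 0) :=
    h.continuousOn.measurable_piecewise continuousOn_const
      (hΩ.measurableSet.prod MeasurableSet.univ)
  have h1 : Measurable fun x => (Ω ×ˢ univ).piecewise (fun q : Pt n × Hor n => a q.1 q.2) 0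
      (x, hG.mk G x) := hm.comp (measurable_id.prodMk hG.measurable_mk)
  refine ⟨_, h1.stronglyMeasurable, ?_⟩
  filter_upwards [hG.ae_eq_mk, ae_restrict_mem hU] with x hx hxU
  rw [piecewise_eq_of_mem _ _ _ (by simpa using hUΩ hxU), ← hx]

/-- The structural assumptions are inherited by the operator frozen at a point. -/
lemma frozen (h : StructureCondition Ω a p L L' s α) (hL' : 0 ≤ L') {x₀ : Pt n} (hx₀ : x₀ ∈ Ω) :
    StructureCondition Ω (fun _ => a x₀) p L L' s α where
  continuousOn := ((h.contDiff x₀ hx₀).continuous.comp continuous_snd).continuousOn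
  contDiff _ _ := h.contDiff x₀ hx₀
  symmetric _ _ := h.symmetric x₀ hx₀
  lower _ _ := h.lower x₀ hx₀
  upper _ _ := h.upper x₀ hx₀
  holder x _ y _ z := by
    have := ccDist_nonneg x y
    rw [sub_self, norm_zero]; positivity

/-- The growth condition. The field is normalized by its value at `z = 0`, which may be nonzero but
is a constant vector and is invisible in the weak formulation. -/
lemma norm_sub_le (h : StructureCondition Ω a p L L' s α) (hL : 0 ≤ L) (hp : 2 ≤ p) (hs : 0 ≤ s)
    {x x₀ : Pt n} (hx : x ∈ Ω) (hx₀ : x₀ ∈ Ω) (z : Hor n) :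
    ‖a x z - a x₀ 0‖ ≤ L * (‖z‖ + s) ^ (p - 1) := by
  rw [h.apply_zero_eq hx₀ hx]
  refine (h.norm_sub_zero_le hL hp hx z).trans ?_
  gcongr
  exact weight_mul_le (norm_nonneg z) hs hp

lemma memLp_sub (h : StructureCondition Ω a p L L' s α) (hL : 0 ≤ L) (hp : 2 ≤ p) (hs : 0 ≤ s)
    (hΩ : IsOpen Ω) {U : Set (Pt n)} (hU : MeasurableSet U) (hUΩ : U ⊆ Ω)
    (hUf : volume U ≠ ∞) {x₀ : Pt n} (hx₀ : x₀ ∈ Ω) {G : Pt n → Hor n}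
    (hG : MemLp G (ENNReal.ofReal p) (volume.restrict U)) :
    MemLp (fun x => a x (G x) - a x₀ 0) (ENNReal.ofReal (p / (p - 1))) (volume.restrict U) := by
  have hfin : IsFiniteMeasure (volume.restrict U) := isFiniteMeasure_restrict.2 hUf
  have h1 : MemLp (fun x => ‖G x‖ + s) (ENNReal.ofReal p) (volume.restrict U) :=
    hG.norm.add (memLp_const s)
  have h2 := h1.norm_rpow_div (ENNReal.ofReal (p - 1))
  rw [ENNReal.toReal_ofReal (by linarith), ← ENNReal.ofReal_div_of_pos (by linarith)] at h2
  refine h2.of_le_mul (c := L) ((h.aestronglyMeasurable hΩ hU hUΩ hG.1).sub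
    aestronglyMeasurable_const) ?_
  filter_upwards [ae_restrict_mem hU] with x hx
  have h0 : 0 ≤ ‖G x‖ + s := by positivity
  rw [Real.norm_of_nonneg h0, Real.norm_of_nonneg (by positivity)]
  exact h.norm_sub_le hL hp hs (hUΩ hx) hx₀ (G x)

end StructureCondition

lemma IsTest.setIntegral_inner_hgrad {U V : Set (Pt n)} {φ : Pt n → ℝ} (hφ : IsTest V φ)
    (hVU : V ⊆ U) (A : Pt n → Hor n) :
    ∫ x in U, inner ℝ (A x) (hgrad φ x) = ∫ x in V, inner ℝ (A x) (hgrad φ x) := by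
  rw [setIntegral_eq_integral_of_forall_compl_eq_zero fun x hx => by
      rw [(hφ.mono hVU).hgrad_eq_zero hx, inner_zero_right],
    setIntegral_eq_integral_of_forall_compl_eq_zero fun x hx => by
      rw [hφ.hgrad_eq_zero hx, inner_zero_right]]

/-- A constant vector may be subtracted from the field in the weak formulation. -/
lemma IsTest.setIntegral_inner_sub_const {p : ℝ} (hp : 1 < p) {U : Set (Pt n)} {φ : Pt n → ℝ}
    (hφ : IsTest U φ) {A : Pt n → Hor n} {z : Hor n}
    (hA : MemLp (fun x => A x - z) (ENNReal.ofReal (p / (p - 1))) (volume.restrict U)) :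
    ∫ x in U, inner ℝ (A x - z) (hgrad φ x) = ∫ x in U, inner ℝ (A x) (hgrad φ x) := by
  have h1 := integrable_inner_of_memLp hp hA (hφ.memLp_hgrad _ U)
  have h2 : Integrable (fun x => inner ℝ z (hgrad φ x)) (volume.restrict U) :=
    memLp_one_iff_integrable.1 ((hφ.memLp_hgrad 1 U).const_inner z)
  have h3 : ∫ x in U, inner ℝ z (hgrad φ x) = 0 := by
    rw [setIntegral_eq_integral_of_forall_compl_eq_zero fun x hx => by
      rw [hφ.hgrad_eq_zero hx, inner_zero_right]]
    exact hφ.integral_inner_const z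
  have := integral_add h1 h2
  rw [h3, add_zero] at this
  rw [← this]
  congr 1; ext x
  rw [← inner_add_left, sub_add_cancel]

/-- The weak formulation of a homogeneous equation, extended to limits of test functions. -/
lemma TestLimit.integral_inner_eq_zero {p : ℝ} (hp : 1 < p) {U V : Set (Pt n)} (hVU : V ⊆ U)
    {φ : ℕ → Pt n → ℝ} {f : Pt n → ℝ} {F : Pt n → Hor n} (h : TestLimit p V φ f F)
    {A : Pt n → Hor n} {z : Hor n}
    (hA : MemLp (fun x => A x - z) (ENNReal.ofReal (p / (p - 1))) (volume.restrict U))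
    (hweak : ∀ ψ, IsTest U ψ → ∫ x in U, inner ℝ (A x) (hgrad ψ x) = 0) :
    ∫ x in V, inner ℝ (A x - z) (F x) = 0 := by
  have hAV := hA.mono_measure (Measure.restrict_mono hVU le_rfl)
  refine tendsto_nhds_unique (h.tendsto_integral_inner hp hAV) ?_
  refine tendsto_const_nhds.congr fun k => ?_
  have hk := (h.isTest k).mono hVU
  rw [← (h.isTest k).setIntegral_inner_hgrad hVU, hk.setIntegral_inner_sub_const hp hA, hweak _ hk]

lemma IsWeakSolution.integral_eq_zero {p : ℝ} {U : Set (Pt n)} {A : Pt n → Hor n → Hor n}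
    {w : Pt n → ℝ} {Dw : Pt n → Hor n} (h : IsWeakSolution p U A 0 w Dw) {ψ : Pt n → ℝ}
    (hψ : IsTest U ψ) : ∫ x in U, inner ℝ (A x (Dw x)) (hgrad ψ x) = 0 := by
  rw [h.2 ψ hψ, signedIntegral_zero]

end

/-! ### Cutoff functions between boxes -/

section

open Filter Topology
variable {n : ℕ}

/-- The second clause makes the derivative vanish off the region where the cutoff function lives. -/
lemma exists_bound_deriv_smoothTransition :
    ∃ C : ℝ, 0 ≤ C ∧ ∀ x : ℝ, |deriv Real.smoothTransition x| ≤ C ∧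
      (x < 0 → deriv Real.smoothTransition x = 0) := by
  have hc : Continuous (deriv Real.smoothTransition) :=
    (Real.smoothTransition.contDiff (n := 1)).continuous_deriv (by simp)
  have h0 : ∀ x : ℝ, x < 0 → deriv Real.smoothTransition x = 0 := fun x hx => by
    have : Real.smoothTransition =ᶠ[𝓝 x] fun _ => 0 := by
      filter_upwards [Iio_mem_nhds hx] with y hy
      exact Real.smoothTransition.zero_of_nonpos (le_of_lt hy)
    rw [this.deriv_eq, deriv_const]
  have h1 : ∀ x : ℝ, 1 < x → deriv Real.smoothTransition x = 0 := fun x hx => by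
    have : Real.smoothTransition =ᶠ[𝓝 x] fun _ => 1 := by
      filter_upwards [Ioi_mem_nhds hx] with y hy
      exact Real.smoothTransition.one_of_one_le (le_of_lt hy)
    rw [this.deriv_eq, deriv_const]
  obtain ⟨C, hC⟩ := (HasCompactSupport.intro (isCompact_Icc (a := (0 : ℝ)) (b := 1))
    (f := deriv Real.smoothTransition) (fun x hx => by
      by_cases h : x < 0
      · exact h0 x h
      · exact h1 x (by by_contra h'; exact hx ⟨not_lt.1 h, not_lt.1 h'⟩))).exists_bound_of_continuous
    hc
  exact ⟨C, (abs_nonneg _).trans (hC 0), fun x => ⟨hC x, h0 x⟩⟩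

/-- Horizontal derivatives are derivatives along right translations. -/
lemma inner_hgrad_eq_of_hasDerivAt {φ : Pt n → ℝ} (hφ : Differentiable ℝ φ) (x : Pt n) (z : Hor n)
    {d : ℝ} (hd : HasDerivAt (fun t : ℝ => φ (mul x (t • z, 0))) d 0) :
    inner ℝ (hgrad φ x) z = d := by
  rw [inner_hgrad]
  have h5 : HasDerivAt (fun t : ℝ => mul x (t • z, 0)) (hlift x z) 0 := by
    have e : (fun t : ℝ => mul x (t • z, 0)) = fun t => x + t • hlift x z := by
      ext1 t; ext1 <;> simp [hlift, symp_smul_right, mul_div_assoc]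
    rw [e]
    simpa using ((hasDerivAt_id (0 : ℝ)).smul_const (hlift x z)).const_add x
  have h6 := (hφ (mul x ((0 : ℝ) • z, 0))).hasFDerivAt.comp_hasDerivAt (0 : ℝ) h5
  have e0 : mul x ((0 : ℝ) • z, 0) = x := by
    rw [zero_smul]; exact mul_zero' x
  rw [e0] at h6
  exact h6.unique hd

lemma norm_le_of_forall_inner_le {v : Hor n} {M : ℝ} (hM : 0 ≤ M)
    (h : ∀ z, inner ℝ v z ≤ M * ‖z‖) : ‖v‖ ≤ M := by
  have := h v
  rw [real_inner_self_eq_norm_sq, sq] at this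
  rcases (norm_nonneg v).eq_or_lt with h0 | h0
  · rwa [← h0]
  · exact le_of_mul_le_mul_right this h0

lemma mem_cbox {x y : Pt n} {r : ℝ} :
    x ∈ cbox y r ↔ ‖(mul (-y) x).1‖ < r ∧ |(mul (-y) x).2| < r ^ 2 := mem_box

/-- Smooth cutoff functions between two concentric boxes. The central variable is cut off through
its square compared with fourth powers of the radii: its horizontal derivative is of the order of
the radius, and the difference of fourth powers compensates for this. -/
lemma exists_cutoff (n : ℕ) : ∃ C : ℝ, 0 ≤ C ∧ ∀ (y : Pt n) (r₁ r₂ : ℝ), 0 < r₁ → r₁ < r₂ →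
    ∃ χ : Pt n → ℝ, IsTest (cbox y r₂) χ ∧ (∀ x ∈ cbox y r₁, χ x = 1) ∧
      (∀ x, 0 ≤ χ x) ∧ (∀ x, χ x ≤ 1) ∧ ∀ x, ‖hgrad χ x‖ ≤ C / (r₂ - r₁) := by
  obtain ⟨C, hC0, hC⟩ := exists_bound_deriv_smoothTransition
  refine ⟨6 * C, by positivity, fun y r₁ r₂ h1 h12 => ?_⟩
  set r := (r₁ + r₂) / 2 with hr
  have h1r : r₁ < r := by rw [hr]; linarith
  have hr0 : 0 < r := by linarith
  have hr2 : r < r₂ := by rw [hr]; linarith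
  have hD1 : 0 < r ^ 2 - r₁ ^ 2 := by nlinarith
  have hD2 : 0 < r ^ 4 - r₁ ^ 4 := by
    have : r ^ 4 - r₁ ^ 4 = (r ^ 2 - r₁ ^ 2) * (r ^ 2 + r₁ ^ 2) := by ring
    rw [this]; positivity
  set S := Real.smoothTransition with hS
  set f : Pt n → ℝ := fun ξ => S ((r ^ 2 - ‖ξ.1‖ ^ 2) / (r ^ 2 - r₁ ^ 2)) *
    S ((r ^ 4 - ξ.2 ^ 2) / (r ^ 4 - r₁ ^ 4)) with hf
  have hfs : ContDiff ℝ (⊤ : ℕ∞) f := by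
    refine (Real.smoothTransition.contDiff.comp ?_).mul (Real.smoothTransition.contDiff.comp ?_)
    · exact (contDiff_const.sub (contDiff_fst.norm_sq ℝ)).div_const _
    · exact (contDiff_const.sub (contDiff_snd.pow 2)).div_const _
  have hχs : ContDiff ℝ (⊤ : ℕ∞) fun x => f (mul (-y) x) := hfs.comp (by fun_prop)
  obtain ⟨K, hK, hK1, hK2⟩ := exists_compact_between y hr0.le hr2
  have hsupp : ∀ x, f (mul (-y) x) ≠ 0 → x ∈ cbox y r := by
    intro x hx
    have hx1 := left_ne_zero_of_mul hx
    have hx2 := right_ne_zero_of_mul hx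
    have h3 : 0 < (r ^ 2 - ‖(mul (-y) x).1‖ ^ 2) / (r ^ 2 - r₁ ^ 2) := by
      by_contra h; exact hx1 (Real.smoothTransition.zero_of_nonpos (not_lt.1 h))
    have h4 : 0 < (r ^ 4 - (mul (-y) x).2 ^ 2) / (r ^ 4 - r₁ ^ 4) := by
      by_contra h; exact hx2 (Real.smoothTransition.zero_of_nonpos (not_lt.1 h))
    rw [div_pos_iff_of_pos_right hD1] at h3
    rw [div_pos_iff_of_pos_right hD2] at h4
    rw [mem_cbox]
    exact ⟨by nlinarith [norm_nonneg (mul (-y) x).1], abs_lt_of_sq_lt_sq (by nlinarith)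
      (by positivity)⟩
  have htK : tsupport (fun x => f (mul (-y) x)) ⊆ K :=
    closure_minimal (fun x hx => hK1 (hsupp x hx)) hK.isClosed
  refine ⟨fun x => f (mul (-y) x), ⟨hχs, hK.of_isClosed_subset (isClosed_tsupport _) htK,
    htK.trans hK2⟩, ?_, ?_, ?_, ?_⟩
  · intro x hx
    rw [mem_cbox] at hx
    have h3 : S ((r ^ 2 - ‖(mul (-y) x).1‖ ^ 2) / (r ^ 2 - r₁ ^ 2)) = 1 := by
      refine Real.smoothTransition.one_of_one_le ?_
      rw [one_le_div hD1]
      nlinarith [norm_nonneg (mul (-y) x).1, hx.1]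
    have h4 : S ((r ^ 4 - (mul (-y) x).2 ^ 2) / (r ^ 4 - r₁ ^ 4)) = 1 := by
      refine Real.smoothTransition.one_of_one_le ?_
      rw [one_le_div hD2]
      have := sq_lt_sq' (abs_lt.1 hx.2).1 (abs_lt.1 hx.2).2
      nlinarith
    simp only [hf, h3, h4, mul_one]
  · exact fun x => mul_nonneg (Real.smoothTransition.nonneg _) (Real.smoothTransition.nonneg _)
  · exact fun x => mul_le_one₀ (Real.smoothTransition.le_one _) (Real.smoothTransition.nonneg _)
      (Real.smoothTransition.le_one _)
  · intro x
    refine norm_le_of_forall_inner_le (div_nonneg (by positivity) (by linarith)) fun z => ?_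
    set ξ := mul (-y) x with hξ
    set A := (r ^ 2 - ‖ξ.1‖ ^ 2) / (r ^ 2 - r₁ ^ 2) with hA
    set B := (r ^ 4 - ξ.2 ^ 2) / (r ^ 4 - r₁ ^ 4) with hB
    have hSd : ∀ t, HasDerivAt S (deriv S t) t := fun t =>
      ((Real.smoothTransition.contDiff (n := 1)).differentiable (by simp) t).hasDerivAt
    have d1 : HasDerivAt (fun t : ℝ => S ((r ^ 2 - ‖ξ.1 + t • z‖ ^ 2) / (r ^ 2 - r₁ ^ 2)))
        (deriv S A * (-(2 * inner ℝ ξ.1 z) / (r ^ 2 - r₁ ^ 2))) 0 := by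
      have h3 : HasDerivAt (fun t : ℝ => ξ.1 + t • z) z 0 := by
        simpa using ((hasDerivAt_id (0 : ℝ)).smul_const z).const_add ξ.1
      have h4 := ((h3.norm_sq.const_sub (r ^ 2)).div_const (r ^ 2 - r₁ ^ 2))
      simp only [zero_smul, add_zero] at h4
      have h5 : HasDerivAt S (deriv S A) ((r ^ 2 - ‖ξ.1 + (0 : ℝ) • z‖ ^ 2) / (r ^ 2 - r₁ ^ 2)) := by
        rw [zero_smul, add_zero]; exact hSd A
      exact h5.comp (0 : ℝ) h4
    have d2 : HasDerivAt (fun t : ℝ => S ((r ^ 4 - (ξ.2 + t * (symp ξ.1 z / 2)) ^ 2) /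
        (r ^ 4 - r₁ ^ 4))) (deriv S B * (-(2 * ξ.2 * (symp ξ.1 z / 2)) / (r ^ 4 - r₁ ^ 4))) 0 := by
      have h3 : HasDerivAt (fun t : ℝ => ξ.2 + t * (symp ξ.1 z / 2)) (symp ξ.1 z / 2) 0 := by
        simpa using ((hasDerivAt_id (0 : ℝ)).mul_const (symp ξ.1 z / 2)).const_add ξ.2
      have h4 := (((h3.pow 2).const_sub (r ^ 4)).div_const (r ^ 4 - r₁ ^ 4))
      have h5 : HasDerivAt S (deriv S B)
          ((r ^ 4 - (ξ.2 + (0 : ℝ) * (symp ξ.1 z / 2)) ^ 2) / (r ^ 4 - r₁ ^ 4)) := by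
        rw [zero_mul, add_zero]; exact hSd B
      refine (h5.comp (0 : ℝ) h4).congr_deriv ?_
      simp
    have d3 := d1.mul d2
    have e : (fun t : ℝ => f (mul (-y) (mul x (t • z, 0)))) =
        (fun t : ℝ => S ((r ^ 2 - ‖ξ.1 + t • z‖ ^ 2) / (r ^ 2 - r₁ ^ 2))) *
          fun t => S ((r ^ 4 - (ξ.2 + t * (symp ξ.1 z / 2)) ^ 2) / (r ^ 4 - r₁ ^ 4)) := by
      ext1 t
      rw [← mul_assoc', ← hξ]
      simp only [hf, Pi.mul_apply, mul_fst, mul_snd, add_zero, symp_smul_right, mul_div_assoc]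
    rw [inner_hgrad_eq_of_hasDerivAt (hχs.differentiable (by simp)) x z (e ▸ d3)]
    simp only [zero_smul, zero_mul, add_zero]
    rw [← hA, ← hB]
    have hδ : 0 < r - r₁ := by linarith
    have hSA0 : 0 ≤ S A := Real.smoothTransition.nonneg _
    have hSB0 : 0 ≤ S B := Real.smoothTransition.nonneg _
    have hSA1 : S A ≤ 1 := Real.smoothTransition.le_one _
    have hSB1 : S B ≤ 1 := Real.smoothTransition.le_one _
    have b1 : deriv S A * (-(2 * inner ℝ ξ.1 z) / (r ^ 2 - r₁ ^ 2)) * S B ≤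
        C * (2 / (r - r₁) * ‖z‖) := by
      by_cases hA0 : A < 0
      · rw [(hC A).2 hA0]; simp only [zero_mul]; positivity
      have hξr : ‖ξ.1‖ ≤ r := by
        rw [not_lt, hA, le_div_iff₀ hD1] at hA0
        exact abs_le_of_sq_le_sq' (by linarith) hr0.le |>.2
      have h3 : |(-(2 * inner ℝ ξ.1 z) / (r ^ 2 - r₁ ^ 2))| ≤ 2 / (r - r₁) * ‖z‖ := by
        rw [abs_div, abs_of_pos hD1, abs_neg, abs_mul, abs_two, div_le_iff₀ hD1]
        have h4 := abs_real_inner_le_norm ξ.1 z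
        have h5 : 2 / (r - r₁) * ‖z‖ * (r ^ 2 - r₁ ^ 2) = 2 * ((r + r₁) * ‖z‖) := by
          field_simp; ring
        rw [h5]
        have : ‖ξ.1‖ * ‖z‖ ≤ (r + r₁) * ‖z‖ := by gcongr; linarith
        linarith
      refine (le_abs_self _).trans ?_
      rw [abs_mul, abs_mul, abs_of_nonneg hSB0]
      calc _ ≤ C * (2 / (r - r₁) * ‖z‖) * 1 := by
            gcongr
            exact (hC A).1
        _ = _ := mul_one _
    have b2 : S A * (deriv S B * (-(2 * ξ.2 * (symp ξ.1 z / 2)) / (r ^ 4 - r₁ ^ 4))) ≤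
        C * (1 / (r - r₁) * ‖z‖) := by
      by_cases hA0 : A ≤ 0
      · rw [hS, Real.smoothTransition.zero_of_nonpos hA0]; simp only [zero_mul]; positivity
      by_cases hB0 : B < 0
      · rw [(hC B).2 hB0]; simp only [zero_mul, mul_zero]; positivity
      have hξr : ‖ξ.1‖ ≤ r := by
        rw [not_le, hA, div_pos_iff_of_pos_right hD1] at hA0
        exact abs_le_of_sq_le_sq' (by linarith) hr0.le |>.2
      have hξ2 : |ξ.2| ≤ r ^ 2 := by
        rw [not_lt, hB, le_div_iff₀ hD2] at hB0
        exact abs_le_of_sq_le_sq (by nlinarith) (by positivity)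
      have h3 : |(-(2 * ξ.2 * (symp ξ.1 z / 2)) / (r ^ 4 - r₁ ^ 4))| ≤ 1 / (r - r₁) * ‖z‖ := by
        rw [abs_div, abs_of_pos hD2, abs_neg, div_le_iff₀ hD2]
        have h4 := abs_symp_le ξ.1 z
        have h5 : 1 / (r - r₁) * ‖z‖ * (r ^ 4 - r₁ ^ 4) =
            ((r ^ 2 + r₁ ^ 2) * (r + r₁)) * ‖z‖ := by
          field_simp; ring
        have h6 : |2 * ξ.2 * (symp ξ.1 z / 2)| = |ξ.2| * |symp ξ.1 z| := by
          rw [← abs_mul]; congr 1; ring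
        rw [h5, h6]
        calc |ξ.2| * |symp ξ.1 z| ≤ r ^ 2 * (r * ‖z‖) := by
              gcongr
              exact h4.trans (by gcongr)
          _ = (r ^ 2 * r) * ‖z‖ := by ring
          _ ≤ _ := by
              gcongr <;> nlinarith
      refine (le_abs_self _).trans ?_
      rw [abs_mul, abs_mul, abs_of_nonneg hSA0]
      calc _ ≤ 1 * (C * (1 / (r - r₁) * ‖z‖)) := by
            gcongr
            exact (hC B).1
        _ = _ := one_mul _
    refine (add_le_add b1 b2).trans (le_of_eq ?_)
    have h12' : r₂ - r₁ ≠ 0 := by linarith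
    have : r - r₁ = (r₂ - r₁) / 2 := by rw [hr]; ring
    rw [this]
    field_simp
    ring

/-- Cutoff functions whose gradient is controlled by a power of the function itself, obtained as a
power of a cutoff function with integer exponent at least `p`. -/
lemma exists_cutoff_rpow (n : ℕ) {p : ℝ} (hp : 1 ≤ p) : ∃ C : ℝ, 0 ≤ C ∧
    ∀ (y : Pt n) (r₁ r₂ : ℝ), 0 < r₁ → r₁ < r₂ →
    ∃ θ : Pt n → ℝ, IsTest (cbox y r₂) θ ∧ (∀ x ∈ cbox y r₁, θ x = 1) ∧
      (∀ x, 0 ≤ θ x) ∧ (∀ x, θ x ≤ 1) ∧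
      ∀ x, ‖hgrad θ x‖ ≤ C / (r₂ - r₁) * θ x ^ ((p - 1) / p) := by
  obtain ⟨C, hC0, hC⟩ := exists_cutoff n
  have hp0 : 0 < p := by linarith
  set m := ⌈p⌉₊ with hm
  have hpm : p ≤ m := Nat.le_ceil p
  have hm1 : 1 ≤ m := Nat.one_le_ceil_iff.2 hp0
  refine ⟨m * C, by positivity, fun y r₁ r₂ h1 h12 => ?_⟩
  obtain ⟨χ, hχ, h3, h4, h5, h6⟩ := hC y r₁ r₂ h1 h12
  have hsub : tsupport (fun x => χ x ^ m) ⊆ tsupport χ := by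
    refine closure_mono fun x hx h => hx ?_
    have hm0 : m ≠ 0 := by omega
    simp [h, hm0]
  refine ⟨fun x => χ x ^ m, ⟨hχ.1.pow m, hχ.2.1.of_isClosed_subset (isClosed_tsupport _) hsub,
    hsub.trans hχ.2.2⟩, fun x hx => by simp [h3 x hx], fun x => pow_nonneg (h4 x) m,
    fun x => pow_le_one₀ (h4 x) (h5 x), fun x => ?_⟩
  have hg : hgrad (fun x => χ x ^ m) x = (m * χ x ^ (m - 1)) • hgrad χ x := by
    ext i
    rw [hgrad_apply, fderiv_fun_pow m (hχ.1.differentiable (by simp) x)]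
    simp
  have h7 : χ x ^ (m - 1) ≤ (χ x ^ m) ^ ((p - 1) / p) := by
    rw [← Real.rpow_natCast, ← Real.rpow_natCast, ← Real.rpow_mul (h4 x)]
    refine Real.rpow_le_rpow_of_exponent_ge' (h4 x) (h5 x) ?_ ?_
    · exact mul_nonneg (by positivity) (div_nonneg (by linarith) hp0.le)
    · rw [Nat.cast_sub hm1, Nat.cast_one, mul_div_assoc', div_le_iff₀ hp0]
      nlinarith
  rw [hg, norm_smul, norm_mul, norm_pow, Real.norm_of_nonneg (h4 x), Real.norm_natCast]
  have h8 := h6 x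
  have h9 : 0 ≤ C / (r₂ - r₁) := div_nonneg hC0 (by linarith)
  have h10 := h4 x
  calc (m : ℝ) * χ x ^ (m - 1) * ‖hgrad χ x‖
      ≤ m * (χ x ^ m) ^ ((p - 1) / p) * (C / (r₂ - r₁)) := by gcongr
    _ = _ := by ring

end

/-! ### The Caccioppoli estimate -/

section

open Filter Topology
variable {n : ℕ}

/-- Young's inequality with a non-optimal constant, by distinguishing `b ≤ ε x` and `ε x ≤ b`. -/
lemma rpow_mul_le_add {p ε x b : ℝ} (hp : 1 ≤ p) (hε : 0 < ε) (hx : 0 ≤ x) (hb : 0 ≤ b) :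
    x ^ (p - 1) * b ≤ ε * x ^ p + (1 / ε) ^ (p - 1) * b ^ p := by
  have hsplit : ∀ t : ℝ, 0 ≤ t → t ^ (p - 1) * t = t ^ p := fun t ht => by
    rw [mul_comm, ← Real.rpow_one_add' ht (by linarith)]; congr 1; ring
  have hp1 : 0 ≤ p - 1 := by linarith
  rcases le_total b (ε * x) with h | h
  · calc x ^ (p - 1) * b ≤ x ^ (p - 1) * (ε * x) := by gcongr
      _ = ε * (x ^ (p - 1) * x) := by ring
      _ = ε * x ^ p := by rw [hsplit x hx]
      _ ≤ _ := le_add_of_nonneg_right (by positivity)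
  · have h1 : x ≤ 1 / ε * b := by rw [one_div_mul_eq_div, le_div_iff₀ hε]; linarith
    calc x ^ (p - 1) * b ≤ (1 / ε * b) ^ (p - 1) * b := by gcongr
      _ = (1 / ε) ^ (p - 1) * (b ^ (p - 1) * b) := by
          rw [Real.mul_rpow (by positivity) hb]; ring
      _ = (1 / ε) ^ (p - 1) * b ^ p := by rw [hsplit b hb]
      _ ≤ _ := le_add_of_nonneg_left (by positivity)

lemma add_rpow_le {p a b : ℝ} (hp : 1 ≤ p) (ha : 0 ≤ a) (hb : 0 ≤ b) :
    (a + b) ^ p ≤ 2 ^ p * (a ^ p + b ^ p) := by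
  have hp0 : 0 ≤ p := by linarith
  have key : ∀ a b : ℝ, 0 ≤ a → 0 ≤ b → a ≤ b → (a + b) ^ p ≤ 2 ^ p * (a ^ p + b ^ p) := by
    intro a b ha hb hab
    calc (a + b) ^ p ≤ (2 * b) ^ p := by gcongr; linarith
      _ = 2 ^ p * b ^ p := Real.mul_rpow (by norm_num) hb
      _ ≤ _ := by gcongr; exact le_add_of_nonneg_left (by positivity)
  rcases le_total a b with h | h
  · exact key a b ha hb h
  · rw [add_comm a, add_comm (a ^ p)]; exact key b a hb ha h

/-- The function `w ∈ HW^{1,p}(U)` solves `div_H A = 0` for a vector field `A` which satisfies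
coercivity and growth conditions of order `p - 1` with respect to `𝔛 w`. The equation is stated for
limits of test functions, so that it can be tested with the solution itself times a cutoff. -/
structure IsCoerciveSolution (p l L s : ℝ) (U : Set (Pt n)) (A : Pt n → Hor n) (w : Pt n → ℝ)
    (Dw : Pt n → Hor n) : Prop where
  isOpen : IsOpen U
  volume_ne_top : volume U ≠ ∞
  memHW : MemHW p U w Dw
  memLp : MemLp A (ENNReal.ofReal (p / (p - 1))) (volume.restrict U)
  integral_eq_zero : ∀ V ⊆ U, ∀ φ f F, TestLimit p V φ f F → ∫ x in V, inner ℝ (A x) (F x) = 0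
  lower : ∀ x ∈ U, l * ‖Dw x‖ ^ p ≤ inner ℝ (A x) (Dw x)
  upper : ∀ x ∈ U, ‖A x‖ ≤ L * (‖Dw x‖ + s) ^ (p - 1)

/-- The ellipticity constant of `a`, in unweighted form. -/
def coerConst (p : ℝ) : ℝ := monoConst p * (1 / 2) ^ ((p - 2) / 2)

lemma coerConst_pos (p : ℝ) : 0 < coerConst p := mul_pos (monoConst_pos p) (by positivity)

lemma IsWeakSolution.isCoerciveSolution {Ω : Set (Pt n)} {a : Pt n → Hor n → Hor n}
    {p L L' s α : ℝ} (h : StructureCondition Ω a p L L' s α) (hL : 0 ≤ L) (hp : 2 ≤ p)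
    (hs : 0 ≤ s) (hΩ : IsOpen Ω) {U : Set (Pt n)} (hU : IsOpen U) (hUΩ : U ⊆ Ω)
    (hUf : volume U ≠ ∞) {x₀ : Pt n} (hx₀ : x₀ ∈ Ω) {w : Pt n → ℝ} {Dw : Pt n → Hor n}
    (hw : IsWeakSolution p U a 0 w Dw) :
    IsCoerciveSolution p (coerConst p) L s U (fun x => a x (Dw x) - a x₀ 0) w Dw where
  isOpen := hU
  volume_ne_top := hUf
  memHW := hw.1
  memLp := h.memLp_sub hL hp hs hΩ hU.measurableSet hUΩ hUf hx₀ hw.1.2.1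
  integral_eq_zero V hV φ f F hφ := hφ.integral_inner_eq_zero (by linarith) hV
    (h.memLp_sub hL hp hs hΩ hU.measurableSet hUΩ hUf hx₀ hw.1.2.1) fun ψ hψ =>
      hw.integral_eq_zero hψ
  lower x hx := by
    have := h.monotone_rpow hp (hUΩ hx) (Dw x) 0
    rwa [sub_zero, ← h.apply_zero_eq hx₀ (hUΩ hx)] at this
  upper x hx := h.norm_sub_le hL hp hs (hUΩ hx) hx₀ _

/-- The pointwise energy inequality behind the Caccioppoli estimate. -/
lemma energy_pointwise {p l L s Λ t W : ℝ} (hp : 2 ≤ p) (hl : 0 < l) (hL : 0 ≤ L) (hs : 0 ≤ s)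
    (ht0 : 0 ≤ t) (ht1 : t ≤ 1) {A z g : Hor n} (h1 : l * ‖z‖ ^ p ≤ inner ℝ A z)
    (h2 : ‖A‖ ≤ L * (‖z‖ + s) ^ (p - 1)) (hg : ‖g‖ ≤ Λ * t ^ ((p - 1) / p)) (hΛ : 0 ≤ Λ) :
    l / 2 * (t * ‖z‖ ^ p) ≤ inner ℝ A (t • z + W • g) + (l / 2 * s ^ p +
      (2 ^ p * 2 / l) ^ (p - 1) * L ^ p * (Λ ^ p * |W| ^ p)) := by
  have hp0 : 0 < p := by linarith
  have hz := norm_nonneg z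
  set y := t ^ (1 / p) * (‖z‖ + s) with hy
  have hy0 : 0 ≤ y := by positivity
  have hyp : y ^ p = t * (‖z‖ + s) ^ p := by
    rw [hy, Real.mul_rpow (by positivity) (by positivity), ← Real.rpow_mul ht0,
      one_div_mul_cancel hp0.ne', Real.rpow_one]
  have hyp1 : y ^ (p - 1) = t ^ ((p - 1) / p) * (‖z‖ + s) ^ (p - 1) := by
    rw [hy, Real.mul_rpow (by positivity) (by positivity), ← Real.rpow_mul ht0]
    congr 2; ring
  have hY := rpow_mul_le_add (p := p) (ε := l / (2 ^ p * 2)) (x := y) (b := L * (Λ * |W|))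
    (by linarith) (by positivity) hy0 (by positivity)
  rw [one_div_div, hyp, Real.mul_rpow hL (by positivity), Real.mul_rpow hΛ (abs_nonneg _)] at hY
  have h3 : -(y ^ (p - 1) * (L * (Λ * |W|))) ≤ W * inner ℝ A g := by
    have h4 : |W * inner ℝ A g| ≤ y ^ (p - 1) * (L * (Λ * |W|)) := by
      rw [abs_mul, hyp1]
      calc |W| * |inner ℝ A g| ≤ |W| * (‖A‖ * ‖g‖) := by
            gcongr; exact abs_real_inner_le_norm A g
        _ ≤ |W| * ((L * (‖z‖ + s) ^ (p - 1)) * (Λ * t ^ ((p - 1) / p))) := by gcongr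
        _ = _ := by ring
    exact (abs_le.1 h4).1
  have h5 := add_rpow_le (p := p) (by linarith) hz hs
  have h6 : l / (2 ^ p * 2) * (t * (‖z‖ + s) ^ p) ≤ l / 2 * (t * ‖z‖ ^ p) + l / 2 * s ^ p := by
    calc l / (2 ^ p * 2) * (t * (‖z‖ + s) ^ p)
        ≤ l / (2 ^ p * 2) * (t * (2 ^ p * (‖z‖ ^ p + s ^ p))) := by gcongr
      _ = l / 2 * (t * ‖z‖ ^ p) + l / 2 * (t * s ^ p) := by field_simp
      _ ≤ l / 2 * (t * ‖z‖ ^ p) + l / 2 * (1 * s ^ p) := by gcongr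
      _ = _ := by ring
  rw [inner_add_right, inner_smul_right, inner_smul_right]
  have h7 := mul_le_mul_of_nonneg_left h1 ht0
  have h8 : t * (l * ‖z‖ ^ p) = l * (t * ‖z‖ ^ p) := by ring
  linarith

/-- The Caccioppoli estimate, from testing with `θ (w - c)`. -/
lemma IsCoerciveSolution.caccioppoli {p l L s : ℝ} (hp : 2 ≤ p) (hl : 0 < l) (hL : 0 ≤ L)
    (hs : 0 ≤ s) {U : Set (Pt n)} {A : Pt n → Hor n} {w : Pt n → ℝ} {Dw : Pt n → Hor n}
    (h : IsCoerciveSolution p l L s U A w Dw) {V : Set (Pt n)} (hV : IsOpen V) (hVU : V ⊆ U)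
    {θ : Pt n → ℝ} (hθ : IsTest V θ) (hθ0 : ∀ x, 0 ≤ θ x) (hθ1 : ∀ x, θ x ≤ 1) {Λ : ℝ}
    (hΛ : 0 ≤ Λ) (hg : ∀ x, ‖hgrad θ x‖ ≤ Λ * θ x ^ ((p - 1) / p)) (c : ℝ) :
    ∫⁻ x in V, ENNReal.ofReal (θ x * ‖Dw x‖ ^ p) ≤
      ENNReal.ofReal (1 + 2 / l * ((2 ^ p * 2 / l) ^ (p - 1) * L ^ p)) *
        ∫⁻ x in V, ENNReal.ofReal (s ^ p + Λ ^ p * |w x - c| ^ p) := by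
  have hp1 : 1 < p := by linarith
  have hm := h.memHW.mono hVU
  obtain ⟨φ, hφ⟩ := hm.exists_testLimit_mul hp1.le hV hθ c
  have hI := integrable_inner_of_memLp hp1 (h.memLp.mono_measure (Measure.restrict_mono hVU le_rfl))
    hφ.memLp_grad
  have hDm := hm.2.1.1
  have hwm := hm.1.1
  set K := (2 ^ p * 2 / l) ^ (p - 1) * L ^ p with hK
  have hK0 : 0 ≤ K := by positivity
  have main := lintegral_le_of_le_add (M := 0)
    (G := fun x => l / 2 * (θ x * ‖Dw x‖ ^ p))
    (H := fun x => l / 2 * s ^ p + K * (Λ ^ p * |w x - c| ^ p)) hI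
    (h.integral_eq_zero V hVU φ _ _ hφ).le
    (((hθ.1.continuous.aestronglyMeasurable).mul
      (hDm.norm.aemeasurable.pow_const p).aestronglyMeasurable).const_mul _)
    (ae_of_all _ fun x => by have := hθ0 x; positivity)
    ((((hwm.sub aestronglyMeasurable_const).norm.aemeasurable.pow_const
      p).aestronglyMeasurable.const_mul _).const_mul _ |>.const_add _)
    (ae_of_all _ fun x => by positivity)
    (by
      filter_upwards [ae_restrict_mem hV.measurableSet] with x hx
      exact energy_pointwise hp hl hL hs (hθ0 x) (hθ1 x) (h.lower x (hVU hx)) (h.upper x (hVU hx))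
        (hg x) hΛ)
  rw [ENNReal.ofReal_zero, zero_add] at main
  have e1 : ∀ x, ENNReal.ofReal (θ x * ‖Dw x‖ ^ p) =
      ENNReal.ofReal (2 / l) * ENNReal.ofReal (l / 2 * (θ x * ‖Dw x‖ ^ p)) := fun x => by
    rw [← ENNReal.ofReal_mul (by positivity)]; congr 1; field_simp
  simp only [e1]
  rw [lintegral_const_mul' _ _ ENNReal.ofReal_ne_top]
  refine (mul_le_mul_right main _).trans ?_
  rw [← lintegral_const_mul' (ENNReal.ofReal (2 / l)) _ ENNReal.ofReal_ne_top,
    ← lintegral_const_mul' (ENNReal.ofReal (1 + 2 / l * K)) _ ENNReal.ofReal_ne_top]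
  refine lintegral_mono fun x => ?_
  rw [← ENNReal.ofReal_mul (by positivity), ← ENNReal.ofReal_mul (by positivity)]
  refine ENNReal.ofReal_le_ofReal ?_
  have hW : 0 ≤ Λ ^ p * |w x - c| ^ p := by positivity
  have hsp : 0 ≤ s ^ p := by positivity
  have e2 : 2 / l * (l / 2 * s ^ p + K * (Λ ^ p * |w x - c| ^ p)) =
      s ^ p + (2 / l * K) * (Λ ^ p * |w x - c| ^ p) := by field_simp
  have h3 : 0 ≤ 2 / l * K := by positivity
  rw [e2]
  nlinarith [mul_nonneg h3 hsp]

end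

/-! ### The local estimate of the p-norm by the 1-norm -/

section

open Filter Topology
variable {n : ℕ}

/-- The form in which the second term of `nash_of_translate` is used. -/
lemma nash_term_eq {p : ℝ} (hp : 1 ≤ p) (v m : ℝ≥0∞) :
    ((v * m) ^ (p - 1) * m) ^ (1 / p) = v ^ ((p - 1) / p) * m := by
  have hp0 : 0 < p := by linarith
  have h1 : m ^ (p - 1) * m = m ^ p := by
    conv_lhs => rw [← ENNReal.rpow_one m, ← ENNReal.rpow_mul, one_mul]
    rw [← ENNReal.rpow_add_of_nonneg _ _ (by linarith) zero_le_one]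
    congr 1; ring
  rw [ENNReal.mul_rpow_of_nonneg v m (by linarith : 0 ≤ p - 1), mul_assoc, h1,
    ENNReal.mul_rpow_of_nonneg _ _ (by positivity), ← ENNReal.rpow_mul, ← ENNReal.rpow_mul,
    mul_one_div_cancel hp0.ne', ENNReal.rpow_one, mul_one_div]

/-- The exponent `Q (p - 1) / p` of the radius in the interpolation inequality. -/
def nashExp (n : ℕ) (p : ℝ) : ℝ := homDim n * ((p - 1) / p)

lemma nashExp_nonneg (n : ℕ) {p : ℝ} (hp : 1 ≤ p) : 0 ≤ nashExp n p :=
  mul_nonneg (by positivity) (div_nonneg (by linarith) (by linarith))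

/-- The `L^p` norm of `W` on a box. -/
def boxNorm {E : Type*} [ENorm E] (p : ℝ) (W : Pt n → E) (y : Pt n) (r : ℝ) : ℝ≥0∞ :=
  (∫⁻ x in cbox y r, ‖W x‖ₑ ^ p) ^ (1 / p)

lemma boxNorm_mono {E : Type*} [ENorm E] {p : ℝ} (hp : 0 < p) (W : Pt n → E) (y : Pt n)
    {r r' : ℝ} (h : r ≤ r') : boxNorm p W y r ≤ boxNorm p W y r' := by
  unfold boxNorm
  gcongr
  exact cbox_mono y h

/-- Extraction of the `p`-th root from the right side of the Caccioppoli estimate. -/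
lemma rpow_one_div_le_of_lintegral {p : ℝ} (hp : 1 ≤ p) {V : Set (Pt n)} {s Λ C : ℝ}
    (hs : 0 ≤ s) (hΛ : 0 ≤ Λ) (hC : 0 ≤ C) (W : Pt n → ℝ) {v : ℝ} (hv : 0 ≤ v)
    (hV : volume V = ENNReal.ofReal v) :
    (ENNReal.ofReal C * ∫⁻ x in V, ENNReal.ofReal (s ^ p + Λ ^ p * |W x| ^ p)) ^ (1 / p) ≤
      ENNReal.ofReal (C ^ (1 / p)) * (ENNReal.ofReal (s * v ^ (1 / p)) +
        ENNReal.ofReal Λ * (∫⁻ x in V, ‖W x‖ₑ ^ p) ^ (1 / p)) := by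
  have hp0 : 0 < p := by linarith
  have hp1 : 0 ≤ 1 / p := by positivity
  have hp2 : 1 / p ≤ 1 := by rw [div_le_one hp0]; exact hp
  have e1 : ∀ x, ENNReal.ofReal (s ^ p + Λ ^ p * |W x| ^ p) =
      ENNReal.ofReal s ^ p + ENNReal.ofReal Λ ^ p * ‖W x‖ₑ ^ p := fun x => by
    rw [ENNReal.ofReal_add (by positivity) (by positivity), ENNReal.ofReal_mul (by positivity),
      ← ENNReal.ofReal_rpow_of_nonneg hs hp0.le, ← ENNReal.ofReal_rpow_of_nonneg hΛ hp0.le,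
      ← ENNReal.ofReal_rpow_of_nonneg (abs_nonneg _) hp0.le, Real.enorm_eq_ofReal_abs]
  simp only [e1]
  rw [lintegral_add_left measurable_const, lintegral_const_mul' _ _
    (ENNReal.rpow_ne_top_of_nonneg hp0.le ENNReal.ofReal_ne_top), lintegral_const,
    Measure.restrict_apply_univ, hV, ENNReal.mul_rpow_of_nonneg _ _ hp1,
    ENNReal.ofReal_rpow_of_nonneg hC hp1]
  gcongr
  refine (ENNReal.rpow_add_le_add_rpow _ _ hp1 hp2).trans (le_of_eq ?_)
  rw [ENNReal.mul_rpow_of_nonneg _ _ hp1, ENNReal.mul_rpow_of_nonneg _ _ hp1, ← ENNReal.rpow_mul,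
    ← ENNReal.rpow_mul, mul_one_div_cancel hp0.ne', ENNReal.rpow_one, ENNReal.rpow_one,
    ENNReal.ofReal_rpow_of_nonneg hv hp1, ENNReal.ofReal_mul hs]

/-- The constant of the Caccioppoli estimate. -/
def cacConst (p l L : ℝ) : ℝ := 1 + 2 / l * ((2 ^ p * 2 / l) ^ (p - 1) * L ^ p)

lemma cacConst_pos {p l L : ℝ} (hl : 0 < l) (hL : 0 ≤ L) : 0 < cacConst p l L := by
  unfold cacConst; positivity

/-- The gradient of the localized solution `θ (w - c)`, estimated through the Caccioppoli
inequality. -/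
lemma IsCoerciveSolution.lintegral_cutoff_grad_le {p l L s : ℝ} (hp : 2 ≤ p) (hl : 0 < l)
    (hL : 0 ≤ L) (hs : 0 ≤ s) {U : Set (Pt n)} {A : Pt n → Hor n} {w : Pt n → ℝ}
    {Dw : Pt n → Hor n} (h : IsCoerciveSolution p l L s U A w Dw) {V : Set (Pt n)}
    (hV : IsOpen V) (hVU : V ⊆ U) {θ : Pt n → ℝ} (hθ : IsTest V θ) (hθ0 : ∀ x, 0 ≤ θ x)
    (hθ1 : ∀ x, θ x ≤ 1) {Λ : ℝ} (hΛ : 0 ≤ Λ)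
    (hg : ∀ x, ‖hgrad θ x‖ ≤ Λ * θ x ^ ((p - 1) / p)) (c : ℝ) :
    ∫⁻ x in V, ‖θ x • Dw x + (w x - c) • hgrad θ x‖ₑ ^ p ≤
      ENNReal.ofReal (2 ^ p * (cacConst p l L + 1)) *
        ∫⁻ x in V, ENNReal.ofReal (s ^ p + Λ ^ p * |w x - c| ^ p) := by
  have hp0 : 0 < p := by linarith
  have hm := h.memHW.mono hVU
  have hC := cacConst_pos (p := p) hl hL
  have h1 := h.caccioppoli hp hl hL hs hV hVU hθ hθ0 hθ1 hΛ hg c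
  have h2 : ∀ x, ‖θ x • Dw x + (w x - c) • hgrad θ x‖ₑ ^ p ≤ ENNReal.ofReal (2 ^ p) *
      (ENNReal.ofReal (θ x * ‖Dw x‖ ^ p) + ENNReal.ofReal (s ^ p + Λ ^ p * |w x - c| ^ p)) := by
    intro x
    have ht0 := hθ0 x
    have ht1 := hθ1 x
    rw [← ofReal_norm, ENNReal.ofReal_rpow_of_nonneg (norm_nonneg _) hp0.le,
      ← ENNReal.ofReal_add (by positivity) (by positivity), ← ENNReal.ofReal_mul (by positivity)]
    refine ENNReal.ofReal_le_ofReal ?_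
    have e1 : ‖θ x • Dw x + (w x - c) • hgrad θ x‖ ≤ θ x * ‖Dw x‖ + Λ * |w x - c| := by
      refine (norm_add_le _ _).trans ?_
      rw [norm_smul, norm_smul, Real.norm_of_nonneg ht0, Real.norm_eq_abs]
      have e2 : θ x ^ ((p - 1) / p) ≤ 1 :=
        Real.rpow_le_one ht0 ht1 (div_nonneg (by linarith) hp0.le)
      have e3 : ‖hgrad θ x‖ ≤ Λ := (hg x).trans (by nlinarith)
      have e4 := abs_nonneg (w x - c)
      nlinarith
    have e5 : θ x ^ p ≤ θ x := by
      conv_rhs => rw [← Real.rpow_one (θ x)]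
      exact Real.rpow_le_rpow_of_exponent_ge' ht0 ht1 zero_le_one (by linarith)
    have e6 : 0 ≤ s ^ p := by positivity
    calc _ ≤ (θ x * ‖Dw x‖ + Λ * |w x - c|) ^ p := by gcongr
      _ ≤ 2 ^ p * ((θ x * ‖Dw x‖) ^ p + (Λ * |w x - c|) ^ p) :=
          add_rpow_le (by linarith) (by positivity) (by positivity)
      _ = 2 ^ p * (θ x ^ p * ‖Dw x‖ ^ p + Λ ^ p * |w x - c| ^ p) := by
          rw [Real.mul_rpow ht0 (norm_nonneg _), Real.mul_rpow hΛ (abs_nonneg _)]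
      _ ≤ 2 ^ p * (θ x * ‖Dw x‖ ^ p + (s ^ p + Λ ^ p * |w x - c| ^ p)) := by
          gcongr; linarith
  refine (lintegral_mono h2).trans ?_
  have hDm : AEMeasurable (fun x => ENNReal.ofReal (θ x * ‖Dw x‖ ^ p)) (volume.restrict V) :=
    (hθ.1.continuous.measurable.aemeasurable.mul
      (hm.2.1.1.norm.aemeasurable.pow_const p)).ennreal_ofReal
  rw [lintegral_const_mul' _ _ ENNReal.ofReal_ne_top, lintegral_add_left' hDm,
    ENNReal.ofReal_mul (by positivity), mul_assoc]
  gcongr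
  rw [ENNReal.ofReal_add hC.le zero_le_one, ENNReal.ofReal_one, add_mul, one_mul]
  gcongr
  exact h1

/-- Gain of integrability on a smaller box, up to a small multiple of the norm on the larger
box. This is the Nash inequality for `θ (w - c)` at a scale proportional to `r₂ - r₁`, with the
gradient estimated by the Caccioppoli inequality. -/
lemma exists_boxNorm_step (n : ℕ) [NeZero n] {p l L : ℝ} (hp : 2 ≤ p) (hl : 0 < l)
    (hL : 0 ≤ L) :
    ∃ K : ℝ, 0 ≤ K ∧ ∀ {s : ℝ}, 0 ≤ s → ∀ {U : Set (Pt n)} {A : Pt n → Hor n} {w : Pt n → ℝ}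
      {Dw : Pt n → Hor n}, IsCoerciveSolution p l L s U A w Dw → ∀ (y : Pt n) (c r₁ r₂ ρ : ℝ),
      0 < r₁ → r₁ < r₂ → r₂ ≤ ρ → cbox y ρ ⊆ U →
      boxNorm p (fun x => w x - c) y r₁ ≤
        ENNReal.ofReal (2 ^ (-nashExp n p - 1)) * boxNorm p (fun x => w x - c) y r₂ +
        (ENNReal.ofReal ((r₂ - r₁) * (s * (boxVol n * ρ ^ homDim n) ^ (1 / p))) +
        ENNReal.ofReal (K * (r₂ - r₁) ^ (-nashExp n p)) * ∫⁻ x in cbox y ρ, ‖w x - c‖ₑ) := by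
  have hp0 : 0 < p := by linarith
  have hp1 : 1 ≤ p := by linarith
  obtain ⟨Cc, hCc, hcut⟩ := exists_cutoff_rpow n hp1
  have hb := boxVol_pos n
  set C₂ := (2 ^ p * (cacConst p l L + 1)) ^ (1 / p) with hC₂
  have hcac := cacConst_pos (p := p) hl hL
  have hC₂0 : 0 < C₂ := by positivity
  set N := nashExp n p with hN
  have hN0 : 0 ≤ N := nashExp_nonneg n hp1
  -- Boxes of radius `δ (r₂ - r₁)` are so small that the gradient term of the Nash inequality
  -- carries the factor `2 ^ (-N - 1)`.
  set δ := 2 ^ (-N - 1) / (37 * C₂ * (Cc + 1)) with hδ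
  have hδ0 : 0 < δ := by positivity
  have hδ1 : 37 * δ * C₂ * (Cc + 1) = 2 ^ (-N - 1) := by rw [hδ]; field_simp
  have h2N : (2 : ℝ) ^ (-N - 1) ≤ 1 :=
    Real.rpow_le_one_of_one_le_of_nonpos (by norm_num) (by linarith)
  have hδ2 : 37 * δ * C₂ ≤ 2 ^ (-N - 1) := by
    have : 0 < 37 * δ * C₂ := by positivity
    nlinarith
  refine ⟨((boxVol n * δ ^ homDim n)⁻¹) ^ ((p - 1) / p), by positivity, ?_⟩
  intro s hs U A w Dw h y c r₁ r₂ ρ h1 h12 h2ρ hρU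
  set e := r₂ - r₁ with he
  have he0 : 0 < e := by linarith
  have hr2 : 0 < r₂ := by linarith
  have hVU : cbox y r₂ ⊆ U := (cbox_mono y h2ρ).trans hρU
  have hVm := (isOpen_cbox y r₂).measurableSet
  obtain ⟨θ, hθ, hθ1, hθ0, hθle, hθg⟩ := hcut y r₁ r₂ h1 h12
  have hΛ : 0 ≤ Cc / e := by positivity
  obtain ⟨φ, hφ⟩ := (h.memHW.mono hVU).exists_testLimit_mul hp1 (isOpen_cbox y r₂) hθ c
  set f : Pt n → ℝ := fun x => θ x * (w x - c) with hf
  have hgrad := h.lintegral_cutoff_grad_le hp hl hL hs (isOpen_cbox y r₂) hVU hθ hθ0 hθle hΛ hθg c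
  have hfm : AEStronglyMeasurable ((cbox y r₂).indicator f) volume :=
    ((memLp_indicator_iff_restrict hVm).2 hφ.memLp).1
  have hnash := nash_of_translate hfm (mul_pos hδ0 he0) hp1
    (fun g hg => hφ.lintegral_translate_le hp1 hVm hg)
  rw [nash_term_eq hp1] at hnash
  have hL1 : boxNorm p (fun x => w x - c) y r₁ ≤
      (∫⁻ x, ‖(cbox y r₂).indicator f x‖ₑ ^ p) ^ (1 / p) := by
    refine ENNReal.rpow_le_rpow ?_ (by positivity)
    rw [← lintegral_indicator (isOpen_cbox y r₁).measurableSet]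
    refine lintegral_mono fun x => ?_
    by_cases hx : x ∈ cbox y r₁
    · simp [hx, cbox_mono y h12.le hx, hf, hθ1 x hx]
    · simp [hx]
  have hm1 : ∫⁻ x, ‖(cbox y r₂).indicator f x‖ₑ ≤ ∫⁻ x in cbox y ρ, ‖w x - c‖ₑ := by
    rw [← lintegral_indicator (isOpen_cbox y ρ).measurableSet]
    refine lintegral_mono fun x => ?_
    by_cases hx : x ∈ cbox y r₂
    · simp only [hx, indicator_of_mem, cbox_mono y h2ρ hx, hf]
      rw [enorm_mul]
      refine mul_le_of_le_one_left (zero_le) ?_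
      rw [Real.enorm_of_nonneg (hθ0 x)]
      simpa using hθle x
    · simp [hx]
  have hgrad' := ENNReal.rpow_le_rpow hgrad (show 0 ≤ 1 / p by positivity)
  have hr1 := rpow_one_div_le_of_lintegral hp1 hs hΛ
    (by positivity : 0 ≤ 2 ^ p * (cacConst p l L + 1)) (fun x => w x - c)
    (by positivity : 0 ≤ boxVol n * r₂ ^ homDim n) (volume_cbox y hr2)
  refine hL1.trans (hnash.trans ?_)
  rw [← add_assoc]
  refine add_le_add ?_ ?_
  · rw [ENNReal.mul_rpow_of_nonneg _ _ (by positivity), ← ENNReal.rpow_mul,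
      mul_one_div_cancel hp0.ne', ENNReal.rpow_one]
    refine (mul_le_mul_right (hgrad'.trans hr1) _).trans ?_
    rw [← hC₂, ← mul_assoc, ← ENNReal.ofReal_mul (by positivity), mul_add, add_comm, ← mul_assoc,
      ← ENNReal.ofReal_mul (by positivity), ← ENNReal.ofReal_mul (by positivity)]
    refine add_le_add ?_ ?_
    · refine mul_le_mul_left (ENNReal.ofReal_le_ofReal ?_) _
      have : 37 * (δ * e) * C₂ * (Cc / e) = 37 * δ * C₂ * Cc := by field_simp
      rw [this, ← hδ1]
      gcongr
      linarith
    · refine ENNReal.ofReal_le_ofReal ?_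
      have : 37 * (δ * e) * C₂ = (37 * δ * C₂) * e := by ring
      rw [this]
      have h3 : (37 * δ * C₂) * e ≤ 1 * e := by
        gcongr; exact hδ2.trans h2N
      calc _ ≤ (1 * e) * (s * (boxVol n * ρ ^ homDim n) ^ (1 / p)) := by gcongr
        _ = _ := by rw [one_mul]
  · rw [volume_box (mul_pos hδ0 he0), ← ENNReal.ofReal_inv_of_pos (by positivity),
      ENNReal.ofReal_rpow_of_pos (by positivity)]
    refine mul_le_mul' (ENNReal.ofReal_le_ofReal (le_of_eq ?_)) hm1
    rw [mul_pow, ← mul_assoc, mul_inv, Real.mul_rpow (by positivity) (by positivity)]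
    congr 1
    rw [Real.inv_rpow (by positivity), ← Real.rpow_natCast, ← Real.rpow_mul he0.le,
      Real.rpow_neg he0.le, hN, nashExp]

/-- Absorption of half of a bounded function. Boundedness is needed since `∞ ≤ ∞ / 2 + D`. -/
lemma le_two_mul_of_absorb {g : ℝ → ℝ≥0∞} {I : Set ℝ} {K₀ D : ℝ≥0∞} (hK : K₀ ≠ ∞)
    (hb : ∀ r ∈ I, g r ≤ K₀) (h : ∀ r ∈ I, ∃ r' ∈ I, g r ≤ g r' / 2 + D) :
    ∀ r ∈ I, g r ≤ 2 * D := by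
  set S := ⨆ r ∈ I, g r with hS
  have hle : ∀ r ∈ I, g r ≤ S := fun r hr => le_iSup₂ (f := fun r _ => g r) r hr
  have hS1 : S ≠ ∞ := ((iSup₂_le hb).trans_lt hK.lt_top).ne
  have h2 : S ≤ S / 2 + D := iSup₂_le fun r hr => by
    obtain ⟨r', hr', h3⟩ := h r hr
    refine h3.trans ?_
    gcongr
    exact hle r' hr'
  have h3 : S / 2 ≤ D := by
    have h4 : S / 2 ≠ ∞ := ENNReal.div_ne_top hS1 (by simp)
    rw [← ENNReal.add_le_add_iff_left h4, ENNReal.add_halves]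
    exact h2
  intro r hr
  refine (hle r hr).trans ?_
  rw [← ENNReal.add_halves S, two_mul]
  gcongr

/-- The local `L^1`-`L^p` estimate for solutions. The weight `(2 ρ - r) ^ N` compensates the growth
of the constant in `exists_boxNorm_step` as the radii approach each other; passing from `r` to the
midpoint of `r` and `2 ρ` costs a factor `2 ^ N`, which leaves one half of the norm to absorb. -/
lemma exists_boxNorm_le (n : ℕ) [NeZero n] {p l L : ℝ} (hp : 2 ≤ p) (hl : 0 < l)
    (hL : 0 ≤ L) :
    ∃ K : ℝ, 0 ≤ K ∧ ∀ {s : ℝ}, 0 ≤ s → ∀ {U : Set (Pt n)} {A : Pt n → Hor n} {w : Pt n → ℝ}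
      {Dw : Pt n → Hor n}, IsCoerciveSolution p l L s U A w Dw → ∀ (y : Pt n) (c ρ : ℝ),
      0 < ρ → cbox y (2 * ρ) ⊆ U →
      ENNReal.ofReal (ρ ^ nashExp n p) * boxNorm p (fun x => w x - c) y ρ ≤
        2 * (ENNReal.ofReal (ρ ^ nashExp n p * (ρ * (s * (boxVol n * (2 * ρ) ^ homDim n) ^ (1 / p))))
          + ENNReal.ofReal K * ∫⁻ x in cbox y (2 * ρ), ‖w x - c‖ₑ) := by
  have hp0 : 0 < p := by linarith
  have hp1 : 1 ≤ p := by linarith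
  obtain ⟨K, hK, hstep⟩ := exists_boxNorm_step n hp hl hL
  set N := nashExp n p with hN
  have hN0 : 0 ≤ N := nashExp_nonneg n hp1
  refine ⟨K * 2 ^ N, by positivity, ?_⟩
  intro s hs U A w Dw h y c ρ hρ hρU
  have hb := boxVol_pos n
  set B := s * (boxVol n * (2 * ρ) ^ homDim n) ^ (1 / p) with hB
  have hB0 : 0 ≤ B := by positivity
  set Φ := boxNorm p (fun x => w x - c) y with hΦ
  set m := ∫⁻ x in cbox y (2 * ρ), ‖w x - c‖ₑ with hm
  have hfin : Φ (2 * ρ) ≠ ∞ := by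
    have hfm : IsFiniteMeasure (volume.restrict (cbox y (2 * ρ))) :=
      isFiniteMeasure_restrict.2 (by rw [volume_cbox y (by linarith)]; simp)
    have h1 : MemLp (fun x => w x - c) (ENNReal.ofReal p) (volume.restrict (cbox y (2 * ρ))) :=
      ((h.memHW.mono hρU).1).sub (memLp_const c)
    have h2 := h1.2.ne
    rwa [eLpNorm_eq_lintegral_rpow_enorm_toReal (by simpa using hp0) ENNReal.ofReal_ne_top,
      ENNReal.toReal_ofReal hp0.le] at h2
  have key := le_two_mul_of_absorb (I := Ico ρ (2 * ρ))
    (g := fun r => ENNReal.ofReal ((2 * ρ - r) ^ N) * Φ r)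
    (K₀ := ENNReal.ofReal (ρ ^ N) * Φ (2 * ρ))
    (D := ENNReal.ofReal (ρ ^ N * (ρ * B)) + ENNReal.ofReal (K * 2 ^ N) * m)
    (ENNReal.mul_ne_top ENNReal.ofReal_ne_top hfin) ?_ ?_ ρ ⟨le_rfl, by linarith⟩
  · have : 2 * ρ - ρ = ρ := by ring
    rwa [this] at key
  · intro r hr
    have h1 : 0 ≤ 2 * ρ - r := by linarith [hr.2]
    gcongr
    · linarith [hr.1]
    · exact boxNorm_mono hp0 _ y hr.2.le
  · intro r hr
    have h1 : 0 < 2 * ρ - r := by linarith [hr.2]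
    have h1' : 2 * ρ - r ≤ ρ := by linarith [hr.1]
    refine ⟨(r + 2 * ρ) / 2, ⟨by linarith [hr.1], by linarith [hr.2]⟩, ?_⟩
    have h2 := hstep hs h y c r ((r + 2 * ρ) / 2) (2 * ρ) (by linarith [hr.1]) (by linarith)
      (by linarith) hρU
    have e1 : (r + 2 * ρ) / 2 - r = (2 * ρ - r) / 2 := by ring
    have e2 : 2 * ρ - (r + 2 * ρ) / 2 = (2 * ρ - r) / 2 := by ring
    rw [e1, ← hB, ← hΦ, ← hm] at h2
    rw [e2]
    set t := 2 * ρ - r with ht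
    refine (mul_le_mul_right h2 _).trans ?_
    rw [mul_add, mul_add]
    refine add_le_add (le_of_eq ?_) (add_le_add ?_ (le_of_eq ?_))
    · rw [← mul_assoc, ← ENNReal.ofReal_mul (by positivity), ENNReal.div_eq_inv_mul, ← mul_assoc]
      congr 1
      have h3 : (2 : ℝ≥0∞)⁻¹ = ENNReal.ofReal (1 / 2) := by
        rw [one_div, ENNReal.ofReal_inv_of_pos (by norm_num)]; simp
      rw [h3, ← ENNReal.ofReal_mul (by positivity)]
      congr 1
      rw [Real.div_rpow h1.le (by norm_num), Real.rpow_sub (by norm_num), Real.rpow_neg (by norm_num),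
        Real.rpow_one]
      field_simp
    · rw [← ENNReal.ofReal_mul (by positivity)]
      refine ENNReal.ofReal_le_ofReal ?_
      gcongr
      linarith
    · rw [← mul_assoc, ← ENNReal.ofReal_mul (by positivity)]
      congr 2
      rw [Real.div_rpow h1.le (by norm_num), Real.rpow_neg h1.le, Real.rpow_neg (by norm_num)]
      have : t ^ N ≠ 0 := by positivity
      field_simp

end

/-! ### The reverse Hölder inequality for the gradient -/

section

open Filter Topology
variable {n : ℕ}

/-- The reverse Hölder inequality for the gradient of a solution, on boxes: the Caccioppoli
estimate, the local `L^1`-`L^p` estimate and the Poincaré inequality combined. The last one is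
applied to the box of radius `4 ρ` and needs the box of radius `78 * 4 ρ`. -/
lemma exists_boxNorm_grad_le (n : ℕ) [NeZero n] {p l L : ℝ} (hp : 2 ≤ p) (hl : 0 < l)
    (hL : 0 ≤ L) :
    ∃ C : ℝ, 0 ≤ C ∧ ∀ {s : ℝ}, 0 ≤ s → ∀ {U : Set (Pt n)} {A : Pt n → Hor n} {w : Pt n → ℝ}
      {Dw : Pt n → Hor n}, IsCoerciveSolution p l L s U A w Dw → ∀ (y : Pt n) (ρ : ℝ),
      0 < ρ → cbox y (312 * ρ) ⊆ U →
      ENNReal.ofReal (ρ ^ nashExp n p) * boxNorm p Dw y ρ ≤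
        ENNReal.ofReal C * ∫⁻ x in cbox y (312 * ρ), (‖Dw x‖ₑ + ENNReal.ofReal s) := by
  have hp0 : 0 < p := by linarith
  have hp1 : 1 ≤ p := by linarith
  obtain ⟨Cc, hCc, hcut⟩ := exists_cutoff_rpow n hp1
  obtain ⟨K, hK, hloc⟩ := exists_boxNorm_le n hp hl hL
  have hb := boxVol_pos n
  have hcac := cacConst_pos (p := p) hl hL
  set N := nashExp n p with hN
  have hN0 : 0 ≤ N := nashExp_nonneg n hp1
  set C₁ := cacConst p l L ^ (1 / p) with hC₁
  set T := (boxVol n * 4 ^ homDim n) ^ (1 / p) with hT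
  set c₃ : ℝ := 74 * 2 ^ homDim n * 4 with hc₃
  have hT0 : 0 ≤ T := by positivity
  set T' := T / (boxVol n * 312 ^ homDim n) with hT'
  have hT'0 : 0 ≤ T' := by positivity
  refine ⟨C₁ * (T' + Cc * (2 * (2 ^ N * 2 * T' + K * c₃))), by positivity, ?_⟩
  intro s hs U A w Dw h y ρ hρ hρU
  obtain ⟨c, hc⟩ := (h.memHW.one hp1 h.volume_ne_top).exists_poincare h.isOpen y
    (r := 4 * ρ) (by positivity) (by convert hρU using 2; ring)
  obtain ⟨θ, hθ, hθ1, hθ0, hθle, hθg⟩ := hcut y ρ (2 * ρ) hρ (by linarith)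
  have e2 : 2 * ρ - ρ = ρ := by ring
  rw [e2] at hθg
  have h2U : cbox y (2 * ρ) ⊆ U := (cbox_mono y (by linarith)).trans hρU
  have h4U : cbox y (4 * ρ) ⊆ U := (cbox_mono y (by linarith)).trans hρU
  have hΛ : 0 ≤ Cc / ρ := by positivity
  have hcacc := h.caccioppoli hp hl hL hs (isOpen_cbox y (2 * ρ)) h2U hθ hθ0 hθle hΛ hθg c
  set I := ∫⁻ x in cbox y (312 * ρ), (‖Dw x‖ₑ + ENNReal.ofReal s) with hI
  set Φ := boxNorm p (fun x => w x - c) y (2 * ρ) with hΦ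
  have hE : boxNorm p Dw y ρ ≤ ENNReal.ofReal C₁ *
      (ENNReal.ofReal (s * (boxVol n * (2 * ρ) ^ homDim n) ^ (1 / p)) +
        ENNReal.ofReal (Cc / ρ) * Φ) := by
    refine le_trans ?_ (rpow_one_div_le_of_lintegral hp1 hs hΛ hcac.le (fun x => w x - c)
      (by positivity) (volume_cbox y (by positivity : 0 < 2 * ρ)))
    refine ENNReal.rpow_le_rpow (le_trans ?_ hcacc) (by positivity)
    rw [← lintegral_indicator (isOpen_cbox y ρ).measurableSet,
      ← lintegral_indicator (isOpen_cbox y (2 * ρ)).measurableSet]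
    refine lintegral_mono fun x => ?_
    by_cases hx : x ∈ cbox y ρ
    · have hx' := cbox_mono y (by linarith : ρ ≤ 2 * ρ) hx
      simp only [hx, hx', indicator_of_mem, hθ1 x hx, one_mul]
      rw [← ofReal_norm, ENNReal.ofReal_rpow_of_nonneg (norm_nonneg _) hp0.le]
    · simp [hx]
  have hm : ∫⁻ x in cbox y (4 * ρ), ‖w x - c‖ₑ ≤ ENNReal.ofReal (c₃ * ρ) * I := by
    refine hc.trans ?_
    have e3 : 74 * 2 ^ homDim n * (4 * ρ) = c₃ * ρ := by rw [hc₃]; ring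
    rw [e3]
    gcongr
    refine (lintegral_mono_set (cbox_mono y (by linarith : 77 * (4 * ρ) ≤ 312 * ρ))).trans ?_
    exact lintegral_mono fun x => le_self_add
  have hsI : ENNReal.ofReal (s * (boxVol n * (312 * ρ) ^ homDim n)) ≤ I := by
    have h1 : ∫⁻ x in cbox y (312 * ρ), ENNReal.ofReal s ≤ I :=
      lintegral_mono fun x => le_add_self
    rwa [lintegral_const, Measure.restrict_apply_univ, volume_cbox y (by positivity),
      ← ENNReal.ofReal_mul hs] at h1
  have hpow : ρ ^ N * (boxVol n * (4 * ρ) ^ homDim n) ^ (1 / p) =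
      T' * (boxVol n * (312 * ρ) ^ homDim n) := by
    have h1 : ρ ^ N * ((ρ ^ homDim n : ℝ)) ^ (1 / p) = ρ ^ homDim n := by
      rw [← Real.rpow_natCast, ← Real.rpow_mul hρ.le, ← Real.rpow_add hρ, hN, nashExp]
      congr 1; field_simp; ring
    rw [mul_pow, ← mul_assoc, Real.mul_rpow (by positivity) (by positivity), ← hT, mul_left_comm,
      h1, hT', mul_pow]
    field_simp
  have hterm : ∀ r, 0 ≤ r → r ≤ 4 * ρ → ENNReal.ofReal (ρ ^ N *
      (s * (boxVol n * r ^ homDim n) ^ (1 / p))) ≤ ENNReal.ofReal T' * I := by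
    intro r hr0 hr
    refine (ENNReal.ofReal_le_ofReal ?_).trans
      ((ENNReal.ofReal_mul hT'0).le.trans (mul_le_mul_right hsI _))
    calc ρ ^ N * (s * (boxVol n * r ^ homDim n) ^ (1 / p))
        ≤ ρ ^ N * (s * (boxVol n * (4 * ρ) ^ homDim n) ^ (1 / p)) := by gcongr
      _ = s * (ρ ^ N * (boxVol n * (4 * ρ) ^ homDim n) ^ (1 / p)) := by ring
      _ = _ := by rw [hpow]; ring
  have hΦ2 : ENNReal.ofReal (ρ ^ N) * Φ ≤
      ENNReal.ofReal (2 * (2 ^ N * 2 * T' + K * c₃) * ρ) * I := by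
    have h1 := hloc hs h y c (2 * ρ) (by positivity) (by convert h4U using 2; ring)
    have e4 : 2 * (2 * ρ) = 4 * ρ := by ring
    rw [e4, ← hΦ] at h1
    refine le_trans (mul_le_mul_left (ENNReal.ofReal_le_ofReal ?_) _) (h1.trans ?_)
    · gcongr; linarith
    have e5 : ENNReal.ofReal ((2 * ρ) ^ N *
        (2 * ρ * (s * (boxVol n * (4 * ρ) ^ homDim n) ^ (1 / p)))) ≤
          ENNReal.ofReal (2 ^ N * 2 * T' * ρ) * I := by
      rw [Real.mul_rpow (by norm_num) hρ.le]
      have e6 : 2 ^ N * ρ ^ N * (2 * ρ * (s * (boxVol n * (4 * ρ) ^ homDim n) ^ (1 / p))) =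
          (2 ^ N * 2 * ρ) * (ρ ^ N * (s * (boxVol n * (4 * ρ) ^ homDim n) ^ (1 / p))) := by ring
      have e7 : 2 ^ N * 2 * T' * ρ = (2 ^ N * 2 * ρ) * T' := by ring
      rw [e6, e7, ENNReal.ofReal_mul (p := 2 ^ N * 2 * ρ) (by positivity),
        ENNReal.ofReal_mul (p := 2 ^ N * 2 * ρ) (by positivity),
        mul_assoc (ENNReal.ofReal (2 ^ N * 2 * ρ))]
      exact mul_le_mul_right (hterm (4 * ρ) (by positivity) le_rfl) _
    have e8 : ENNReal.ofReal K * ∫⁻ x in cbox y (4 * ρ), ‖w x - c‖ₑ ≤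
        ENNReal.ofReal (K * c₃ * ρ) * I := by
      rw [mul_assoc K, ENNReal.ofReal_mul hK, mul_assoc]
      gcongr
    refine (mul_le_mul_right (add_le_add e5 e8) _).trans (le_of_eq ?_)
    rw [← add_mul, ← ENNReal.ofReal_add (by positivity) (by positivity), ← mul_assoc]
    congr 1
    rw [show (2 : ℝ≥0∞) = ENNReal.ofReal 2 by simp, ← ENNReal.ofReal_mul (by norm_num)]
    congr 1; ring
  calc ENNReal.ofReal (ρ ^ N) * boxNorm p Dw y ρ
      ≤ ENNReal.ofReal (ρ ^ N) * (ENNReal.ofReal C₁ *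
        (ENNReal.ofReal (s * (boxVol n * (2 * ρ) ^ homDim n) ^ (1 / p)) +
        ENNReal.ofReal (Cc / ρ) * Φ)) := by gcongr
    _ = ENNReal.ofReal C₁ * (ENNReal.ofReal (ρ ^ N * (s * (boxVol n * (2 * ρ) ^ homDim n) ^ (1 / p)))
        + ENNReal.ofReal (Cc / ρ) * (ENNReal.ofReal (ρ ^ N) * Φ)) := by
        rw [ENNReal.ofReal_mul (p := ρ ^ N) (by positivity)]; ring
    _ ≤ ENNReal.ofReal C₁ * (ENNReal.ofReal T' * I + ENNReal.ofReal (Cc / ρ) *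
        (ENNReal.ofReal (2 * (2 ^ N * 2 * T' + K * c₃) * ρ) * I)) := by
        gcongr
        exact hterm (2 * ρ) (by positivity) (by linarith)
    _ = _ := by
        rw [← mul_assoc (ENNReal.ofReal (Cc / ρ)), ← ENNReal.ofReal_mul hΛ, ← add_mul,
          ← ENNReal.ofReal_add hT'0 (by positivity), ← mul_assoc,
          ← ENNReal.ofReal_mul (by positivity)]
        congr 3
        field_simp

/-- Averaging over the centres of the boxes turns a uniform local bound into a bound over a
larger set. This replaces a covering argument. -/
lemma volume_box_mul_lintegral_le {B D : Set (Pt n)} (hB : MeasurableSet B) (hD : MeasurableSet D)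
    {g : Pt n → ℝ≥0∞} (hg : AEMeasurable g (volume.restrict B)) {ρ : ℝ} (hρ : 0 < ρ) {M : ℝ≥0∞}
    (hBD : ∀ x ∈ B, cbox x ρ ⊆ D) (hM : ∀ y ∈ D, ∫⁻ x in cbox y ρ ∩ B, g x ≤ M) :
    volume (box n ρ) * ∫⁻ x in B, g x ≤ volume D * M := by
  have hgm : AEMeasurable (B.indicator g) volume := (aemeasurable_indicator_iff hB).2 hg
  set S : Set (Pt n × Pt n) := {q | mul (-q.2) q.1 ∈ box n ρ} with hS
  have hSm : MeasurableSet S :=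
    ((isOpen_box ρ).preimage (by fun_prop : Continuous fun q : Pt n × Pt n =>
      mul (-q.2) q.1)).measurableSet
  have hF : AEMeasurable (Function.uncurry fun x y : Pt n =>
      B.indicator g x * S.indicator 1 (x, y)) (volume.prod volume) :=
    (hgm.comp_quasiMeasurePreserving Measure.quasiMeasurePreserving_fst).mul
      ((measurable_const.indicator hSm).aemeasurable)
  have hSi : ∀ x y, S.indicator (1 : Pt n × Pt n → ℝ≥0∞) (x, y) =
      (cbox y ρ).indicator 1 x := fun x y => rfl
  have hSi' : ∀ x y, S.indicator (1 : Pt n × Pt n → ℝ≥0∞) (x, y) =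
      (cbox x ρ).indicator 1 y := fun x y => by
    rw [hSi]
    by_cases h : x ∈ cbox y ρ
    · simp [h, mem_cbox_comm.1 h]
    · have h' : y ∉ cbox x ρ := fun h' => h (mem_cbox_comm.1 h')
      simp [h, h']
  have h1 : ∫⁻ x, ∫⁻ y, B.indicator g x * S.indicator 1 (x, y) =
      volume (box n ρ) * ∫⁻ x in B, g x := by
    rw [← lintegral_indicator hB, ← lintegral_const_mul'' _ hgm]
    refine lintegral_congr fun x => ?_
    simp only [hSi']
    rw [lintegral_const_mul _ (measurable_one.indicator (isOpen_cbox x ρ).measurableSet),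
      lintegral_indicator_one (isOpen_cbox x ρ).measurableSet, volume_cbox x hρ, volume_box hρ,
      mul_comm]
  rw [← h1, lintegral_lintegral_swap hF]
  have h2 : ∀ y, ∫⁻ x, B.indicator g x * S.indicator 1 (x, y) ≤ D.indicator (fun _ => M) y := by
    intro y
    have h3 : ∫⁻ x, B.indicator g x * S.indicator 1 (x, y) = ∫⁻ x in cbox y ρ ∩ B, g x := by
      rw [← lintegral_indicator ((isOpen_cbox y ρ).measurableSet.inter hB)]
      refine lintegral_congr fun x => ?_
      rw [hSi]
      by_cases h : x ∈ cbox y ρ <;> by_cases h' : x ∈ B <;> simp [h, h']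
    rw [h3]
    by_cases hy : y ∈ D
    · simpa [hy] using hM y hy
    · have h4 : cbox y ρ ∩ B = ∅ := by
        by_contra hne
        obtain ⟨x, hx1, hx2⟩ := nonempty_iff_ne_empty.2 hne
        exact hy (hBD x hx2 (mem_cbox_comm.1 hx1))
      simp [h4]
  refine (lintegral_mono h2).trans ?_
  rw [lintegral_indicator hD, lintegral_const, Measure.restrict_apply_univ, mul_comm]

lemma cbox_subset_ccBall_of_mem [NeZero n] {x₀ y : Pt n} {R ρ t : ℝ} (hy : y ∈ ccBall x₀ R)
    (h : R + 38 * ρ ≤ t) : cbox y ρ ⊆ ccBall x₀ t := fun _ hz =>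
  (ccDist_triangle_lt hy (cbox_subset_ccBall y ρ hz)).trans_le h

/-- The reverse Hölder inequality for the gradient of a solution, on Carnot-Carathéodory
balls. -/
lemma exists_reverse_holder (n : ℕ) [NeZero n] {p l L : ℝ} (hp : 2 ≤ p) (hl : 0 < l)
    (hL : 0 ≤ L) :
    ∃ C : ℝ, 0 ≤ C ∧ ∀ {s : ℝ}, 0 ≤ s → ∀ {A : Pt n → Hor n} {w : Pt n → ℝ}
      {Dw : Pt n → Hor n} (x₀ : Pt n) (R : ℝ), 0 < R →
      IsCoerciveSolution p l L s (ccBall x₀ (2 * R)) A w Dw →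
      ENNReal.ofReal (R ^ nashExp n p) * (∫⁻ x in ccBall x₀ R, ‖Dw x‖ₑ ^ p) ^ (1 / p) ≤
        ENNReal.ofReal C * ∫⁻ x in ccBall x₀ (2 * R), (‖Dw x‖ₑ + ENNReal.ofReal s) := by
  have hp0 : 0 < p := by linarith
  have hp1 : 1 ≤ p := by linarith
  obtain ⟨C, hC, hbox⟩ := exists_boxNorm_grad_le n hp hl hL
  set N := nashExp n p with hN
  have hN0 : 0 ≤ N := nashExp_nonneg n hp1
  have hb := boxVol_pos n
  refine ⟨((32000 : ℝ) ^ homDim n) ^ (1 / p) * (16000 ^ N * C), by positivity, ?_⟩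
  intro s hs A w Dw x₀ R hR h
  -- The box of radius `312 ρ` about a point of `ccBall x₀ (R + 38 ρ)` stays in `ccBall x₀ (2 R)`,
  -- because `38 + 38 * 312 ≤ 16000`.
  set ρ := R / 16000 with hρ
  have hρ0 : 0 < ρ := by positivity
  have hR' : R = 16000 * ρ := by rw [hρ]; ring
  set I := ∫⁻ x in ccBall x₀ (2 * R), (‖Dw x‖ₑ + ENNReal.ofReal s) with hI
  set J := ∫⁻ x in ccBall x₀ R, ‖Dw x‖ₑ ^ p with hJ
  have hsub : ccBall x₀ R ⊆ ccBall x₀ (2 * R) := fun x hx => by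
    have h1 : ccDist x₀ x < R := hx
    exact h1.trans (by linarith)
  have hM : ∀ y ∈ ccBall x₀ (R + 38 * ρ), ∫⁻ x in cbox y ρ ∩ ccBall x₀ R, ‖Dw x‖ₑ ^ p ≤
      (ENNReal.ofReal (ρ ^ (-N) * C) * I) ^ p := by
    intro y hy
    have h1 : cbox y (312 * ρ) ⊆ ccBall x₀ (2 * R) :=
      cbox_subset_ccBall_of_mem hy (by rw [hR']; linarith)
    have h2 := hbox hs h y ρ hρ0 h1
    have h3 : boxNorm p Dw y ρ ≤ ENNReal.ofReal (ρ ^ (-N) * C) * I := by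
      have h4 := mul_le_mul_right h2 (ENNReal.ofReal (ρ ^ (-N)))
      rw [← mul_assoc, ← ENNReal.ofReal_mul (by positivity), ← Real.rpow_add hρ0, neg_add_cancel,
        Real.rpow_zero, ENNReal.ofReal_one, one_mul, ← mul_assoc,
        ← ENNReal.ofReal_mul (by positivity)] at h4
      exact h4.trans (mul_le_mul_right (lintegral_mono_set h1) _)
    have h5 := ENNReal.rpow_le_rpow h3 hp0.le
    rw [boxNorm, ← ENNReal.rpow_mul, one_div_mul_cancel hp0.ne', ENNReal.rpow_one] at h5
    exact (lintegral_mono_set inter_subset_left).trans h5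
  have hmeas : AEMeasurable (fun x => ‖Dw x‖ₑ ^ p) (volume.restrict (ccBall x₀ R)) :=
    ((h.memHW.2.1.mono_measure (Measure.restrict_mono hsub le_rfl)).1.enorm).pow_const p
  have havg := volume_box_mul_lintegral_le (measurableSet_ccBall x₀ R)
    (measurableSet_ccBall x₀ (R + 38 * ρ)) hmeas hρ0
    (fun x hx => cbox_subset_ccBall_of_mem hx le_rfl) hM
  have hvD : volume (ccBall x₀ (R + 38 * ρ)) ≤
      volume (box n ρ) * ENNReal.ofReal (32000 ^ homDim n) := by
    refine (volume_ccBall_le x₀ (by positivity)).trans ?_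
    rw [volume_box hρ0, ← ENNReal.ofReal_mul (by positivity)]
    refine ENNReal.ofReal_le_ofReal ?_
    rw [mul_assoc, ← mul_pow]
    gcongr
    rw [hR']; linarith
  have hJle : J ≤ ENNReal.ofReal (32000 ^ homDim n) * (ENNReal.ofReal (ρ ^ (-N) * C) * I) ^ p := by
    have h1 := havg.trans (mul_le_mul_left hvD _)
    rw [mul_assoc] at h1
    exact (ENNReal.mul_le_mul_iff_right (volume_box_ne_zero hρ0) (volume_box_ne_top hρ0)).1 h1
  have h2 := ENNReal.rpow_le_rpow hJle (show 0 ≤ 1 / p by positivity)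
  rw [ENNReal.mul_rpow_of_nonneg _ _ (by positivity), ← ENNReal.rpow_mul,
    mul_one_div_cancel hp0.ne', ENNReal.rpow_one, ENNReal.ofReal_rpow_of_nonneg (by positivity)
    (by positivity), ← mul_assoc, ← ENNReal.ofReal_mul (by positivity)] at h2
  refine (mul_le_mul_right h2 _).trans (le_of_eq ?_)
  rw [← mul_assoc, ← ENNReal.ofReal_mul (by positivity)]
  congr 2
  rw [hR', Real.mul_rpow (by norm_num) hρ0.le, Real.rpow_neg hρ0.le]
  have : ρ ^ N ≠ 0 := by positivity
  field_simp

end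

/-! ### Decay of level sets under truncated energy bounds -/

section

open Filter Topology
variable {n : ℕ}

/-- Hölder's inequality against the constant function one. -/
lemma lintegral_le_rpow_mul_measure {X : Type*} [MeasurableSpace X] {ν : Measure X} {p : ℝ}
    (hp : 1 < p) {f : X → ℝ≥0∞} (hf : AEMeasurable f ν) :
    ∫⁻ x, f x ∂ν ≤ (∫⁻ x, f x ^ p ∂ν) ^ (1 / p) * ν univ ^ ((p - 1) / p) := by
  have h := ENNReal.lintegral_mul_le_Lp_mul_Lq ν (Real.HolderConjugate.conjExponent hp) hf
    (aemeasurable_const (b := (1 : ℝ≥0∞)))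
  simpa [Real.conjExponent] using h

/-- The Poincaré inequality with zero boundary values: a limit of test functions in a bounded set is
moved off its support by a right translation, and is close to its translates. -/
lemma TestLimit.lintegral_rpow_le [NeZero n] {p : ℝ} (hp : 1 ≤ p) {U : Set (Pt n)}
    (hU : MeasurableSet U) {φ : ℕ → Pt n → ℝ} {f : Pt n → ℝ} {F : Pt n → Hor n}
    (h : TestLimit p U φ f F) {x₀ : Pt n} {r : ℝ} (hr : 0 < r) (hUr : U ⊆ cbox x₀ r) :
    ∫⁻ x, ‖U.indicator f x‖ₑ ^ p ≤ ENNReal.ofReal (111 * r) ^ p * ∫⁻ x in U, ‖F x‖ₑ ^ p := by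
  have hp0 : 0 < p := by linarith
  set g : Pt n := (EuclideanSpace.single (Sum.inl 0) (2 * r), 0) with hg
  have hgn : ‖g.1‖ = 2 * r := by simp [hg, abs_of_pos hr]
  have hgb : g ∈ box n (3 * r) := by
    rw [mem_box, hgn]
    refine ⟨by linarith, ?_⟩
    simp only [hg, abs_zero]; positivity
  have h1 := h.lintegral_translate_le hp hU hgb
  have e : 37 * (3 * r) = 111 * r := by ring
  rw [e] at h1
  refine (lintegral_mono fun x => ?_).trans h1
  by_cases hx : x ∈ U
  · have hx' : mul x g ∉ U := by
      intro hx'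
      have h2 := (mem_cbox.1 (hUr hx)).1
      have h3 := (mem_cbox.1 (hUr hx')).1
      have h4 : g.1 = (mul (-x₀) (mul x g)).1 - (mul (-x₀) x).1 := by simp
      have h5 := norm_sub_le (mul (-x₀) (mul x g)).1 (mul (-x₀) x).1
      rw [← h4, hgn] at h5
      linarith
    simp [hx, hx']
  · simp [hx, hp0]

lemma half_lt_abs_trunc {k t : ℝ} (hk : 0 < k) (h : k < |t|) : k / 2 < |trunc k t| := by
  have h1 : ∀ t, k < t → k / 2 < trunc k t := fun t ht => by
    have h2 : 1 < t / k := by rwa [lt_div_iff₀ hk, one_mul]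
    have h3 := Real.arctan_strictMono h2
    rw [Real.arctan_one] at h3
    have h4 : 1 / 2 < Real.arctan (t / k) := by linarith [Real.pi_gt_three]
    unfold trunc
    nlinarith
  rcases lt_abs.1 h with h2 | h2
  · exact (h1 t h2).trans_le (le_abs_self _)
  · have h3 := h1 (-t) h2
    have h4 : trunc k (-t) = -trunc k t := by
      unfold trunc; rw [neg_div, Real.arctan_neg]; ring
    rw [h4] at h3
    exact h3.trans_le (neg_le_abs _)

lemma half_le_trunc' {k t : ℝ} (hk : 0 < k) (h : |t| ≤ k) : 1 / 2 ≤ trunc' k t := by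
  unfold trunc'
  have h1 : (t / k) ^ 2 ≤ 1 := by
    rw [sq_le_one_iff_abs_le_one, abs_div, abs_of_pos hk, div_le_one hk]; exact h
  exact one_div_le_one_div_of_le (by positivity) (by linarith)

/-- The exponent of decay of the level sets. -/
def levelExp (n : ℕ) (p : ℝ) : ℝ := (1 - p) * (1 + p / homDim n)

/-- The measure of the level sets of `g`, if the energy of each truncation of `g` is bounded by a
multiple of the height of the truncation. The weak type estimate for the truncation at the height
of the level takes the place of the Sobolev inequality. -/
lemma exists_volume_level_le (n : ℕ) [NeZero n] {p : ℝ} (hp : 2 ≤ p) :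
    ∃ C : ℝ, 0 ≤ C ∧ ∀ {U : Set (Pt n)}, MeasurableSet U → ∀ {x₀ : Pt n} {r : ℝ}, 0 < r →
      U ⊆ cbox x₀ r → ∀ {φ : ℕ → Pt n → ℝ} {g : Pt n → ℝ} {G : Pt n → Hor n},
      TestLimit p U φ g G → ∀ {k₀ : ℝ}, 0 < k₀ →
      (∀ k, 0 < k → ∫⁻ x in U, ENNReal.ofReal (trunc' k (g x) * ‖G x‖ ^ p) ≤
        ENNReal.ofReal (k * (k₀ ^ (p - 1) * r ^ (homDim n - p)))) →
      ∀ t, 0 < t → volume.restrict U {x | t * k₀ < |g x|} ≤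
        ENNReal.ofReal (C * t ^ levelExp n p * r ^ (homDim n : ℝ)) := by
  have hp0 : 0 < p := by linarith
  have hp1 : 1 ≤ p := by linarith
  have hb := boxVol_pos n
  have hQ : (0 : ℝ) < homDim n := by unfold homDim; positivity
  refine ⟨148 ^ p * (444 ^ p / boxVol n) ^ (p / homDim n), by positivity, ?_⟩
  intro U hU x₀ r hr hUr φ g G h k₀ hk₀ hE t ht
  set k := t * k₀ with hk
  have hk0 : 0 < k := by positivity
  set m := k₀ ^ (p - 1) * r ^ (homDim n - p) with hm
  have hm0 : 0 < m := by positivity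
  obtain ⟨ns, hns, hae⟩ := h.exists_ae_tendsto hp0
  have hT := (h.comp_subseq hns).trunc hp1 hae hk0
  set f : Pt n → ℝ := fun x => trunc k (g x) with hf
  have hEn : ∫⁻ x in U, ‖trunc' k (g x) • G x‖ₑ ^ p ≤ ENNReal.ofReal (k * m) := by
    refine le_trans (lintegral_mono fun x => ?_) (hE k hk0)
    rw [← ofReal_norm, ENNReal.ofReal_rpow_of_nonneg (norm_nonneg _) hp0.le]
    refine ENNReal.ofReal_le_ofReal ?_
    have h0 := trunc'_nonneg k (g x)
    rw [norm_smul, Real.norm_of_nonneg h0, Real.mul_rpow h0 (norm_nonneg _)]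
    gcongr
    conv_rhs => rw [← Real.rpow_one (trunc' k (g x))]
    exact Real.rpow_le_rpow_of_exponent_ge' h0 (trunc'_le_one _ _) zero_le_one hp1
  -- With this `η` the Poincaré inequality bounds the `L^p` means of the truncation over boxes of
  -- radius `r * η` by `k / 4`.
  set η := (444 ^ p * t ^ (1 - p) / boxVol n) ^ (1 / (homDim n : ℝ)) with hη
  have hη0 : 0 < η := by positivity
  have hηQ : boxVol n * η ^ homDim n = 444 ^ p * t ^ (1 - p) := by
    rw [hη, ← Real.rpow_natCast, ← Real.rpow_mul (by positivity), one_div_mul_cancel hQ.ne',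
      Real.rpow_one]
    field_simp
  have hrQ : r ^ p * r ^ (homDim n - p) = r ^ homDim n := by
    rw [← Real.rpow_add hr, ← Real.rpow_natCast]; congr 1; ring
  have hkp : t ^ (1 - p) * k ^ p = k * k₀ ^ (p - 1) := by
    have h1 : k ^ p = k * k ^ (p - 1) := by
      rw [← Real.rpow_one_add' hk0.le (by linarith)]; congr 1; ring
    rw [h1, hk, Real.mul_rpow ht.le hk₀.le]
    have h2 : t ^ (1 - p) * t ^ (p - 1) = 1 := by
      rw [← Real.rpow_add ht]; simp
    linear_combination t * k₀ * k₀ ^ (p - 1) * h2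
  have hfm : AEStronglyMeasurable (U.indicator f) volume :=
    ((memLp_indicator_iff_restrict hU).2 hT.memLp).1
  have hweak := weak_type_of_translate hfm (mul_pos hr hη0) hp1
    (N := ENNReal.ofReal (37 * (r * η)) ^ p * ENNReal.ofReal (k * m)) (t := ENNReal.ofReal (k / 4))
    (fun g hg => (hT.lintegral_translate_le hp1 hU hg).trans (by gcongr)) ENNReal.ofReal_ne_top
    (by
      rw [ENNReal.inv_mul_le_iff (volume_box_ne_zero (mul_pos hr hη0))
        (volume_box_ne_top (mul_pos hr hη0)), volume_box (mul_pos hr hη0),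
        ENNReal.ofReal_rpow_of_pos (by positivity), ← ENNReal.ofReal_mul (by positivity)]
      refine (hT.lintegral_rpow_le hp1 hU hr hUr).trans ((mul_le_mul_right hEn _).trans ?_)
      rw [ENNReal.ofReal_rpow_of_pos (by positivity), ← ENNReal.ofReal_mul (by positivity)]
      refine ENNReal.ofReal_le_ofReal (le_of_eq ?_)
      have e4 : (444 : ℝ) ^ p = 111 ^ p * 4 ^ p := by
        rw [← Real.mul_rpow (by norm_num) (by norm_num)]; norm_num
      have e5 : (0 : ℝ) < 4 ^ p := by positivity
      rw [mul_pow, mul_left_comm (boxVol n), hηQ, Real.div_rpow hk0.le (by norm_num),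
        Real.mul_rpow (by norm_num) hr.le, e4, hm]
      field_simp
      linear_combination k * k₀ ^ (p - 1) * hrQ - r ^ homDim n * hkp)
  have hsub : {x | t * k₀ < |g x|} ∩ U ⊆ {x | 2 * ENNReal.ofReal (k / 4) < ‖U.indicator f x‖ₑ} := by
    rintro x ⟨hx, hxU⟩
    have h1 := half_lt_abs_trunc hk0 hx
    simp only [mem_ofPred_eq, hxU, indicator_of_mem]
    rw [Real.enorm_eq_ofReal_abs, show (2 : ℝ≥0∞) = ENNReal.ofReal 2 by simp,
      ← ENNReal.ofReal_mul (by norm_num), ENNReal.ofReal_lt_ofReal_iff_of_nonneg (by positivity)]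
    rw [hf]; dsimp only; linarith
  rw [Measure.restrict_apply' hU]
  refine (measure_mono hsub).trans ?_
  have hk4 : ENNReal.ofReal (k / 4) ^ p ≠ 0 := by
    rw [ENNReal.ofReal_rpow_of_pos (by positivity)]
    exact (ENNReal.ofReal_pos.2 (by positivity)).ne'
  have hk4' : ENNReal.ofReal (k / 4) ^ p ≠ ∞ :=
    ENNReal.rpow_ne_top_of_nonneg hp0.le ENNReal.ofReal_ne_top
  rw [← ENNReal.mul_le_mul_iff_right hk4 hk4']
  refine hweak.trans (le_of_eq ?_)
  rw [ENNReal.ofReal_rpow_of_pos (by positivity), ENNReal.ofReal_rpow_of_pos (by positivity),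
    ← ENNReal.ofReal_mul (by positivity), ← ENNReal.ofReal_mul (by positivity)]
  congr 1
  have e1 : η ^ p = (444 ^ p / boxVol n) ^ (p / homDim n) * t ^ ((1 - p) * (p / homDim n)) := by
    rw [hη, ← Real.rpow_mul (by positivity), mul_div_right_comm,
      Real.mul_rpow (by positivity) (by positivity), ← Real.rpow_mul ht.le, one_div_mul_eq_div]
  have e2 : t ^ levelExp n p = t ^ (1 - p) * t ^ ((1 - p) * (p / homDim n)) := by
    rw [← Real.rpow_add ht, levelExp]; congr 1; ring
  have e4 : (148 : ℝ) ^ p = 37 ^ p * 4 ^ p := by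
    rw [← Real.mul_rpow (by norm_num) (by norm_num)]; norm_num
  have e5 : (0 : ℝ) < 4 ^ p := by positivity
  rw [e2, e4, Real.mul_rpow (by norm_num) (by positivity), Real.mul_rpow hr.le hη0.le, e1,
    Real.div_rpow hk0.le (by norm_num), Real.rpow_natCast, hm]
  set T := t ^ ((1 - p) * (p / homDim n))
  set W := (444 ^ p / boxVol n) ^ (p / homDim n)
  field_simp
  linear_combination W * T * (k * k₀ ^ (p - 1) * hrQ - r ^ homDim n * hkp)

end

/-! ### Dyadic shells and the energy of truncations -/

section

open Filter Topology
variable {n : ℕ}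

/-- On a set where `|g| ≤ κ` the truncation at height `κ` does not degenerate, and Hölder's
inequality bounds the integral of the gradient by the energy and the measure of the set. -/
lemma lintegral_shell_le {p : ℝ} (hp : 2 ≤ p) {U S : Set (Pt n)} {g : Pt n → ℝ} {G : Pt n → Hor n}
    (hG : AEStronglyMeasurable G (volume.restrict U))
    (hS : NullMeasurableSet S (volume.restrict U)) {m κ V : ℝ} (hm : 0 ≤ m) (hκ : 0 < κ)
    (hV : 0 ≤ V) (hE : ∫⁻ x in U, ENNReal.ofReal (trunc' κ (g x) * ‖G x‖ ^ p) ≤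
      ENNReal.ofReal (κ * m)) (hSκ : ∀ x ∈ S, |g x| ≤ κ)
    (hSV : volume.restrict U S ≤ ENNReal.ofReal V) :
    ∫⁻ x in S, ‖G x‖ₑ ∂(volume.restrict U) ≤
      ENNReal.ofReal ((2 * κ * m) ^ (1 / p) * V ^ ((p - 1) / p)) := by
  have hp0 : 0 < p := by linarith
  have hp1 : 0 ≤ (p - 1) / p := div_nonneg (by linarith) hp0.le
  refine (lintegral_le_rpow_mul_measure (by linarith : 1 < p) (hG.enorm.mono_measure
    Measure.restrict_le_self)).trans ?_
  rw [Measure.restrict_apply_univ, ENNReal.ofReal_mul (by positivity),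
    ← ENNReal.ofReal_rpow_of_nonneg (by positivity) (by positivity),
    ← ENNReal.ofReal_rpow_of_nonneg hV hp1]
  refine mul_le_mul' (ENNReal.rpow_le_rpow ?_ (by positivity)) (ENNReal.rpow_le_rpow hSV hp1)
  have h1 : ∫⁻ x in S, ‖G x‖ₑ ^ p ∂(volume.restrict U) ≤
      ∫⁻ x in S, ENNReal.ofReal 2 * ENNReal.ofReal (trunc' κ (g x) * ‖G x‖ ^ p)
        ∂(volume.restrict U) := by
    refine lintegral_mono_ae ?_
    filter_upwards [ae_restrict_mem₀ hS] with x hx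
    rw [← ENNReal.ofReal_mul (by norm_num), ← ofReal_norm,
      ENNReal.ofReal_rpow_of_nonneg (norm_nonneg _) hp0.le]
    refine ENNReal.ofReal_le_ofReal ?_
    have h2 := half_le_trunc' hκ (hSκ x hx)
    have h3 : 0 ≤ ‖G x‖ ^ p := by positivity
    nlinarith
  refine h1.trans ?_
  rw [lintegral_const_mul' _ _ ENNReal.ofReal_ne_top, mul_assoc, ENNReal.ofReal_mul (by norm_num)]
  gcongr
  exact (lintegral_mono' Measure.restrict_le_self le_rfl).trans hE

/-- The exponent of decay of the gradient integrals over dyadic shells. It is negative because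
`p ≥ 2`. -/
def shellExp (n : ℕ) (p : ℝ) : ℝ := 1 / p + levelExp n p * ((p - 1) / p)

lemma shellExp_neg (n : ℕ) {p : ℝ} (hp : 2 ≤ p) : shellExp n p < 0 := by
  have hQ : (0 : ℝ) < homDim n := by unfold homDim; positivity
  have h1 : 0 < p / homDim n := by positivity
  have e : shellExp n p = (1 - (p - 1) ^ 2 * (1 + p / homDim n)) / p := by
    unfold shellExp levelExp; ring
  rw [e]
  refine div_neg_of_neg_of_pos ?_ (by linarith)
  have h2 : 1 ≤ (p - 1) ^ 2 := by nlinarith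
  nlinarith [mul_pos (by linarith : 0 < (p - 1) ^ 2) h1]

lemma shell_const_eq (n : ℕ) {p : ℝ} (hp : 2 ≤ p) {r k₀ t V₀ : ℝ} (hr : 0 < r) (hk₀ : 0 < k₀)
    (ht : 0 < t) (hV₀ : 0 ≤ V₀) :
    (2 * (2 * t * k₀) * (k₀ ^ (p - 1) * r ^ (homDim n - p))) ^ (1 / p) *
      (V₀ * t ^ levelExp n p * r ^ (homDim n : ℝ)) ^ ((p - 1) / p) =
    4 ^ (1 / p) * V₀ ^ ((p - 1) / p) * k₀ * r ^ ((homDim n : ℝ) - 1) * t ^ shellExp n p := by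
  have hp0 : 0 < p := by linarith
  have e1 : 2 * (2 * t * k₀) * (k₀ ^ (p - 1) * r ^ (homDim n - p)) =
      4 * t * k₀ ^ p * r ^ (homDim n - p) := by
    have : k₀ ^ p = k₀ * k₀ ^ (p - 1) := by
      rw [← Real.rpow_one_add' hk₀.le (by linarith)]; congr 1; ring
    rw [this]; ring
  rw [e1, Real.mul_rpow (by positivity) (by positivity), Real.mul_rpow (by positivity)
    (by positivity), Real.mul_rpow (by positivity) (by positivity), Real.mul_rpow (by positivity)
    (by positivity), Real.mul_rpow (by positivity) (by positivity), ← Real.rpow_mul hk₀.le,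
    mul_one_div_cancel hp0.ne', Real.rpow_one, ← Real.rpow_mul hr.le, ← Real.rpow_mul hr.le,
    ← Real.rpow_mul ht.le]
  have e2 : r ^ ((homDim n : ℝ) - 1) = r ^ ((homDim n - p) * (1 / p)) *
      r ^ ((homDim n : ℝ) * ((p - 1) / p)) := by
    rw [← Real.rpow_add hr]; congr 1; field_simp; ring
  have e3 : t ^ shellExp n p = t ^ (1 / p) * t ^ (levelExp n p * ((p - 1) / p)) := by
    rw [← Real.rpow_add ht]; rfl
  rw [e2, e3]
  ring

/-- A bound for the gradient of `g` in `L^1`, if the energy of each truncation of `g` is bounded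
by a multiple of the height of the truncation. The estimates over the shells
`2 ^ j k₀ < |g| ≤ 2 ^ (j + 1) k₀` form a convergent geometric series. -/
lemma exists_lintegral_grad_le (n : ℕ) [NeZero n] {p : ℝ} (hp : 2 ≤ p) :
    ∃ C : ℝ, 0 ≤ C ∧ ∀ {U : Set (Pt n)}, MeasurableSet U → ∀ {x₀ : Pt n} {r : ℝ}, 0 < r →
      U ⊆ cbox x₀ r → ∀ {φ : ℕ → Pt n → ℝ} {g : Pt n → ℝ} {G : Pt n → Hor n},
      TestLimit p U φ g G → ∀ {k₀ : ℝ}, 0 < k₀ →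
      (∀ k, 0 < k → ∫⁻ x in U, ENNReal.ofReal (trunc' k (g x) * ‖G x‖ ^ p) ≤
        ENNReal.ofReal (k * (k₀ ^ (p - 1) * r ^ (homDim n - p)))) →
      ∫⁻ x in U, ‖G x‖ₑ ≤ ENNReal.ofReal (C * k₀ * r ^ ((homDim n : ℝ) - 1)) := by
  have hp0 : 0 < p := by linarith
  obtain ⟨C, hC, hlev⟩ := exists_volume_level_le n hp
  have hb := boxVol_pos n
  set V₀ := C + boxVol n with hV₀
  have hV₀0 : 0 ≤ V₀ := by positivity
  set C₀ := (4 : ℝ) ^ (1 / p) * V₀ ^ ((p - 1) / p) with hC₀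
  have hC₀0 : 0 ≤ C₀ := by positivity
  set q : ℝ := 2 ^ shellExp n p with hq
  have hq0 : 0 ≤ q := by positivity
  have hq1 : q < 1 := Real.rpow_lt_one_of_one_lt_of_neg (by norm_num) (shellExp_neg n hp)
  have hq1' : 0 < 1 - q := by linarith
  refine ⟨C₀ + C₀ * (1 - q)⁻¹, by positivity, ?_⟩
  intro U hU x₀ r hr hUr φ g G h k₀ hk₀ hE
  set ν := volume.restrict U with hν
  set B := C₀ * k₀ * r ^ ((homDim n : ℝ) - 1) with hB
  have hB0 : 0 ≤ B := by positivity
  have hgm : AEMeasurable (fun x => |g x|) ν := h.memLp.1.norm.aemeasurable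
  have hm0 : 0 ≤ k₀ ^ (p - 1) * r ^ (homDim n - p) := by positivity
  have key : ∀ (S : Set (Pt n)) (t κ : ℝ), NullMeasurableSet S ν → 0 < t → 0 < κ → κ ≤ 2 * t * k₀ →
      (∀ x ∈ S, |g x| ≤ κ) →
      ν S ≤ ENNReal.ofReal (V₀ * t ^ levelExp n p * r ^ (homDim n : ℝ)) →
      ∫⁻ x in S, ‖G x‖ₑ ∂ν ≤ ENNReal.ofReal (B * t ^ shellExp n p) := by
    intro S t κ hS ht hκ hκt hSκ hSV
    refine (lintegral_shell_le hp h.memLp_grad.1 hS hm0 hκ (by positivity) (hE κ hκ) hSκ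
      hSV).trans (ENNReal.ofReal_le_ofReal ?_)
    rw [hB, hC₀, ← shell_const_eq n hp hr hk₀ ht hV₀0]
    gcongr
  have h1 : ∫⁻ x in {x | |g x| ≤ k₀}, ‖G x‖ₑ ∂ν ≤ ENNReal.ofReal B := by
    have := key {x | |g x| ≤ k₀} 1 k₀ (hgm.nullMeasurable measurableSet_Iic) one_pos hk₀
      (by linarith) (fun x hx => hx) ?_
    · rwa [Real.one_rpow, mul_one] at this
    · refine (measure_mono (subset_univ _)).trans ?_
      rw [hν, Measure.restrict_apply_univ]
      refine (measure_mono hUr).trans ?_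
      rw [volume_cbox x₀ hr, Real.one_rpow, mul_one, Real.rpow_natCast]
      refine ENNReal.ofReal_le_ofReal ?_
      gcongr
      rw [hV₀]; linarith
  set S : ℕ → Set (Pt n) := fun j => {x | 2 ^ j * k₀ < |g x| ∧ |g x| ≤ 2 ^ (j + 1) * k₀} with hS
  have h2 : ∀ j : ℕ, ∫⁻ x in S j, ‖G x‖ₑ ∂ν ≤ ENNReal.ofReal (B * q ^ j) := by
    intro j
    have := key (S j) (2 ^ j) (2 ^ (j + 1) * k₀) (hgm.nullMeasurable measurableSet_Ioc)
      (by positivity) (by positivity) (le_of_eq (by ring)) (fun x hx => hx.2) ?_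
    · convert this using 3
      rw [hq, ← Real.rpow_natCast, ← Real.rpow_natCast, ← Real.rpow_mul (by norm_num),
        ← Real.rpow_mul (by norm_num), mul_comm]
    · refine (measure_mono (fun x hx => hx.1)).trans
        ((hlev hU hr hUr h hk₀ hE (2 ^ j) (by positivity)).trans (ENNReal.ofReal_le_ofReal ?_))
      gcongr
      rw [hV₀]; linarith
  have hcov : (univ : Set (Pt n)) ⊆ {x | |g x| ≤ k₀} ∪ ⋃ j, S j := by
    intro x _
    by_cases hx : |g x| ≤ k₀
    · exact Or.inl hx
    right
    have hex : ∃ J : ℕ, |g x| ≤ 2 ^ J * k₀ := by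
      obtain ⟨J, hJ⟩ := pow_unbounded_of_one_lt (|g x| / k₀) (by norm_num : (1 : ℝ) < 2)
      exact ⟨J, ((div_lt_iff₀ hk₀).1 hJ).le⟩
    classical
    obtain ⟨j, hj⟩ : ∃ j, Nat.find hex = j + 1 := by
      refine Nat.exists_eq_succ_of_ne_zero fun h0 => hx ?_
      have := Nat.find_spec hex
      rwa [h0, pow_zero, one_mul] at this
    have hspec := Nat.find_spec hex
    rw [hj] at hspec
    exact mem_iUnion.2 ⟨j, not_le.1 (Nat.find_min hex (by omega)), hspec⟩
  calc ∫⁻ x, ‖G x‖ₑ ∂ν = ∫⁻ x in univ, ‖G x‖ₑ ∂ν := by rw [Measure.restrict_univ]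
    _ ≤ ∫⁻ x in {x | |g x| ≤ k₀} ∪ ⋃ j, S j, ‖G x‖ₑ ∂ν := lintegral_mono_set hcov
    _ ≤ ∫⁻ x in {x | |g x| ≤ k₀}, ‖G x‖ₑ ∂ν + ∫⁻ x in ⋃ j, S j, ‖G x‖ₑ ∂ν :=
        lintegral_union_le _ _ _
    _ ≤ ENNReal.ofReal B + ∑' j, ENNReal.ofReal (B * q ^ j) := by
        refine add_le_add h1 ((lintegral_iUnion_le _ _).trans ?_)
        exact ENNReal.tsum_le_tsum h2
    _ = _ := by
        rw [← ENNReal.ofReal_tsum_of_nonneg (fun j => by positivity)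
          ((summable_geometric_of_lt_one hq0 hq1).mul_left B), tsum_mul_left,
          tsum_geometric_of_lt_one hq0 hq1, ← ENNReal.ofReal_add hB0 (by positivity), hB]
        congr 1; ring

lemma IsTest.abs_signedIntegral_le {U : Set (Pt n)} {φ : Pt n → ℝ}
    (hφ : IsTest U φ) {k : ℝ} (hk : ∀ x, |φ x| ≤ k) (μ : SignedMeasure (Pt n)) :
    |signedIntegral μ φ| ≤ k * (μ.totalVariation U).toReal := by
  have h1 : ∀ (ν : Measure (Pt n)) [IsFiniteMeasure ν], |∫ x, φ x ∂ν| ≤ k * (ν U).toReal := by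
    intro ν _
    rw [← setIntegral_eq_integral_of_forall_compl_eq_zero fun x hx => hφ.eq_zero hx]
    exact norm_setIntegral_le_of_norm_le_const (μ := ν) (C := k) (measure_lt_top ν U)
      fun x _ => by
        rw [Real.norm_eq_abs]; exact hk x
  unfold signedIntegral SignedMeasure.totalVariation
  rw [Measure.add_apply, ENNReal.toReal_add (measure_ne_top _ _) (measure_ne_top _ _), mul_add]
  exact (abs_sub _ _).trans (add_le_add (h1 _) (h1 _))

/-- The energy of the truncations of the difference of a solution of the measure data problem and
a solution of the homogeneous problem. The difference of the equations is tested with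
`trunc k (w - u)`, which is bounded by `2 k`. -/
lemma lintegral_trunc_energy_le {Ω : Set (Pt n)} {a : Pt n → Hor n → Hor n}
    {p L L' s α : ℝ} (h : StructureCondition Ω a p L L' s α) (hL : 0 ≤ L) (hp : 2 ≤ p)
    (hs : 0 ≤ s) (hΩ : IsOpen Ω) {U : Set (Pt n)} (hU : IsOpen U) (hUΩ : U ⊆ Ω)
    (hUf : volume U ≠ ∞) {x₀ : Pt n} (hx₀ : x₀ ∈ Ω) {μ : SignedMeasure (Pt n)}
    {u w : Pt n → ℝ} {Du Dw : Pt n → Hor n} (hu : IsWeakSolution p Ω a μ u Du)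
    (hw : IsWeakSolution p U a 0 w Dw) {φ : ℕ → Pt n → ℝ}
    (hφ : TestLimit p U φ (fun x => w x - u x) (fun x => Dw x - Du x)) {k : ℝ} (hk : 0 < k) :
    ∫⁻ x in U, ENNReal.ofReal (trunc' k (w x - u x) * ‖Dw x - Du x‖ ^ p) ≤
      ENNReal.ofReal (k * (2 / coerConst p * (μ.totalVariation U).toReal)) := by
  have hp0 : 0 < p := by linarith
  have hp1 : 1 < p := by linarith
  have hc := coerConst_pos p
  obtain ⟨ns, hns, hae⟩ := hφ.exists_ae_tendsto hp0
  have hT := (hφ.comp_subseq hns).trunc hp1.le hae hk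
  have hAw := h.memLp_sub hL hp hs hΩ hU.measurableSet hUΩ hUf hx₀ hw.1.2.1
  have hDu := hu.1.2.1.mono_measure (Measure.restrict_mono hUΩ le_rfl)
  have hAu := h.memLp_sub hL hp hs hΩ hU.measurableSet hUΩ hUf hx₀ hDu
  have hA : MemLp (fun x => a x (Dw x) - a x (Du x)) (ENNReal.ofReal (p / (p - 1)))
      (volume.restrict U) := (hAw.sub hAu).ae_eq (ae_of_all _ fun x => by simp)
  have hlim := hT.tendsto_integral_inner hp1 hA
  have hle : ∫ x in U, inner ℝ (a x (Dw x) - a x (Du x)) (trunc' k (w x - u x) • (Dw x - Du x)) ≤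
      2 * k * (μ.totalVariation U).toReal := by
    refine le_of_tendsto' hlim fun j => ?_
    have ht := hT.isTest j
    have e1 : ∫ x in U, inner ℝ (a x (Dw x) - a x (Du x))
        (hgrad (fun x => trunc k (φ (ns j) x)) x) =
          -signedIntegral μ (fun x => trunc k (φ (ns j) x)) := by
      have e2 := integral_sub (integrable_inner_of_memLp hp1 hAw (ht.memLp_hgrad _ U))
        (integrable_inner_of_memLp hp1 hAu (ht.memLp_hgrad _ U))
      rw [ht.setIntegral_inner_sub_const hp1 hAw, ht.setIntegral_inner_sub_const hp1 hAu,
        hw.integral_eq_zero ht, ← ht.setIntegral_inner_hgrad hUΩ, hu.2 _ (ht.mono hUΩ),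
        zero_sub] at e2
      rw [← e2]
      congr 1; ext1 x
      rw [← inner_sub_left]; congr 1; abel
    rw [e1]
    exact (neg_le_abs _).trans (ht.abs_signedIntegral_le
      (fun x => abs_trunc_le hk _) μ)
  have hgm : AEMeasurable (fun x => w x - u x) (volume.restrict U) := hφ.memLp.1.aemeasurable
  have main := lintegral_le_of_le_add
    (G := fun x => coerConst p * (trunc' k (w x - u x) * ‖Dw x - Du x‖ ^ p)) (H := fun _ => 0)
    (integrable_inner_of_memLp hp1 hA hT.memLp_grad) hle
    (((((continuous_trunc' k).measurable.comp_aemeasurable hgm).mul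
      (hφ.memLp_grad.1.norm.aemeasurable.pow_const p)).const_mul _).aestronglyMeasurable)
    (ae_of_all _ fun x => by have := trunc'_nonneg k (w x - u x); positivity)
    aestronglyMeasurable_const (ae_of_all _ fun _ => le_rfl)
    (by
      filter_upwards [ae_restrict_mem hU.measurableSet] with x hx
      rw [add_zero, inner_smul_right, mul_left_comm]
      exact mul_le_mul_of_nonneg_left (h.monotone_rpow hp (hUΩ hx) (Dw x) (Du x))
        (trunc'_nonneg _ _))
  simp only [ENNReal.ofReal_zero, lintegral_zero, add_zero] at main
  have e1 : ∀ x, ENNReal.ofReal (trunc' k (w x - u x) * ‖Dw x - Du x‖ ^ p) =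
      ENNReal.ofReal (1 / coerConst p) *
        ENNReal.ofReal (coerConst p * (trunc' k (w x - u x) * ‖Dw x - Du x‖ ^ p)) := fun x => by
    rw [← ENNReal.ofReal_mul (by positivity)]; congr 1; field_simp
  simp only [e1]
  rw [lintegral_const_mul' _ _ ENNReal.ofReal_ne_top]
  refine (mul_le_mul_right main _).trans (le_of_eq ?_)
  rw [← ENNReal.ofReal_mul (by positivity)]
  congr 1; field_simp

end

/-! ### The comparison estimates -/

section

open Filter Topology
variable {n : ℕ}

lemma homDim_pos (n : ℕ) : (0 : ℝ) < homDim n := by unfold homDim; positivity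

/-- Comparison of a solution of the measure data problem with the solution of the homogeneous
problem having the same boundary values. -/
lemma exists_comparison_measure (n : ℕ) [NeZero n] {p : ℝ} (hp : 2 ≤ p) :
    ∃ C : ℝ, 0 ≤ C ∧ ∀ {Ω : Set (Pt n)} {a : Pt n → Hor n → Hor n} {L L' s α : ℝ},
      StructureCondition Ω a p L L' s α → 0 ≤ L → 0 ≤ s → IsOpen Ω →
      ∀ {x₀ : Pt n} {R : ℝ}, x₀ ∈ Ω → 0 < R → ccBall x₀ (2 * R) ⊆ Ω →
      ∀ {μ : SignedMeasure (Pt n)} {u w : Pt n → ℝ} {Du Dw : Pt n → Hor n},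
      IsWeakSolution p Ω a μ u Du → IsWeakSolution p (ccBall x₀ (2 * R)) a 0 w Dw →
      MemHWZero p (ccBall x₀ (2 * R)) (fun x => w x - u x) (fun x => Dw x - Du x) →
      ∫⁻ x in ccBall x₀ (2 * R), ‖Dw x - Du x‖ₑ ≤ ENNReal.ofReal (C * R ^ homDim n *
        ((μ.totalVariation (ccBall x₀ (2 * R))).toReal / R ^ (homDim n - 1)) ^ (1 / (p - 1))) := by
  have hp1 : 0 < p - 1 := by linarith
  obtain ⟨C, hC, hgrad⟩ := exists_lintegral_grad_le n hp
  have hc := coerConst_pos p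
  have hQ : 1 ≤ homDim n := by unfold homDim; omega
  refine ⟨C * (2 / coerConst p) ^ (1 / (p - 1)) * 2 ^ homDim n, by positivity, ?_⟩
  intro Ω a L L' s α h hL hs hΩ x₀ R hx₀ hR hUΩ μ u w Du Dw hu hw hwu
  set U := ccBall x₀ (2 * R) with hU
  set M := (μ.totalVariation U).toReal with hM
  have hM0 : 0 ≤ M := ENNReal.toReal_nonneg
  have hUo : IsOpen U := isOpen_ccBall x₀ (2 * R)
  have hUf : volume U ≠ ∞ :=
    ((volume_ccBall_le x₀ (by positivity)).trans_lt ENNReal.ofReal_lt_top).ne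
  obtain ⟨φ, hφ⟩ := hwu.exists_testLimit
  set r := 2 * R with hr
  have hr0 : 0 < r := by positivity
  set X : ℝ → ℝ := fun M' => C * (2 / coerConst p * M' / r ^ (homDim n - p)) ^ (1 / (p - 1)) *
    r ^ ((homDim n : ℝ) - 1) with hX
  have hXle : ∀ M', M < M' → ∫⁻ x in U, ‖Dw x - Du x‖ₑ ≤ ENNReal.ofReal (X M') := by
    intro M' hM'
    have hM'0 : 0 < M' := hM0.trans_lt hM'
    refine hgrad hUo.measurableSet hr0 (ccBall_subset_cbox x₀ r) hφ (by positivity) fun k hk => ?_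
    refine (lintegral_trunc_energy_le h hL hp hs hΩ hUo hUΩ hUf hx₀ hu hw hφ hk).trans
      (ENNReal.ofReal_le_ofReal ?_)
    rw [← Real.rpow_mul (by positivity), one_div_mul_cancel hp1.ne', Real.rpow_one,
      div_mul_cancel₀ _ (by positivity)]
    gcongr
  -- The height `k₀` has to be positive, so that the total mass is first enlarged.
  have hXc : Continuous X := by
    refine (continuous_const.mul (Continuous.rpow_const (by fun_prop) fun _ => Or.inr ?_)).mul
      continuous_const
    positivity
  have hlim : Tendsto (fun M' => ENNReal.ofReal (X M')) (𝓝[>] M) (𝓝 (ENNReal.ofReal (X M))) :=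
    (ENNReal.continuous_ofReal.comp hXc).continuousWithinAt
  have hfin : ∫⁻ x in U, ‖Dw x - Du x‖ₑ ≤ ENNReal.ofReal (X M) :=
    ge_of_tendsto hlim (eventually_nhdsWithin_of_forall hXle)
  refine hfin.trans (ENNReal.ofReal_le_ofReal ?_)
  have e1 : 2 / coerConst p * M / r ^ (homDim n - p) =
      2 / coerConst p * (M / r ^ (homDim n - 1)) * r ^ (p - 1) := by
    have e2 : r ^ (homDim n - p) * r ^ (p - 1) = r ^ (homDim n - 1) := by
      rw [← Real.rpow_add hr0, ← Real.rpow_natCast, Nat.cast_sub hQ, Nat.cast_one]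
      congr 1; ring
    rw [← e2]; field_simp
  have e3 : r * r ^ ((homDim n : ℝ) - 1) = r ^ homDim n := by
    rw [← Real.rpow_one_add' hr0.le (by simpa using (homDim_pos n).ne'), ← Real.rpow_natCast]
    congr 1; ring
  have hRr : R ≤ r := by rw [hr]; linarith
  simp only [hX]
  rw [e1, Real.mul_rpow (by positivity) (by positivity), Real.mul_rpow (by positivity)
    (by positivity), ← Real.rpow_mul hr0.le, mul_one_div_cancel hp1.ne', Real.rpow_one]
  calc C * ((2 / coerConst p) ^ (1 / (p - 1)) * (M / r ^ (homDim n - 1)) ^ (1 / (p - 1)) * r) *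
        r ^ ((homDim n : ℝ) - 1)
      = C * (2 / coerConst p) ^ (1 / (p - 1)) * (M / r ^ (homDim n - 1)) ^ (1 / (p - 1)) *
        (r * r ^ ((homDim n : ℝ) - 1)) := by ring
    _ ≤ C * (2 / coerConst p) ^ (1 / (p - 1)) * (M / R ^ (homDim n - 1)) ^ (1 / (p - 1)) *
        (r * r ^ ((homDim n : ℝ) - 1)) := by gcongr
    _ = _ := by rw [e3, hr, mul_pow]; ring

/-- The energy estimate for the difference of the solutions of the frozen and of the original
homogeneous equation, both tested with `v - w`. -/
lemma lintegral_frozen_energy_le {Ω : Set (Pt n)} {a : Pt n → Hor n → Hor n}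
    {p L L' s α : ℝ} (h : StructureCondition Ω a p L L' s α) (hL : 0 ≤ L) (hp : 2 ≤ p)
    (hs : 0 ≤ s) (hL' : 0 ≤ L') (hΩ : IsOpen Ω) {U V : Set (Pt n)} (hU : IsOpen U) (hUΩ : U ⊆ Ω)
    (hUf : volume U ≠ ∞) (hV : IsOpen V) (hVU : V ⊆ U) {x₀ : Pt n} (hx₀ : x₀ ∈ Ω) {κ : ℝ}
    (hκ : ∀ x ∈ V, L' * ccDist x₀ x ^ α ≤ κ) {w v : Pt n → ℝ} {Dw Dv : Pt n → Hor n}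
    (hw : IsWeakSolution p U a 0 w Dw) (hv : IsWeakSolution p V (fun _ => a x₀) 0 v Dv)
    (hvw : MemHWZero p V (fun x => v x - w x) (fun x => Dv x - Dw x)) :
    ∫⁻ x in V, ENNReal.ofReal (coerConst p / 2 * ‖Dv x - Dw x‖ ^ p) ≤
      ∫⁻ x in V, ENNReal.ofReal (κ ^ 2 / (2 * monoConst p) * (‖Dw x‖ + s) ^ p) := by
  have hp1 : 1 < p := by linarith
  have hc := coerConst_pos p
  have hm := monoConst_pos p
  obtain ⟨φ, hφ⟩ := hvw.exists_testLimit
  have hVf : volume V ≠ ∞ := ((measure_mono hVU).trans_lt hUf.lt_top).ne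
  have hAw := h.memLp_sub hL hp hs hΩ hU.measurableSet hUΩ hUf hx₀ hw.1.2.1
  have hAwV := hAw.mono_measure (Measure.restrict_mono hVU le_rfl)
  have hAv := (h.frozen hL' hx₀).memLp_sub hL hp hs hΩ hV.measurableSet (hVU.trans hUΩ) hVf hx₀
    hv.1.2.1
  have h1 := hφ.integral_inner_eq_zero hp1 hVU (A := fun x => a x (Dw x)) hAw
    fun ψ hψ => hw.integral_eq_zero hψ
  have h2 := hφ.integral_inner_eq_zero hp1 subset_rfl (A := fun x => a x₀ (Dv x)) hAv
    fun ψ hψ => hv.integral_eq_zero hψ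
  have i1 := integrable_inner_of_memLp hp1 hAwV hφ.memLp_grad
  have i2 := integrable_inner_of_memLp hp1 hAv hφ.memLp_grad
  have h3 := integral_sub i2 i1
  rw [h1, h2, sub_zero] at h3
  have main := lintegral_le_of_le_add (M := 0)
    (G := fun x => coerConst p / 2 * ‖Dv x - Dw x‖ ^ p)
    (H := fun x => κ ^ 2 / (2 * monoConst p) * (‖Dw x‖ + s) ^ p) (i2.sub i1) h3.le
    ((hφ.memLp_grad.1.norm.aemeasurable.pow_const p).const_mul _).aestronglyMeasurable
    (ae_of_all _ fun x => by positivity)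
    ((((hw.1.mono hVU).2.1.1.norm.aemeasurable.add_const s).pow_const
      p).const_mul _).aestronglyMeasurable
    (ae_of_all _ fun x => by positivity)
    (by
      filter_upwards [ae_restrict_mem hV.measurableSet] with x hx
      have hκx := hκ x hx
      have h4 := h.frozen_comparison hp hs (hUΩ (hVU hx)) hx₀ hκx (Dv x) (Dw x)
      have e : inner ℝ (a x₀ (Dv x) - a x (Dw x)) (Dv x - Dw x) =
          inner ℝ (a x₀ (Dv x) - a x₀ 0) (Dv x - Dw x) -
            inner ℝ (a x (Dw x) - a x₀ 0) (Dv x - Dw x) := by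
        rw [← inner_sub_left]; congr 1; abel
      rw [e] at h4
      refine le_trans (le_of_eq ?_) h4
      unfold coerConst; ring)
  rwa [ENNReal.ofReal_zero, zero_add] at main

/-- Comparison of the solutions of the frozen and of the original homogeneous equation. The energy
estimate bounds the difference in `L^p` by the `L^p` norm of `𝔛 w`, which the reverse Hölder
inequality bounds by its `L^1` norm on the larger ball. -/
lemma exists_comparison_frozen (n : ℕ) [NeZero n] {p L : ℝ} (hp : 2 ≤ p) (hL : 0 ≤ L) :
    ∃ C : ℝ, 0 ≤ C ∧ ∀ {Ω : Set (Pt n)} {a : Pt n → Hor n → Hor n} {L' s α : ℝ},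
      StructureCondition Ω a p L L' s α → 0 ≤ L' → 0 ≤ s → 0 ≤ α → IsOpen Ω →
      ∀ {x₀ : Pt n} {R : ℝ}, x₀ ∈ Ω → 0 < R → ccBall x₀ (2 * R) ⊆ Ω →
      ∀ {w v : Pt n → ℝ} {Dw Dv : Pt n → Hor n},
      IsWeakSolution p (ccBall x₀ (2 * R)) a 0 w Dw →
      IsWeakSolution p (ccBall x₀ R) (fun _ => a x₀) 0 v Dv →
      MemHWZero p (ccBall x₀ R) (fun x => v x - w x) (fun x => Dv x - Dw x) →
      ∫⁻ x in ccBall x₀ R, ‖Dv x - Dw x‖ₑ ≤ ENNReal.ofReal (C * (L' * R ^ α) ^ (2 / p)) *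
        ∫⁻ x in ccBall x₀ (2 * R), (‖Dw x‖ₑ + ENNReal.ofReal s) := by
  have hp0 : 0 < p := by linarith
  have hp1 : 1 ≤ p := by linarith
  have hpp : 0 ≤ (p - 1) / p := div_nonneg (by linarith) hp0.le
  have hc := coerConst_pos p
  have hm := monoConst_pos p
  have hb := boxVol_pos n
  obtain ⟨C, hC, hrev⟩ := exists_reverse_holder n hp hc hL
  set N := nashExp n p with hN
  set D := 2 / coerConst p * (1 / (2 * monoConst p)) * 2 ^ p with hD
  have hD0 : 0 < D := by positivity
  set T := boxVol n ^ (1 / p) / (boxVol n * (1 / 19) ^ homDim n) with hT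
  refine ⟨boxVol n ^ ((p - 1) / p) * D ^ (1 / p) * (T + C), by positivity, ?_⟩
  intro Ω a L' s α h hL' hs hα hΩ x₀ R hx₀ hR hUΩ w v Dw Dv hw hv hvw
  set κ := L' * R ^ α with hκ
  have hκ0 : 0 ≤ κ := by positivity
  set U := ccBall x₀ (2 * R) with hU
  set V := ccBall x₀ R with hV
  have hUo : IsOpen U := isOpen_ccBall x₀ (2 * R)
  have hVo : IsOpen V := isOpen_ccBall x₀ R
  have hUf : volume U ≠ ∞ :=
    ((volume_ccBall_le x₀ (by positivity)).trans_lt ENNReal.ofReal_lt_top).ne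
  have hVU : V ⊆ U := fun x hx => by
    have h1 : ccDist x₀ x < R := hx
    exact h1.trans (by linarith)
  have hVf : volume V ≠ ∞ := ((measure_mono hVU).trans_lt hUf.lt_top).ne
  have hVle : volume V ≤ ENNReal.ofReal (boxVol n * R ^ homDim n) := volume_ccBall_le x₀ hR
  set vV := (volume V).toReal with hvV
  have hvVe : volume V = ENNReal.ofReal vV := (ENNReal.ofReal_toReal hVf).symm
  have hvV0 : 0 ≤ vV := ENNReal.toReal_nonneg
  have hvVle : vV ≤ boxVol n * R ^ homDim n := ENNReal.toReal_le_of_le_ofReal (by positivity) hVle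
  set I := ∫⁻ x in U, (‖Dw x‖ₑ + ENNReal.ofReal s) with hI
  have hen := lintegral_frozen_energy_le h hL hp hs hL' hΩ hUo hUΩ hUf hVo hVU hx₀
    (κ := κ) (fun x hx => by
      have h1 : ccDist x₀ x < R := hx
      have h2 := ccDist_nonneg x₀ x
      rw [hκ]; gcongr) hw hv hvw
  have hp' : ∫⁻ x in V, ‖Dv x - Dw x‖ₑ ^ p ≤
      ENNReal.ofReal (D * κ ^ 2) * ∫⁻ x in V, ENNReal.ofReal (s ^ p + 1 ^ p * |‖Dw x‖| ^ p) := by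
    have e1 : ∀ x, ‖Dv x - Dw x‖ₑ ^ p = ENNReal.ofReal (2 / coerConst p) *
        ENNReal.ofReal (coerConst p / 2 * ‖Dv x - Dw x‖ ^ p) := fun x => by
      rw [← ENNReal.ofReal_mul (by positivity), ← ofReal_norm,
        ENNReal.ofReal_rpow_of_nonneg (norm_nonneg _) hp0.le]
      congr 1; field_simp
    simp only [e1]
    rw [lintegral_const_mul' _ _ ENNReal.ofReal_ne_top]
    refine (mul_le_mul_right hen _).trans ?_
    rw [← lintegral_const_mul' (ENNReal.ofReal (2 / coerConst p)) _ ENNReal.ofReal_ne_top,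
      ← lintegral_const_mul' (ENNReal.ofReal (D * κ ^ 2)) _ ENNReal.ofReal_ne_top]
    refine lintegral_mono fun x => ?_
    rw [← ENNReal.ofReal_mul (by positivity), ← ENNReal.ofReal_mul (by positivity)]
    refine ENNReal.ofReal_le_ofReal ?_
    have h1 := add_rpow_le hp1 (norm_nonneg (Dw x)) hs
    rw [Real.one_rpow, one_mul, abs_norm, hD, add_comm (s ^ p)]
    calc 2 / coerConst p * (κ ^ 2 / (2 * monoConst p) * (‖Dw x‖ + s) ^ p)
        ≤ 2 / coerConst p * (κ ^ 2 / (2 * monoConst p) * (2 ^ p * (‖Dw x‖ ^ p + s ^ p))) := by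
          gcongr
      _ = _ := by field_simp
  have hroot : (∫⁻ x in V, ‖Dv x - Dw x‖ₑ ^ p) ^ (1 / p) ≤
      ENNReal.ofReal (D ^ (1 / p) * κ ^ (2 / p)) * (ENNReal.ofReal (s * vV ^ (1 / p)) +
        (∫⁻ x in V, ‖Dw x‖ₑ ^ p) ^ (1 / p)) := by
    have h1 := rpow_one_div_le_of_lintegral hp1 hs zero_le_one (by positivity : 0 ≤ D * κ ^ 2)
      (fun x => ‖Dw x‖) hvV0 hvVe
    have h2 := (ENNReal.rpow_le_rpow hp' (show 0 ≤ 1 / p by positivity)).trans h1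
    simp only [enorm_norm, ENNReal.ofReal_one, one_mul] at h2
    have e2 : (D * κ ^ 2) ^ (1 / p) = D ^ (1 / p) * κ ^ (2 / p) := by
      rw [Real.mul_rpow hD0.le (by positivity), ← Real.rpow_natCast, ← Real.rpow_mul hκ0]
      congr 2; push_cast; ring
    rwa [e2] at h2
  have hrev' := hrev hs x₀ R hR (hw.isCoerciveSolution h hL hp hs hΩ hUo hUΩ hUf hx₀)
  have hsI : ENNReal.ofReal (s * (boxVol n * (1 / 19 * R) ^ homDim n)) ≤ I := by
    have h1 : ∫⁻ x in U, ENNReal.ofReal s ≤ I := lintegral_mono fun x => le_add_self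
    rw [lintegral_const, Measure.restrict_apply_univ] at h1
    refine le_trans ?_ h1
    rw [ENNReal.ofReal_mul hs]
    gcongr
    have h2 := le_volume_ccBall x₀ (by positivity : 0 < 2 * R)
    have e3 : 2 * R / 38 = 1 / 19 * R := by ring
    rwa [e3] at h2
  have hRN : R ^ N * (R ^ homDim n) ^ (1 / p) = R ^ homDim n := by
    rw [← Real.rpow_natCast, ← Real.rpow_mul hR.le, ← Real.rpow_add hR, hN, nashExp]
    congr 1; field_simp; ring
  have hsT : ENNReal.ofReal (R ^ N) * ENNReal.ofReal (s * vV ^ (1 / p)) ≤ ENNReal.ofReal T * I := by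
    refine le_trans ?_ (mul_le_mul_right hsI _)
    rw [← ENNReal.ofReal_mul (by positivity), ← ENNReal.ofReal_mul (by positivity)]
    refine ENNReal.ofReal_le_ofReal ?_
    calc R ^ N * (s * vV ^ (1 / p)) ≤ R ^ N * (s * (boxVol n * R ^ homDim n) ^ (1 / p)) := by
          gcongr
      _ = s * boxVol n ^ (1 / p) * (R ^ N * (R ^ homDim n) ^ (1 / p)) := by
          rw [Real.mul_rpow hb.le (by positivity)]; ring
      _ = _ := by rw [hRN, hT, mul_pow]; field_simp
  have hmeas : AEMeasurable (fun x => ‖Dv x - Dw x‖ₑ) (volume.restrict V) := hvw.1.2.1.1.enorm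
  calc ∫⁻ x in V, ‖Dv x - Dw x‖ₑ
      ≤ (∫⁻ x in V, ‖Dv x - Dw x‖ₑ ^ p) ^ (1 / p) * volume V ^ ((p - 1) / p) := by
        have := lintegral_le_rpow_mul_measure (by linarith : 1 < p) hmeas
        rwa [Measure.restrict_apply_univ] at this
    _ ≤ (ENNReal.ofReal (D ^ (1 / p) * κ ^ (2 / p)) * (ENNReal.ofReal (s * vV ^ (1 / p)) +
        (∫⁻ x in V, ‖Dw x‖ₑ ^ p) ^ (1 / p))) *
          ENNReal.ofReal (boxVol n ^ ((p - 1) / p) * R ^ N) := by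
        refine mul_le_mul' hroot ((ENNReal.rpow_le_rpow hVle hpp).trans (le_of_eq ?_))
        rw [ENNReal.ofReal_rpow_of_pos (by positivity), Real.mul_rpow hb.le (by positivity),
          ← Real.rpow_natCast, ← Real.rpow_mul hR.le, hN, nashExp]
    _ = ENNReal.ofReal (boxVol n ^ ((p - 1) / p) * D ^ (1 / p) * κ ^ (2 / p)) *
        (ENNReal.ofReal (R ^ N) * ENNReal.ofReal (s * vV ^ (1 / p)) +
          ENNReal.ofReal (R ^ N) * (∫⁻ x in V, ‖Dw x‖ₑ ^ p) ^ (1 / p)) := by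
        rw [mul_assoc (boxVol n ^ ((p - 1) / p)), ENNReal.ofReal_mul (p := boxVol n ^ ((p - 1) / p))
          (by positivity), ENNReal.ofReal_mul (p := boxVol n ^ ((p - 1) / p)) (by positivity)]
        ring
    _ ≤ ENNReal.ofReal (boxVol n ^ ((p - 1) / p) * D ^ (1 / p) * κ ^ (2 / p)) *
        (ENNReal.ofReal T * I + ENNReal.ofReal C * I) := by gcongr
    _ = _ := by
        rw [← add_mul, ← ENNReal.ofReal_add (by positivity) hC, ← mul_assoc,
          ← ENNReal.ofReal_mul (by positivity)]
        congr 2; ring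

/-- The comparison estimate, before division by the measures of the balls. -/
lemma exists_comparison (n : ℕ) [NeZero n] {p L : ℝ} (hp : 2 ≤ p) (hL : 0 ≤ L) :
    ∃ C : ℝ, 0 ≤ C ∧ ∀ {Ω : Set (Pt n)} {a : Pt n → Hor n → Hor n} {L' s α : ℝ},
      StructureCondition Ω a p L L' s α → 0 ≤ L' → 0 ≤ s → 0 ≤ α → IsOpen Ω →
      ∀ {x₀ : Pt n} {R : ℝ}, x₀ ∈ Ω → 0 < R → ccBall x₀ (2 * R) ⊆ Ω →
      ∀ {μ : SignedMeasure (Pt n)} {u w v : Pt n → ℝ} {Du Dw Dv : Pt n → Hor n},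
      IsWeakSolution p Ω a μ u Du → IsWeakSolution p (ccBall x₀ (2 * R)) a 0 w Dw →
      MemHWZero p (ccBall x₀ (2 * R)) (fun x => w x - u x) (fun x => Dw x - Du x) →
      IsWeakSolution p (ccBall x₀ R) (fun _ => a x₀) 0 v Dv →
      MemHWZero p (ccBall x₀ R) (fun x => v x - w x) (fun x => Dv x - Dw x) →
      ∫ x in ccBall x₀ R, ‖Dv x - Du x‖ ≤
        C * (L' * R ^ α) ^ (2 / p) * (∫ x in ccBall x₀ (2 * R), (‖Du x‖ + s)) +
        C * (1 + (L' * R ^ α) ^ (2 / p)) * (R ^ homDim n *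
          ((μ.totalVariation (ccBall x₀ (2 * R))).toReal / R ^ (homDim n - 1)) ^
            (1 / (p - 1))) := by
  have hp1 : 1 ≤ p := by linarith
  obtain ⟨C₁, hC₁, hm⟩ := exists_comparison_measure n hp
  obtain ⟨C₂, hC₂, hf⟩ := exists_comparison_frozen n hp hL
  refine ⟨C₁ + C₂ + C₂ * C₁, by positivity, ?_⟩
  intro Ω a L' s α h hL' hs hα hΩ x₀ R hx₀ hR hUΩ μ u w v Du Dw Dv hu hw hwu hv hvw
  have h1 := hm h hL hs hΩ hx₀ hR hUΩ hu hw hwu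
  have h2 := hf h hL' hs hα hΩ hx₀ hR hUΩ hw hv hvw
  set U := ccBall x₀ (2 * R) with hU
  set V := ccBall x₀ R with hV
  set κ := (L' * R ^ α) ^ (2 / p) with hκ
  have hκ0 : 0 ≤ κ := by positivity
  set Y := ((μ.totalVariation U).toReal / R ^ (homDim n - 1)) ^ (1 / (p - 1)) with hY
  have hY0 : 0 ≤ Y := by positivity
  have hVU : V ⊆ U := fun x hx => by
    have h1 : ccDist x₀ x < R := hx
    exact h1.trans (by linarith)
  have hUf : volume U ≠ ∞ :=
    ((volume_ccBall_le x₀ (by positivity)).trans_lt ENNReal.ofReal_lt_top).ne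
  have hUfin : IsFiniteMeasure (volume.restrict U) := isFiniteMeasure_restrict.2 hUf
  have hDu := hu.1.2.1.mono_measure (Measure.restrict_mono hUΩ le_rfl)
  have hint : Integrable (fun x => ‖Du x‖ + s) (volume.restrict U) :=
    (hDu.integrable (by simpa using hp1)).norm.add (integrable_const s)
  have h3 : ∫⁻ x in U, (‖Du x‖ₑ + ENNReal.ofReal s) = ENNReal.ofReal (∫ x in U, (‖Du x‖ + s)) := by
    rw [ofReal_integral_eq_lintegral_ofReal hint (ae_of_all _ fun x => by positivity)]
    refine lintegral_congr fun x => ?_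
    rw [ENNReal.ofReal_add (norm_nonneg _) hs, ofReal_norm]
  have hI0 : 0 ≤ ∫ x in U, (‖Du x‖ + s) := integral_nonneg fun x => by positivity
  have hmU : AEMeasurable (fun x => ‖Dw x - Du x‖ₑ) (volume.restrict U) := hwu.1.2.1.1.enorm
  have h4 : ∫⁻ x in U, (‖Dw x‖ₑ + ENNReal.ofReal s) ≤
      ENNReal.ofReal (C₁ * R ^ homDim n * Y) + ENNReal.ofReal (∫ x in U, (‖Du x‖ + s)) := by
    rw [← h3]
    refine le_trans (lintegral_mono (g := fun x => ‖Dw x - Du x‖ₑ +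
      (‖Du x‖ₑ + ENNReal.ofReal s)) fun x => ?_) ?_
    · dsimp only
      rw [← add_assoc]
      gcongr
      simpa using enorm_add_le (Dw x - Du x) (Du x)
    · rw [lintegral_add_left' hmU]
      gcongr
  have hmV : AEMeasurable (fun x => ‖Dv x - Dw x‖ₑ) (volume.restrict V) := hvw.1.2.1.1.enorm
  have h5 : ∫⁻ x in V, ‖Dv x - Du x‖ₑ ≤
      (∫⁻ x in V, ‖Dv x - Dw x‖ₑ) + ∫⁻ x in U, ‖Dw x - Du x‖ₑ := by
    refine le_trans (lintegral_mono (g := fun x => ‖Dv x - Dw x‖ₑ + ‖Dw x - Du x‖ₑ) fun x => ?_) ?_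
    · simpa using enorm_add_le (Dv x - Dw x) (Dw x - Du x)
    · rw [lintegral_add_left' hmV]
      gcongr
  have h6 : ∫⁻ x in V, ‖Dv x - Du x‖ₑ ≤ ENNReal.ofReal (C₂ * κ * (C₁ * R ^ homDim n * Y +
      ∫ x in U, (‖Du x‖ + s)) + C₁ * R ^ homDim n * Y) := by
    refine h5.trans ?_
    rw [ENNReal.ofReal_add (by positivity) (by positivity), ENNReal.ofReal_mul (by positivity),
      ENNReal.ofReal_add (by positivity) hI0]
    exact add_le_add (h2.trans (mul_le_mul_right h4 _)) h1
  have hsm : AEStronglyMeasurable (fun x => Dv x - Du x) (volume.restrict V) :=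
    hv.1.2.1.1.sub (hDu.1.mono_measure (Measure.restrict_mono hVU le_rfl))
  rw [integral_norm_eq_lintegral_enorm hsm]
  refine (ENNReal.toReal_le_of_le_ofReal (by positivity) h6).trans ?_
  have hRY : 0 ≤ R ^ homDim n * Y := by positivity
  set J := ∫ x in U, (‖Du x‖ + s)
  have e1 : 0 ≤ κ * J := by positivity
  have e2 : 0 ≤ κ * (R ^ homDim n * Y) := by positivity
  have e3 : 0 ≤ C₂ * C₁ := by positivity
  nlinarith [mul_nonneg hC₁ e1, mul_nonneg e3 e1, mul_nonneg hC₂ hRY, mul_nonneg e3 hRY,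
    mul_nonneg hC₁ e2, mul_nonneg hC₂ e2]

end

end

end Heis

theorem corollary3p6 (n : ℕ) (hn : 1 ≤ n) (p L : ℝ) (hp : 2 ≤ p) (hL : 1 ≤ L) :
    ∃ c : ℝ, 0 < c ∧
      ∀ (L' s α : ℝ), 1 ≤ L' → 0 ≤ s → 0 < α → α ≤ 1 →
      ∀ (Ω : Set (Heis.Pt n)), IsOpen Ω → IsConnected Ω →
      ∀ (a : Heis.Pt n → Heis.Hor n → Heis.Hor n), Heis.StructureCondition Ω a p L L' s α →
      ∀ (μ : SignedMeasure (Heis.Pt n)), μ.totalVariation Ωᶜ = 0 →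
      ∀ (u : Heis.Pt n → ℝ) (Du : Heis.Pt n → Heis.Hor n), Heis.IsWeakSolution p Ω a μ u Du →
      ∀ (x₀ : Heis.Pt n) (R : ℝ), x₀ ∈ Ω → 0 < R → Heis.ccBall x₀ (2 * R) ⊆ Ω →
      ∀ (w : Heis.Pt n → ℝ) (Dw : Heis.Pt n → Heis.Hor n),
        Heis.IsWeakSolution p (Heis.ccBall x₀ (2 * R)) a 0 w Dw →
        Heis.MemHWZero p (Heis.ccBall x₀ (2 * R)) (fun x => w x - u x) (fun x => Dw x - Du x) →
      ∀ (v : Heis.Pt n → ℝ) (Dv : Heis.Pt n → Heis.Hor n),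
        Heis.IsWeakSolution p (Heis.ccBall x₀ R) (fun _ => a x₀) 0 v Dv →
        Heis.MemHWZero p (Heis.ccBall x₀ R) (fun x => v x - w x) (fun x => Dv x - Dw x) →
        ⨍ x in Heis.ccBall x₀ R, ‖Dv x - Du x‖ ≤
          c * (1 + (L' * R ^ α) ^ (2 / p)) *
              ((μ.totalVariation (Heis.ccBall x₀ (2 * R))).toReal /
                R ^ (Heis.homDim n - 1)) ^ (1 / (p - 1)) +
            c * (L' * R ^ α) ^ (2 / p) * ⨍ x in Heis.ccBall x₀ (2 * R), (‖Du x‖ + s) := by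
  have hn0 : NeZero n := ⟨by omega⟩
  have hb := Heis.boxVol_pos n
  obtain ⟨C, hC, hcomp⟩ := Heis.exists_comparison n hp (by linarith : 0 ≤ L)
  set Q := Heis.homDim n with hQ
  refine ⟨C * (38 ^ Q / Heis.boxVol n) + C * 76 ^ Q + 1, by positivity, ?_⟩
  intro L' s α hL' hs hα _ Ω hΩ _ a h μ _ u Du hu x₀ R hx₀ hR hUΩ w Dw hw hwu v Dv hv hvw
  have h1 := hcomp h (by linarith) hs hα.le hΩ hx₀ hR hUΩ hu hw hwu hv hvw
  set U := Heis.ccBall x₀ (2 * R) with hU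
  set V := Heis.ccBall x₀ R with hV
  set κ := (L' * R ^ α) ^ (2 / p) with hκ
  have hκ0 : 0 ≤ κ := by positivity
  set Y := ((μ.totalVariation U).toReal / R ^ (Q - 1)) ^ (1 / (p - 1)) with hY
  have hY0 : 0 ≤ Y := by positivity
  set J := ∫ x in U, (‖Du x‖ + s) with hJ
  have hJ0 : 0 ≤ J := integral_nonneg fun x => by positivity
  have hUf : volume U ≠ ∞ :=
    ((Heis.volume_ccBall_le x₀ (by positivity)).trans_lt ENNReal.ofReal_lt_top).ne
  have hVf : volume V ≠ ∞ :=
    ((Heis.volume_ccBall_le x₀ hR).trans_lt ENNReal.ofReal_lt_top).ne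
  have hUle : volume.real U ≤ Heis.boxVol n * (2 * R) ^ Q :=
    ENNReal.toReal_le_of_le_ofReal (by positivity) (Heis.volume_ccBall_le x₀ (by positivity))
  have hVge : Heis.boxVol n * (R / 38) ^ Q ≤ volume.real V :=
    (ENNReal.ofReal_le_iff_le_toReal hVf).1 (Heis.le_volume_ccBall x₀ hR)
  have hUpos : 0 < volume.real U := by
    refine lt_of_lt_of_le (by positivity : 0 < Heis.boxVol n * (2 * R / 38) ^ Q) ?_
    exact (ENNReal.ofReal_le_iff_le_toReal hUf).1 (Heis.le_volume_ccBall x₀ (by positivity))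
  have hVpos : 0 < volume.real V := lt_of_lt_of_le (by positivity) hVge
  rw [setAverage_eq, setAverage_eq, smul_eq_mul, smul_eq_mul, ← hJ, ← div_eq_inv_mul,
    div_le_iff₀ hVpos]
  have hRV : R ^ Q ≤ 38 ^ Q / Heis.boxVol n * volume.real V := by
    have : R ^ Q = 38 ^ Q / Heis.boxVol n * (Heis.boxVol n * (R / 38) ^ Q) := by
      rw [div_pow]; field_simp
    rw [this]; gcongr
  have hUV : J ≤ 76 ^ Q * ((volume.real U)⁻¹ * J) * volume.real V := by
    have h2 : volume.real U ≤ 76 ^ Q * volume.real V := by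
      calc volume.real U ≤ Heis.boxVol n * (2 * R) ^ Q := hUle
        _ = 76 ^ Q * (Heis.boxVol n * (R / 38) ^ Q) := by
            rw [mul_left_comm, ← mul_pow]; congr 2; ring
        _ ≤ _ := by gcongr
    calc J = (volume.real U)⁻¹ * J * volume.real U := by field_simp
      _ ≤ (volume.real U)⁻¹ * J * (76 ^ Q * volume.real V) := by gcongr
      _ = _ := by ring
  set A := (volume.real U)⁻¹ * J with hA
  have hA0 : 0 ≤ A := by positivity
  set c := C * (38 ^ Q / Heis.boxVol n) + C * 76 ^ Q + 1 with hc
  have hc1 : C * (38 ^ Q / Heis.boxVol n) ≤ c := by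
    have : 0 ≤ C * 76 ^ Q := by positivity
    linarith
  have hc2 : C * 76 ^ Q ≤ c := by
    have : 0 ≤ C * (38 ^ Q / Heis.boxVol n) := by positivity
    linarith
  calc ∫ x in V, ‖Dv x - Du x‖ ≤ C * κ * J + C * (1 + κ) * (R ^ Q * Y) := h1
    _ ≤ C * κ * (76 ^ Q * A * volume.real V) +
        C * (1 + κ) * ((38 ^ Q / Heis.boxVol n * volume.real V) * Y) := by gcongr
    _ = ((C * (38 ^ Q / Heis.boxVol n)) * (1 + κ) * Y + (C * 76 ^ Q) * κ * A) *
        volume.real V := by ring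
    _ ≤ (c * (1 + κ) * Y + c * κ * A) * volume.real V := by gcongr
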